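/- **Setting.** Let $f_1,\dots,f_n:\mathbb R^m\times\mathbb R^d\to\mathbb R$ be differentiable and, for some $0<\mu\le\beta$, (i) $\mu$-strongly convex-concave: $f_i(x',y)\ge f_i(x,y)+\langle\nabla_xf_i(x,y),x'-x\rangle+\frac\mu2\|x'-x\|^2$ and $-f_i(x,y')\ge -f_i(x,y)-\langle\nabla_yf_i(x,y),y'-y\rangle+\frac\mu2\|y'-y\|^2$; and (ii) $\beta$-smooth: $\nabla_xf_i$ and $\nabla_yf_i$ are each $\beta$-Lipschitz in $x$ (for fixed $y$) and in $y$ (for fixed $x$). No bound on the heterogeneity of the $f_i$ is assumed. Put $f=\frac1n\sum_if_i$, write $z=(x,y)$ with the Euclidean norm, let $z^*=(x^*,y^*)$ be the minimax-optimal point of $f$, i.e. $f(x^*,y)\le f(x^*,y^*)\le f(x,y^*)$ for all $x,y$, and put $G_i=(\nabla_xf_i,-\nabla_yf_i)$. Let $\hat G_i(z)=\hat G_i(z,\xi)$, $\xi\sim\mathcal D_i$, be an unbiased estimate of $G_i(z)$ with variance at most $\sigma^2$. Let $p\in(0,1]$, $\epsilon>0$. **Inner solver SCAFFOLD-S** (objectives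 $h_i$, with gradient mappings and estimates again written $G_i,\hat G_i$, starting point $z^0$, step sizes $\gamma_l,\gamma_g$, $K$ iterations). Start with $\tilde z^0=z_i^0=z^0$. At iteration $k=0,\dots,K-1$ flip a coin with $\Pr(c_k=1)=p$ and put $g_i^k=\hat G_i(z_i^k)-\hat G_i(\tilde z^k)+\frac1n\sum_jG_j(\tilde z^k)$. If $c_k=1$ (a communication round), put $\tilde z^{k+1}=\tilde z^k-\gamma_g\frac1n\sum_i\sum_{l}g_i^l$, with $l$ running over the iterations since the last synchronization, up to $k$, and $z_i^{k+1}=\tilde z^{k+1}$; otherwise $z_i^{k+1}=z_i^k-\gamma_lg_i^k$ and $\tilde z^{k+1}=\tilde z^k$. Coins and samples are fresh in every iteration, and independent over iterations and clients; the two samples that one client uses in one iteration may have any joint law. **Scaled step sizes.** For $\beta'$-smooth, $\mu'$-strongly convex-concave $h_i$ and the solution $h^*$ of $\frac1n\sum_ih_i$, take $\gamma_l=\gamma_g=\gamma>0$ with $$\gamma=\min\Big\{\gamma_{\max},\ \tfrac{1}{c_3\mu'K}\log\max\big\{2,\min\{\tfrac{a\mu'^2K^2}{c_1},\tfrac{a\mu'^3K^3}{c_2}\}\big\}\Big\},\qquad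 \gamma_{\max}=\tfrac{p\mu'}{80\beta'^2},$$ $c_1=\frac{\sigma^2}{2n}$, $c_2=\frac{8\beta'^2\sigma^2}{p\mu'}$, $c_3=\frac18$, $a=\frac12\|z^0-h^*\|^2+\frac{2\beta'^2}{\mu'}H\gamma^3\sigma_0^2$, $\sigma_0^2=\frac1n\sum_i\|G_i(z^0)-G_i(h^*)\|^2$, $H=\frac{64(1-p)(2+p)(8+p)}{12p^3}$ (an equation for $\gamma$, since $a$ depends on $\gamma$; if $\sigma=0$, it reads $\gamma=\gamma_{\max}$). The output is $\frac1{W_K}\sum_{k=0}^Kw_kz^k$, where $z^k=\frac1n\sum_iz_i^k$, $w_k=(1-\frac{\gamma\mu'}8)^{1-k}$, $W_K=\sum_{k=0}^Kw_k$. **SCAFFOLD-Catalyst-S** with $\theta=\beta-\mu$, from $\bar z^0$. At meta-iteration $t$ broadcast $\bar z^t=(\bar x^t,\bar y^t)$ and let $\bar z^{t+1}$ be the output of SCAFFOLD-S with scaled step sizes, started at $\bar z^t$, on the objectives $f_i+\frac\theta2\|x-\bar x^t\|^2-\frac\theta2\|y-\bar y^t\|^2$ (so $\beta'=\beta+\theta$,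 $\mu'=\mu+\theta$, stochastic gradient mappings $\hat G_i(z)+\theta(z-\bar z^t)$), with a number of iterations $K=K(\bar z^t)\ge1$ for which $$\mathbb E_t\|\bar z^{t+1}-P(\bar z^t)\|^2\le\Big(\frac{\mu}{2(\theta+\mu)}\Big)^2\epsilon ,$$ where $P(\bar z^t)$ is the minimax-optimal point of $f+\frac\theta2\|x-\bar x^t\|^2-\frac\theta2\|y-\bar y^t\|^2$ and $\mathbb E_t$ is the expectation conditional on everything up to meta-iteration $t$. The communication rounds are counted as one for each meta-iteration plus one for each coin with $c_k=1$. **Theorem.** There are universal constants $C>0$ and $q\in\mathbb N$ such that, for all data as above, there are a number $T$ of meta-iterations and a (measurable) rule $K(\cdot)\ge1$ for the number of inner iterations such that step sizes as above exist (as a measurable function of the current meta-iterate) and, for every such choice of the step sizes: the displayed inner accuracy holds at every meta-iteration, whatever the value of $\bar z^t$; the output $z'=\bar z^T$ satisfies $\mathbb E\|z'-z^*\|^2\le\epsilon$; and the expected number of communication rounds is at most $$C\,\Lambda^q\Big(\frac{p\beta\sigma^2}{n\mu^3\epsilon}+\frac{p^{1/2}\beta\sigma}{\mu^2\epsilon^{1/2}}+\frac\beta\mu\Big),\qquad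 \Lambda=\log\Big(2+\frac\beta\mu+\frac1p+\frac{\|\bar z^0-z^*\|^2}{\epsilon}+\frac{\sigma^2}{\mu^2\epsilon}\Big),$$ i.e. $\tilde O\big(\frac{p\beta\sigma^2}{n\mu^3\epsilon}+\frac{p^{1/2}\beta\sigma}{\mu^2\epsilon^{1/2}}+\frac\beta\mu\big)$. -/

import Mathlib

open MeasureTheory ProbabilityTheory

namespace FedMinimax

/-- The space `ℝᵐ × ℝᵈ` of points `z = (x, y)`, with its Euclidean norm. -/
abbrev Pt (m d : ℕ) : Type :=
  WithLp 2 (EuclideanSpace ℝ (Fin m) × EuclideanSpace ℝ (Fin d))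

/-- Real functions `g (x, y)` with `x ∈ ℝᵐ`, `y ∈ ℝᵈ`. -/
abbrev Objective (m d : ℕ) : Type :=
  EuclideanSpace ℝ (Fin m) → EuclideanSpace ℝ (Fin d) → ℝ

noncomputable section

variable {m d n : ℕ} {Ξ : Type*}

/-- The partial gradient `∇ₓ g (x, y)`. -/
def gradX (g : Objective m d) (x : EuclideanSpace ℝ (Fin m)) (y : EuclideanSpace ℝ (Fin d)) :
    EuclideanSpace ℝ (Fin m) :=
  gradient (fun x' => g x' y) x

/-- The partial gradient `∇_y g (x, y)`. -/
def gradY (g : Objective m d) (x : EuclideanSpace ℝ (Fin m)) (y : EuclideanSpace ℝ (Fin d)) :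
    EuclideanSpace ℝ (Fin d) :=
  gradient (fun y' => g x y') y

/-- The gradient mapping `z ↦ (∇ₓ g (z), -∇_y g (z))`. -/
def gradMap (g : Objective m d) (z : Pt m d) : Pt m d :=
  WithLp.toLp 2 (gradX g z.fst z.snd, -gradY g z.fst z.snd)

/-- `g` is `μ`-strongly convex-concave. -/
def IsStronglyConvexConcave (μ : ℝ) (g : Objective m d) : Prop :=
  (∀ x x' y, g x y + inner ℝ (gradX g x y) (x' - x) + μ / 2 * ‖x' - x‖ ^ 2 ≤ g x' y) ∧
  (∀ x y y', -g x y + inner ℝ (-gradY g x y) (y' - y) + μ / 2 * ‖y' - y‖ ^ 2 ≤ -g x y')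

/-- `g` is `β`-smooth: it is differentiable and each partial gradient is `β`-Lipschitz in each of
the two variables. -/
def IsSmooth (β : ℝ) (g : Objective m d) : Prop :=
  Differentiable ℝ
    (fun q : EuclideanSpace ℝ (Fin m) × EuclideanSpace ℝ (Fin d) => g q.1 q.2) ∧
  (∀ x x' y, ‖gradX g x y - gradX g x' y‖ ≤ β * ‖x - x'‖) ∧
  (∀ x y y', ‖gradY g x y - gradY g x y'‖ ≤ β * ‖y - y'‖) ∧
  (∀ x y y', ‖gradX g x y - gradX g x y'‖ ≤ β * ‖y - y'‖) ∧
  (∀ x x' y, ‖gradY g x y - gradY g x' y‖ ≤ β * ‖x - x'‖)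

/-- `z = (x*, y*)` is minimax-optimal for `g`: `g (x*, y) ≤ g (x*, y*) ≤ g (x, y*)`. -/
def IsMinimaxOptimal (g : Objective m d) (z : Pt m d) : Prop :=
  ∀ x y, g z.fst y ≤ g z.fst z.snd ∧ g z.fst z.snd ≤ g x z.snd

/-- The global objective `f = (1 / n) ∑ᵢ fᵢ`. -/
def globalObjective (f : Fin n → Objective m d) : Objective m d :=
  fun x y => (1 / (n : ℝ)) * ∑ i, f i x y

/-- The regularized function `g (x, y) + θ / 2 ‖x - x̄‖² - θ / 2 ‖y - ȳ‖²` with centre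
`w = (x̄, ȳ)`. -/
def regularized (θ : ℝ) (w : Pt m d) (g : Objective m d) : Objective m d :=
  fun x y => g x y + θ / 2 * ‖x - w.fst‖ ^ 2 - θ / 2 * ‖y - w.snd‖ ^ 2

/-- The proximal point of `w`: the minimax-optimal point of `g` regularized around `w`. For
`θ > 0` this is `prox_{(1/θ) g} (w)`; for `θ = 0` it is the minimax-optimal point of `g`. -/
def prox (θ : ℝ) (g : Objective m d) (w : Pt m d) : Pt m d :=
  Classical.epsilon (IsMinimaxOptimal (regularized θ w g))

/-- `Ghat · ξ`, with `ξ ∼ D`, is an unbiased estimate of the map `G` with variance at most `σ²`. -/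
structure IsUnbiasedEstimate [MeasurableSpace Ξ] (G : Pt m d → Pt m d)
    (Ghat : Pt m d → Ξ → Pt m d) (D : Measure Ξ) (σ : ℝ) : Prop where
  measurable : Measurable (Function.uncurry Ghat)
  memLp : ∀ z, MemLp (Ghat z) 2 D
  unbiased : ∀ z, ∫ ξ, Ghat z ξ ∂D = G z
  variance_le : ∀ z, ∫ ξ, ‖Ghat z ξ - G z‖ ^ 2 ∂D ≤ σ ^ 2

/-! ### The inner solver SCAFFOLD-S -/

/-- The randomness of one iteration: the coin (`true` means that the clients communicate) and, for
each client, the samples used by its two stochastic gradient evaluations, the first at the client's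
own iterate and the second at the last synchronized iterate. -/
abbrev StepSample (n : ℕ) (Ξ : Type*) : Type _ := Bool × (Fin n → Ξ × Ξ)

/-- The law of a coin that shows `true` with probability `p`. -/
def coinLaw (p : ℝ) : Measure Bool :=
  ENNReal.ofReal p • Measure.dirac true + ENNReal.ofReal (1 - p) • Measure.dirac false

/-- The law of the randomness of one iteration: the coin and the samples of the clients are
independent, and the two samples of client `i` have joint law `π i`. -/
def stepLaw [MeasurableSpace Ξ] (p : ℝ) (π : Fin n → Measure (Ξ × Ξ)) :
    Measure (StepSample n Ξ) :=
  (coinLaw p).prod (Measure.pi π)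

/-- State of the solver: client iterates `zᵢᵏ`, last synchronized iterate `z̃ᵏ`, and for each
client the sum of its directions `gᵢˡ` since the last synchronization. -/
structure ScaffoldState (m d n : ℕ) where
  client : Fin n → Pt m d
  sync : Pt m d
  acc : Fin n → Pt m d

/-- One iteration, with local step size `γl`, global step size `γg`, exact gradient mappings `G i`
and stochastic ones `Ghat i`. -/
def scaffoldStep (G : Fin n → Pt m d → Pt m d) (Ghat : Fin n → Pt m d → Ξ → Pt m d)
    (γl γg : ℝ) (s : ScaffoldState m d n) (ω : StepSample n Ξ) : ScaffoldState m d n :=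
  let g : Fin n → Pt m d := fun i =>
    Ghat i (s.client i) (ω.2 i).1 - Ghat i s.sync (ω.2 i).2
      + (1 / (n : ℝ)) • ∑ j, G j s.sync
  let acc' : Fin n → Pt m d := fun i => s.acc i + g i
  if ω.1 = true then
    let z' : Pt m d := s.sync - γg • ((1 / (n : ℝ)) • ∑ i, acc' i)
    { client := fun _ => z', sync := z', acc := fun _ => 0 }
  else
    { client := fun i => s.client i - γl • g i, sync := s.sync, acc := acc' }

/-- The state after `k` iterations from the initial point `z0`, along the samples `ω`. -/
def scaffoldState (G : Fin n → Pt m d → Pt m d) (Ghat : Fin n → Pt m d → Ξ → Pt m d)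
    (γl γg : ℝ) (z0 : Pt m d) (ω : ℕ → StepSample n Ξ) : ℕ → ScaffoldState m d n
  | 0 => { client := fun _ => z0, sync := z0, acc := fun _ => 0 }
  | k + 1 => scaffoldStep G Ghat γl γg (scaffoldState G Ghat γl γg z0 ω k) (ω k)

/-- The output `(1 / W_K) ∑_{k ≤ K} w_k zᵏ` after `K` iterations with `γl = γg = γ`, where `zᵏ` is
the average of the client iterates, `w_k = (1 - γ μ / 8) ^ (1 - k)` and `W_K = ∑_{k ≤ K} w_k`. -/
def scaffoldOutput (G : Fin n → Pt m d → Pt m d) (Ghat : Fin n → Pt m d → Ξ → Pt m d)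
    (μ γ : ℝ) (K : ℕ) (z0 : Pt m d) (ω : ℕ → StepSample n Ξ) : Pt m d :=
  let w : ℕ → ℝ := fun k => (1 - γ * μ / 8) ^ (1 - (k : ℤ))
  let zavg : ℕ → Pt m d := fun k =>
    (1 / (n : ℝ)) • ∑ i, (scaffoldState G Ghat γ γ z0 ω k).client i
  (1 / ∑ k ∈ Finset.range (K + 1), w k) • ∑ k ∈ Finset.range (K + 1), w k • zavg k

/-- The scaled step size for `K` iterations on a `β`-smooth, `μ`-strongly convex-concave problem:
`γ = min {γ_max, log (max {2, min {a μ² K² / c₁, a μ³ K³ / c₂}}) / (c₃ μ K)}`. Here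
`r0sq = ‖z⁰ - z*‖²` and `s0sq = (1 / n) ∑ᵢ ‖Gᵢ (z⁰) - Gᵢ (z*)‖²`. As `a` depends on `γ`, this is an
equation for `γ`. If `σ = 0`, then `c₁ = c₂ = 0`, the two quotients are `+∞` and `γ = γ_max`. -/
def IsScaledStepsize (n : ℕ) (p β μ σ r0sq s0sq : ℝ) (K : ℕ) (γ : ℝ) : Prop :=
  let H : ℝ := 64 * (1 - p) * (2 + p) * (8 + p) / (12 * p ^ 3)
  let a : ℝ := r0sq / 2 + 2 * β ^ 2 / μ * H * γ ^ 3 * s0sq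
  let c₁ : ℝ := σ ^ 2 / (2 * n)
  let c₂ : ℝ := 8 * β ^ 2 * σ ^ 2 / (p * μ)
  let c₃ : ℝ := 1 / 8
  let γmax : ℝ := p * μ / (80 * β ^ 2)
  γ = if σ = 0 then γmax else
    min γmax (Real.log (max 2 (min (a * μ ^ 2 * K ^ 2 / c₁) (a * μ ^ 3 * K ^ 3 / c₂)))
      / (c₃ * μ * K))

/-! ### The outer method SCAFFOLD-Catalyst-S -/

/-- The exact gradient mappings of the subproblem with centre `w`. -/
def subGrad (f : Fin n → Objective m d) (θ : ℝ) (w : Pt m d) (i : Fin n) : Pt m d → Pt m d :=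
  gradMap (regularized θ w (f i))

/-- The stochastic gradient mappings of the subproblem with centre `w`. -/
def subGradHat (Ghat : Fin n → Pt m d → Ξ → Pt m d) (θ : ℝ) (w : Pt m d) (i : Fin n) :
    Pt m d → Ξ → Pt m d :=
  fun z ξ => Ghat i z ξ + θ • (z - w)

/-- The inner solver on the subproblem with centre `w` (which is `(μ + θ)`-strongly
convex-concave), started at `w`. -/
def subSolve (f : Fin n → Objective m d) (Ghat : Fin n → Pt m d → Ξ → Pt m d) (μ θ γ : ℝ)
    (K : ℕ) (w : Pt m d) (ω : ℕ → StepSample n Ξ) : Pt m d :=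
  scaffoldOutput (subGrad f θ w) (subGradHat Ghat θ w) (μ + θ) γ K w ω

/-- `γ` is the scaled step size for `K` iterations on the subproblem with centre `w`, which is
`(β + θ)`-smooth and `(μ + θ)`-strongly convex-concave, has initial point `w` and solution
`prox θ f w`. -/
def IsSubStepsize (f : Fin n → Objective m d) (p β μ σ θ : ℝ) (w : Pt m d) (K : ℕ) (γ : ℝ) :
    Prop :=
  IsScaledStepsize n p (β + θ) (μ + θ) σ
    (‖w - prox θ (globalObjective f) w‖ ^ 2)
    ((1 / (n : ℝ)) *
      ∑ i, ‖subGrad f θ w i w - subGrad f θ w i (prox θ (globalObjective f) w)‖ ^ 2)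
    K γ

/-- The meta-iterates `z̄ᵗ`. When the current meta-iterate is `w`, the inner solver makes `K w`
iterations with step size `γ w`; `ω t k` is the randomness of its `k`-th iteration. -/
def catalystIter (f : Fin n → Objective m d) (Ghat : Fin n → Pt m d → Ξ → Pt m d) (μ θ : ℝ)
    (K : Pt m d → ℕ) (γ : Pt m d → ℝ) (z0 : Pt m d) (ω : ℕ → ℕ → StepSample n Ξ) : ℕ → Pt m d
  | 0 => z0
  | t + 1 =>
    let w := catalystIter f Ghat μ θ K γ z0 ω t
    subSolve f Ghat μ θ (γ w) (K w) w (ω t)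

/-- The number of communication rounds in the first `T` meta-iterations: in each one, the broadcast
of the meta-iterate and the synchronizations of the inner solver. -/
def catalystRounds (f : Fin n → Objective m d) (Ghat : Fin n → Pt m d → Ξ → Pt m d) (μ θ : ℝ)
    (K : Pt m d → ℕ) (γ : Pt m d → ℝ) (z0 : Pt m d) (ω : ℕ → ℕ → StepSample n Ξ) (T : ℕ) : ℕ :=
  ∑ t ∈ Finset.range T,
    (1 + ((Finset.range (K (catalystIter f Ghat μ θ K γ z0 ω t))).filter
      (fun k => (ω t k).1 = true)).card)

end

end FedMinimax

open FedMinimax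

/-! With `θ = β - μ` every subproblem is `β`-strongly monotone and `(2β - μ)`-smooth, so its
condition number is at most 2. The ratio `β / μ` then enters the leading cost once, through the
number of meta-iterations.

Outer loop. The proximal map is the resolvent of the strongly monotone mean gradient map. It
contracts with factor `1 - μ / β` and fixes the saddle point (`norm_prox_sub_prox_le`,
`prox_of_isMinimaxOptimal`). By convexity of the square, one meta-iteration multiplies the expected
squared error by `1 - μ / β` and adds `β / μ` times the inner error. The prescribed inner accuracy
turns this addition into `(μ / β) ε / 4`, hence at most `ε / 4` in total
(`lintegral_norm_catalystIter_sub_sq_le`). About `(β / μ) log` meta-iterations bring the initial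
error below `ε / 2`.

Inner loop. Since the two step sizes agree, a synchronization just averages the local steps
(`scaffoldState_eq_syncState`). The Lyapunov function adds to the squared error of the average a
multiple of the client drift, which a communication resets to zero, and a multiple of the squared
error of the last synchronized point. In the corrected directions the clients differ only through `G
i (zs i) - G i zt`, which is controlled by distances; no heterogeneity term appears
(`average_drift_step_sq_le`). One iteration contracts the Lyapunov function by `1 - γ a / 4` up to
noise. The noise in the average is divided by `n`; the noise in the drift is not, but it carries one
more power of `γ`.

Step size and iteration count. The implicit step size is a fixed point of a monotone continuous map,
and the quantity `a` in it stays within a factor two of the squared initial distance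
(`stepsizeA_mem`). With `s = σ / (μ √ε)`, a count of order `(1 / p + s² / n + s / √p) log` reaches
the inner accuracy (`scaled_error_le_accuracy`).

Rounds. A meta-iteration costs one broadcast plus `p` times the expected count. The count depends on
the random meta-iterate only through a logarithm, which is replaced by a tangent line so that second
moments suffice (`iterCount_le_affine`). Multiplying the count by `p` and by `β / μ` gives the three
terms of the bound (`p_mul_countFactor`, `rounds_le`).

Expectations are handled as lower Lebesgue integrals. Conditioning on the past is replaced by
freezing an independent variable (`lintegral_comp_indepFun`). -/

namespace FedMinimax

/-! ### Gradient mappings: calculus, Lipschitz bound, strong monotonicity, saddle points as zeros.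
-/

section GradientMappings

variable {m d n : ℕ}

lemma hasGradientAt_half_sq {F : Type*} [NormedAddCommGroup F] [InnerProductSpace ℝ F]
    [CompleteSpace F] (θ : ℝ) (c x : F) :
    HasGradientAt (fun x' => θ / 2 * ‖x' - c‖ ^ 2) (θ • (x - c)) x := by
  rw [hasGradientAt_iff_hasFDerivAt]
  have h := (((hasFDerivAt_id (𝕜 := ℝ) x).sub_const c).norm_sq).const_mul (θ / 2)
  refine HasFDerivAt.congr_fderiv (f := fun x' => θ / 2 * ‖x' - c‖ ^ 2) h ?_
  ext v
  simp
  ring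

/-- Joint differentiability of an objective. -/
def IsDifferentiable (g : Objective m d) : Prop :=
  Differentiable ℝ
    (fun q : EuclideanSpace ℝ (Fin m) × EuclideanSpace ℝ (Fin d) => g q.1 q.2)

lemma IsDifferentiable.hasGradientAt_gradX {g : Objective m d} (h : IsDifferentiable g)
    (x : EuclideanSpace ℝ (Fin m)) (y : EuclideanSpace ℝ (Fin d)) :
    HasGradientAt (fun x' => g x' y) (gradX g x y) x := by
  have h1 : DifferentiableAt ℝ (fun x' => g x' y) x :=
    (h (x, y)).comp (f := fun x' => (x', y)) x (by fun_prop)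
  exact h1.hasGradientAt

lemma IsDifferentiable.hasGradientAt_gradY {g : Objective m d} (h : IsDifferentiable g)
    (x : EuclideanSpace ℝ (Fin m)) (y : EuclideanSpace ℝ (Fin d)) :
    HasGradientAt (fun y' => g x y') (gradY g x y) y := by
  have h1 : DifferentiableAt ℝ (fun y' => g x y') y :=
    (h (x, y)).comp (f := fun y' => (x, y')) y (by fun_prop)
  exact h1.hasGradientAt

lemma IsDifferentiable.globalObjective {f : Fin n → Objective m d}
    (h : ∀ i, IsDifferentiable (f i)) : IsDifferentiable (globalObjective f) := by
  unfold IsDifferentiable FedMinimax.globalObjective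
  exact (Differentiable.fun_sum fun i _ => h i).const_mul _

lemma IsDifferentiable.regularized {g : Objective m d} (h : IsDifferentiable g) (θ : ℝ)
    (w : Pt m d) : IsDifferentiable (regularized θ w g) := by
  unfold IsDifferentiable FedMinimax.regularized
  have h1 : Differentiable ℝ
      (fun q : EuclideanSpace ℝ (Fin m) × EuclideanSpace ℝ (Fin d) => ‖q.1 - w.fst‖ ^ 2) :=
    Differentiable.norm_sq ℝ (by fun_prop)
  have h2 : Differentiable ℝ
      (fun q : EuclideanSpace ℝ (Fin m) × EuclideanSpace ℝ (Fin d) => ‖q.2 - w.snd‖ ^ 2) :=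
    Differentiable.norm_sq ℝ (by fun_prop)
  exact (Differentiable.add h (h1.const_mul _)).sub (h2.const_mul _)

lemma gradX_globalObjective {f : Fin n → Objective m d} (h : ∀ i, IsDifferentiable (f i))
    (x : EuclideanSpace ℝ (Fin m)) (y : EuclideanSpace ℝ (Fin d)) :
    gradX (globalObjective f) x y = (1 / (n : ℝ)) • ∑ i, gradX (f i) x y := by
  refine HasGradientAt.gradient ?_
  rw [hasGradientAt_iff_hasFDerivAt]
  have h1 := (HasFDerivAt.fun_sum (u := Finset.univ) fun i _ =>
    ((h i).hasGradientAt_gradX x y).hasFDerivAt).const_mul (1 / (n : ℝ))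
  refine h1.congr_fderiv ?_
  simp [map_sum]

lemma gradY_globalObjective {f : Fin n → Objective m d} (h : ∀ i, IsDifferentiable (f i))
    (x : EuclideanSpace ℝ (Fin m)) (y : EuclideanSpace ℝ (Fin d)) :
    gradY (globalObjective f) x y = (1 / (n : ℝ)) • ∑ i, gradY (f i) x y := by
  refine HasGradientAt.gradient ?_
  rw [hasGradientAt_iff_hasFDerivAt]
  have h1 := (HasFDerivAt.fun_sum (u := Finset.univ) fun i _ =>
    ((h i).hasGradientAt_gradY x y).hasFDerivAt).const_mul (1 / (n : ℝ))
  refine h1.congr_fderiv ?_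
  simp [map_sum]

lemma Pt.ext_iff' {z z' : Pt m d} : z = z' ↔ z.fst = z'.fst ∧ z.snd = z'.snd := by
  constructor
  · rintro rfl; exact ⟨rfl, rfl⟩
  · rintro ⟨h1, h2⟩
    exact (WithLp.equiv 2 _).injective (Prod.ext h1 h2)

lemma Pt.norm_sq (z : Pt m d) : ‖z‖ ^ 2 = ‖z.fst‖ ^ 2 + ‖z.snd‖ ^ 2 :=
  WithLp.prod_norm_sq_eq_of_L2 z

lemma Pt.inner_eq (z w : Pt m d) :
    inner ℝ z w = inner ℝ z.fst w.fst + inner ℝ z.snd w.snd :=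
  WithLp.prod_inner_apply z w

lemma Pt.fst_sum {ι : Type*} (s : Finset ι) (z : ι → Pt m d) :
    (∑ i ∈ s, z i).fst = ∑ i ∈ s, (z i).fst := by
  classical
  induction s using Finset.induction_on with
  | empty => simp
  | insert a s ha ih => simp [Finset.sum_insert ha, ih]

lemma Pt.snd_sum {ι : Type*} (s : Finset ι) (z : ι → Pt m d) :
    (∑ i ∈ s, z i).snd = ∑ i ∈ s, (z i).snd := by
  classical
  induction s using Finset.induction_on with
  | empty => simp
  | insert a s ha ih => simp [Finset.sum_insert ha, ih]

@[simp] lemma gradMap_fst (g : Objective m d) (z : Pt m d) :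
    (gradMap g z).fst = gradX g z.fst z.snd := rfl

@[simp] lemma gradMap_snd (g : Objective m d) (z : Pt m d) :
    (gradMap g z).snd = -gradY g z.fst z.snd := rfl

lemma gradMap_globalObjective {f : Fin n → Objective m d} (h : ∀ i, IsDifferentiable (f i))
    (z : Pt m d) :
    gradMap (globalObjective f) z = (1 / (n : ℝ)) • ∑ i, gradMap (f i) z := by
  rw [Pt.ext_iff']
  constructor
  · simp [gradX_globalObjective h, Pt.fst_sum]
  · simp [gradY_globalObjective h, Pt.snd_sum]

lemma gradMap_regularized {g : Objective m d} (h : IsDifferentiable g) (θ : ℝ) (w z : Pt m d) :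
    gradMap (regularized θ w g) z = gradMap g z + θ • (z - w) := by
  rw [Pt.ext_iff']
  constructor
  · refine HasGradientAt.gradient ?_
    have h1 := (((h.hasGradientAt_gradX z.fst z.snd).hasFDerivAt.add
      (hasGradientAt_half_sq θ w.fst z.fst).hasFDerivAt).sub_const
        (θ / 2 * ‖z.snd - w.snd‖ ^ 2))
    rw [hasGradientAt_iff_hasFDerivAt]
    refine h1.congr_fderiv ?_
    simp [map_add]
  · have h0 : gradY (regularized θ w g) z.fst z.snd = gradY g z.fst z.snd - θ • (z.snd - w.snd) := by
      refine HasGradientAt.gradient ?_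
      have h1 := (((h.hasGradientAt_gradY z.fst z.snd).hasFDerivAt.add_const
        (θ / 2 * ‖z.fst - w.fst‖ ^ 2)).sub
        (hasGradientAt_half_sq θ w.snd z.snd).hasFDerivAt)
      rw [hasGradientAt_iff_hasFDerivAt]
      refine h1.congr_fderiv ?_
      simp [map_sub]
    simp [h0]
    abel

lemma IsSmooth.isDifferentiable {β : ℝ} {g : Objective m d} (h : IsSmooth β g) :
    IsDifferentiable g := h.1

/-- Each block changes by at most `β (‖Δx‖ + ‖Δy‖)`, passing through the mixed point; squaring and
adding gives `2 β² (‖Δx‖ + ‖Δy‖)² ≤ 4 β² ‖Δz‖²`. This is the source of the factor 2. -/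
lemma IsSmooth.norm_gradMap_sub_le {β : ℝ} (hβ : 0 ≤ β) {g : Objective m d} (h : IsSmooth β g)
    (z z' : Pt m d) : ‖gradMap g z - gradMap g z'‖ ≤ 2 * β * ‖z - z'‖ := by
  obtain ⟨-, h1, h2, h3, h4⟩ := h
  have hx : ‖gradX g z.fst z.snd - gradX g z'.fst z'.snd‖
      ≤ β * (‖z.fst - z'.fst‖ + ‖z.snd - z'.snd‖) := by
    have := norm_sub_le_norm_sub_add_norm_sub (gradX g z.fst z.snd) (gradX g z'.fst z.snd)
      (gradX g z'.fst z'.snd)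
    linarith [h1 z.fst z'.fst z.snd, h3 z'.fst z.snd z'.snd]
  have hy : ‖gradY g z.fst z.snd - gradY g z'.fst z'.snd‖
      ≤ β * (‖z.fst - z'.fst‖ + ‖z.snd - z'.snd‖) := by
    have := norm_sub_le_norm_sub_add_norm_sub (gradY g z.fst z.snd) (gradY g z'.fst z.snd)
      (gradY g z'.fst z'.snd)
    linarith [h4 z.fst z'.fst z.snd, h2 z'.fst z.snd z'.snd]
  refine le_of_sq_le_sq ?_ (by positivity)
  rw [Pt.norm_sq, mul_pow, Pt.norm_sq]
  have e2 : (gradMap g z - gradMap g z').snd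
      = -(gradY g z.fst z.snd - gradY g z'.fst z'.snd) := by simp; abel
  rw [e2, norm_neg]
  have hx2 := pow_le_pow_left₀ (norm_nonneg _) hx 2
  have hy2 := pow_le_pow_left₀ (norm_nonneg _) hy 2
  simp only [WithLp.sub_fst, gradMap_fst, WithLp.sub_snd]
  nlinarith [mul_nonneg (sq_nonneg β) (sq_nonneg (‖z.fst - z'.fst‖ - ‖z.snd - z'.snd‖))]

/-- Sum the four strong convexity and concavity inequalities between the corners of the rectangle
spanned by `z` and `z'`: all function values cancel. -/
lemma IsStronglyConvexConcave.le_inner {μ : ℝ} {g : Objective m d}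
    (h : IsStronglyConvexConcave μ g) (z z' : Pt m d) :
    μ * ‖z - z'‖ ^ 2 ≤ inner ℝ (gradMap g z - gradMap g z') (z - z') := by
  obtain ⟨h1, h2⟩ := h
  have a1 := h1 z.fst z'.fst z.snd
  have a2 := h1 z'.fst z.fst z'.snd
  have a3 := h2 z.fst z.snd z'.snd
  have a4 := h2 z'.fst z'.snd z.snd
  rw [Pt.norm_sq, Pt.inner_eq]
  simp only [WithLp.sub_fst, gradMap_fst, WithLp.sub_snd, gradMap_snd, inner_sub_left,
    inner_sub_right, inner_neg_left] at *
  rw [norm_sub_rev] at a1 a3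
  linarith

lemma IsStronglyConvexConcave.globalObjective (hn : 0 < n) {μ : ℝ} {f : Fin n → Objective m d}
    (hd : ∀ i, IsDifferentiable (f i)) (h : ∀ i, IsStronglyConvexConcave μ (f i)) :
    IsStronglyConvexConcave μ (globalObjective f) := by
  have hn' : (n : ℝ) ≠ 0 := by positivity
  constructor
  · intro x x' y
    have h1 := Finset.sum_le_sum fun i (_ : i ∈ Finset.univ) => (h i).1 x x' y
    have h2 := mul_le_mul_of_nonneg_left h1 (by positivity : 0 ≤ 1 / (n : ℝ))
    rw [gradX_globalObjective hd, real_inner_smul_left, sum_inner]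
    simp only [Finset.sum_add_distrib, Finset.sum_const, Finset.card_univ, Fintype.card_fin,
      nsmul_eq_mul, mul_add] at h2
    rw [← mul_assoc, one_div_mul_cancel hn', one_mul] at h2
    exact h2
  · intro x y y'
    have h1 := Finset.sum_le_sum fun i (_ : i ∈ Finset.univ) => (h i).2 x y y'
    have h2 := mul_le_mul_of_nonneg_left h1 (by positivity : 0 ≤ 1 / (n : ℝ))
    rw [gradY_globalObjective hd, inner_neg_left, real_inner_smul_left, sum_inner]
    simp only [Finset.sum_add_distrib, Finset.sum_const, Finset.card_univ, Fintype.card_fin,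
      nsmul_eq_mul, mul_add, inner_neg_left, Finset.sum_neg_distrib, mul_neg] at h2
    rw [← mul_assoc (1 / (n : ℝ)) (n : ℝ), one_div_mul_cancel hn', one_mul] at h2
    exact h2

lemma IsMinimaxOptimal.gradMap_eq_zero {g : Objective m d} {z : Pt m d} (h : IsMinimaxOptimal g z)
    (hd : IsDifferentiable g) : gradMap g z = 0 := by
  rw [Pt.ext_iff']
  constructor
  · have hmin : IsLocalMin (fun x' => g x' z.snd) z.fst :=
      Filter.Eventually.of_forall fun x => (h x 0).2
    have := hmin.hasFDerivAt_eq_zero (hd.hasGradientAt_gradX z.fst z.snd).hasFDerivAt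
    simpa using this
  · have hmax : IsLocalMax (fun y' => g z.fst y') z.snd :=
      Filter.Eventually.of_forall fun y => (h 0 y).1
    have := hmax.hasFDerivAt_eq_zero (hd.hasGradientAt_gradY z.fst z.snd).hasFDerivAt
    simpa using this

/-- Converse of criticality: convexity-concavity makes the first-order condition sufficient. It
turns the zero found by the contraction principle into a saddle point. -/
lemma isMinimaxOptimal_regularized_of_gradMap {μ θ : ℝ} (hμ : 0 ≤ μ) (hθ : 0 ≤ θ)
    {g : Objective m d} (h : IsStronglyConvexConcave μ g) {w z : Pt m d}
    (hz : gradMap g z + θ • (z - w) = 0) : IsMinimaxOptimal (regularized θ w g) z := by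
  have hz' := Pt.ext_iff'.1 hz
  simp only [WithLp.add_fst, gradMap_fst, WithLp.smul_fst, WithLp.sub_fst, WithLp.zero_fst,
    WithLp.add_snd, gradMap_snd, WithLp.smul_snd, WithLp.sub_snd, WithLp.zero_snd] at hz'
  have e1 : gradX g z.fst z.snd = -(θ • (z.fst - w.fst)) := eq_neg_of_add_eq_zero_left hz'.1
  have e2 : -gradY g z.fst z.snd = -(θ • (z.snd - w.snd)) := eq_neg_of_add_eq_zero_left hz'.2
  intro x y
  unfold regularized
  have h1 := h.1 z.fst x z.snd
  have h2 := h.2 z.fst z.snd y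
  rw [e1, inner_neg_left, real_inner_smul_left] at h1
  rw [e2, inner_neg_left, real_inner_smul_left] at h2
  have q1 : ‖x - w.fst‖ ^ 2 = ‖z.fst - w.fst‖ ^ 2 + 2 * inner ℝ (z.fst - w.fst) (x - z.fst)
      + ‖x - z.fst‖ ^ 2 := by
    rw [← norm_add_sq_real]; congr 2; abel
  have q2 : ‖y - w.snd‖ ^ 2 = ‖z.snd - w.snd‖ ^ 2 + 2 * inner ℝ (z.snd - w.snd) (y - z.snd)
      + ‖y - z.snd‖ ^ 2 := by
    rw [← norm_add_sq_real]; congr 2; abel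
  rw [q1, q2]
  constructor
  · nlinarith [mul_nonneg hμ (sq_nonneg ‖y - z.snd‖), mul_nonneg hθ (sq_nonneg ‖y - z.snd‖)]
  · nlinarith [mul_nonneg hμ (sq_nonneg ‖x - z.fst‖), mul_nonneg hθ (sq_nonneg ‖x - z.fst‖)]

/-- A Lipschitz strongly monotone map of a Hilbert space has a zero. -/
lemma exists_zero_of_stronglyMonotone {E : Type*} [NormedAddCommGroup E] [InnerProductSpace ℝ E]
    [CompleteSpace E] {F : E → E} {a L : ℝ} (ha : 0 < a) (haL : a ≤ L)
    (hL : ∀ z z', ‖F z - F z'‖ ≤ L * ‖z - z'‖)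
    (hm : ∀ z z', a * ‖z - z'‖ ^ 2 ≤ inner ℝ (F z - F z') (z - z')) : ∃ z, F z = 0 := by
  have hL0 : 0 < L := ha.trans_le haL
  -- This `τ` minimizes `1 - 2 τ a + τ² L²`, the bound for the squared Lipschitz constant of `z ↦ z
  -- - τ F z`; the minimum is `1 - a² / L² < 1`, so Banach's fixed point theorem applies.
  set τ := a / L ^ 2 with hτ
  have hτ0 : 0 < τ := by positivity
  have hk : 0 ≤ 1 - a ^ 2 / L ^ 2 := by
    rw [sub_nonneg, div_le_one (by positivity)]
    exact pow_le_pow_left₀ ha.le haL 2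
  set k : ℝ := Real.sqrt (1 - a ^ 2 / L ^ 2) with hkdef
  have hk1 : k < 1 := by
    rw [hkdef, Real.sqrt_lt' one_pos]
    have : 0 < a ^ 2 / L ^ 2 := by positivity
    linarith
  have key : ∀ z z', ‖(z - τ • F z) - (z' - τ • F z')‖ ≤ k * ‖z - z'‖ := by
    intro z z'
    refine le_of_sq_le_sq ?_ (by positivity)
    have e : (z - τ • F z) - (z' - τ • F z') = (z - z') - τ • (F z - F z') := by
      rw [smul_sub]; abel
    rw [e, norm_sub_sq_real, real_inner_smul_right, norm_smul, mul_pow, mul_pow, hkdef,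
      Real.sq_sqrt hk, Real.norm_eq_abs, sq_abs, real_inner_comm]
    have h1 := pow_le_pow_left₀ (norm_nonneg _) (hL z z') 2
    have h2 := hm z z'
    rw [mul_pow] at h1
    have h3 : τ ^ 2 * ‖F z - F z'‖ ^ 2 ≤ a ^ 2 / L ^ 2 * ‖z - z'‖ ^ 2 := by
      calc τ ^ 2 * ‖F z - F z'‖ ^ 2 ≤ τ ^ 2 * (L ^ 2 * ‖z - z'‖ ^ 2) := by gcongr
        _ = a ^ 2 / L ^ 2 * ‖z - z'‖ ^ 2 := by rw [hτ]; field_simp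
    have h4 : a ^ 2 / L ^ 2 * ‖z - z'‖ ^ 2 ≤ τ * inner ℝ (F z - F z') (z - z') := by
      calc a ^ 2 / L ^ 2 * ‖z - z'‖ ^ 2 = τ * (a * ‖z - z'‖ ^ 2) := by rw [hτ]; ring
        _ ≤ _ := by gcongr
    linarith
  have hc : ContractingWith (⟨k, Real.sqrt_nonneg _⟩ : NNReal) (fun z => z - τ • F z) := by
    refine ⟨by exact_mod_cast hk1, LipschitzWith.of_dist_le_mul fun z z' => ?_⟩
    rw [dist_eq_norm, dist_eq_norm]
    exact key z z'
  have hfix : hc.fixedPoint _ - τ • F (hc.fixedPoint _) = hc.fixedPoint _ := hc.fixedPoint_isFixedPt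
  exact ⟨_, (smul_eq_zero.1 (sub_eq_self.1 hfix)).resolve_left hτ0.ne'⟩

end GradientMappings

/-! ### The proximal point map as a resolvent. -/

section Prox

variable {m d n : ℕ} {β μ θ : ℝ} {f : Fin n → Objective m d}

/-- The average of the gradient mappings. -/
noncomputable def meanMap (f : Fin n → Objective m d) (z : Pt m d) : Pt m d :=
  (1 / (n : ℝ)) • ∑ i, gradMap (f i) z

lemma meanMap_le_inner (hn : 0 < n) (hs : ∀ i, IsSmooth β (f i))
    (hc : ∀ i, IsStronglyConvexConcave μ (f i)) (z z' : Pt m d) :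
    μ * ‖z - z'‖ ^ 2 ≤ inner ℝ (meanMap f z - meanMap f z') (z - z') := by
  have hd := fun i => (hs i).isDifferentiable
  have := (IsStronglyConvexConcave.globalObjective hn hd hc).le_inner z z'
  rwa [gradMap_globalObjective hd, gradMap_globalObjective hd] at this

lemma norm_average_sub_le {E : Type*} [NormedAddCommGroup E] [NormedSpace ℝ E] (hn : 0 < n)
    {u v : Fin n → E} {c : ℝ} (h : ∀ i, ‖u i - v i‖ ≤ c) :
    ‖(1 / (n : ℝ)) • ∑ i, u i - (1 / (n : ℝ)) • ∑ i, v i‖ ≤ c := by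
  have hn' : (0 : ℝ) < n := by positivity
  rw [← smul_sub, ← Finset.sum_sub_distrib, norm_smul, Real.norm_of_nonneg (by positivity)]
  have h1 := norm_sum_le_of_le Finset.univ fun i _ => h i
  simp only [Finset.sum_const, Finset.card_univ, Fintype.card_fin, nsmul_eq_mul] at h1
  calc _ ≤ 1 / (n : ℝ) * (n * c) := by gcongr
    _ = c := by field_simp

lemma norm_meanMap_sub_le (hn : 0 < n) (hβ : 0 ≤ β) (hs : ∀ i, IsSmooth β (f i))
    (z z' : Pt m d) : ‖meanMap f z - meanMap f z'‖ ≤ 2 * β * ‖z - z'‖ :=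
  norm_average_sub_le hn fun i => (hs i).norm_gradMap_sub_le hβ z z'

/-- `prox` is a choice, so existence of a saddle point has to come first; then the chosen point is
critical. From here on `prox` is used only through this resolvent equation. -/
lemma meanMap_prox (hn : 0 < n) (hμ : 0 < μ) (hμβ : μ ≤ β) (hθ : 0 ≤ θ)
    (hs : ∀ i, IsSmooth β (f i)) (hc : ∀ i, IsStronglyConvexConcave μ (f i)) (w : Pt m d) :
    meanMap f (prox θ (globalObjective f) w)
      + θ • (prox θ (globalObjective f) w - w) = 0 := by
  have hβ : 0 ≤ β := hμ.le.trans hμβ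
  have hd := fun i => (hs i).isDifferentiable
  obtain ⟨z, hz⟩ := exists_zero_of_stronglyMonotone (F := fun z => meanMap f z + θ • (z - w))
    (a := μ + θ) (L := 2 * β + θ) (by positivity) (by linarith)
    (fun z z' => by
      have e : meanMap f z + θ • (z - w) - (meanMap f z' + θ • (z' - w))
          = (meanMap f z - meanMap f z') + θ • (z - z') := by
        simp only [smul_sub]; abel
      rw [e]
      have h1 := norm_add_le (meanMap f z - meanMap f z') (θ • (z - z'))
      rw [norm_smul, Real.norm_of_nonneg hθ] at h1
      linarith [norm_meanMap_sub_le hn hβ hs z z'])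
    (fun z z' => by
      have e : meanMap f z + θ • (z - w) - (meanMap f z' + θ • (z' - w))
          = (meanMap f z - meanMap f z') + θ • (z - z') := by
        simp only [smul_sub]; abel
      rw [e, inner_add_left, real_inner_smul_left, real_inner_self_eq_norm_sq]
      linarith [meanMap_le_inner hn hs hc z z'])
  have hex : ∃ z, IsMinimaxOptimal (regularized θ w (globalObjective f)) z :=
    ⟨z, isMinimaxOptimal_regularized_of_gradMap hμ.le hθ
      (IsStronglyConvexConcave.globalObjective hn hd hc)
      (by rw [gradMap_globalObjective hd]; exact hz)⟩
  have hspec : IsMinimaxOptimal _ (prox θ (globalObjective f) w) := Classical.epsilon_spec hex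
  have hgd := IsDifferentiable.globalObjective hd
  have := hspec.gradMap_eq_zero (hgd.regularized θ w)
  rwa [gradMap_regularized hgd, gradMap_globalObjective hd] at this

lemma meanMap_eq_zero_of_isMinimaxOptimal (hs : ∀ i, IsSmooth β (f i)) {z : Pt m d}
    (h : IsMinimaxOptimal (globalObjective f) z) : meanMap f z = 0 := by
  have hd := fun i => (hs i).isDifferentiable
  have := h.gradMap_eq_zero (IsDifferentiable.globalObjective hd)
  rwa [gradMap_globalObjective hd] at this

/-- Subtract the two resolvent equations and test with the difference of the proximal points: strong
monotonicity adds `μ` to the `θ` already on the left. The resulting factor `θ / (μ + θ)` drives the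
outer loop. -/
lemma norm_prox_sub_prox_le (hn : 0 < n) (hμ : 0 < μ) (hμβ : μ ≤ β) (hθ : 0 ≤ θ)
    (hs : ∀ i, IsSmooth β (f i)) (hc : ∀ i, IsStronglyConvexConcave μ (f i)) (w w' : Pt m d) :
    (μ + θ) * ‖prox θ (globalObjective f) w - prox θ (globalObjective f) w'‖
      ≤ θ * ‖w - w'‖ := by
  set u := prox θ (globalObjective f) w
  set u' := prox θ (globalObjective f) w'
  have h1 : meanMap f u + θ • (u - w) = 0 := meanMap_prox hn hμ hμβ hθ hs hc w
  have h2 : meanMap f u' + θ • (u' - w') = 0 := meanMap_prox hn hμ hμβ hθ hs hc w'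
  have h3 := meanMap_le_inner hn hs hc u u'
  have e : meanMap f u - meanMap f u' = θ • (w - w') - θ • (u - u') := by
    rw [eq_neg_of_add_eq_zero_left h1, eq_neg_of_add_eq_zero_left h2]
    simp only [smul_sub]; abel
  rw [e, inner_sub_left, real_inner_smul_left, real_inner_smul_left,
    real_inner_self_eq_norm_sq] at h3
  have h4 := real_inner_le_norm (w - w') (u - u')
  rcases (norm_nonneg (u - u')).eq_or_lt with h0 | h0
  · rw [← h0]; simp only [mul_zero]; positivity
  · refine le_of_mul_le_mul_right ?_ h0
    nlinarith [mul_le_mul_of_nonneg_left h4 hθ]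

lemma prox_of_isMinimaxOptimal (hn : 0 < n) (hμ : 0 < μ) (hμβ : μ ≤ β) (hθ : 0 ≤ θ)
    (hs : ∀ i, IsSmooth β (f i)) (hc : ∀ i, IsStronglyConvexConcave μ (f i)) {z : Pt m d}
    (h : IsMinimaxOptimal (globalObjective f) z) : prox θ (globalObjective f) z = z := by
  set u := prox θ (globalObjective f) z
  have h1 : meanMap f u + θ • (u - z) = 0 := meanMap_prox hn hμ hμβ hθ hs hc z
  have h2 := meanMap_eq_zero_of_isMinimaxOptimal hs h
  have h3 := meanMap_le_inner hn hs hc u z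
  rw [h2, sub_zero, eq_neg_of_add_eq_zero_left h1, inner_neg_left, real_inner_smul_left,
    real_inner_self_eq_norm_sq] at h3
  have h5 : ‖u - z‖ ^ 2 ≤ 0 := by
    by_contra hpos
    push Not at hpos
    nlinarith [mul_pos hμ hpos, mul_nonneg hθ hpos.le]
  have h6 : ‖u - z‖ = 0 := by
    have := sq_nonneg ‖u - z‖
    exact pow_eq_zero_iff two_ne_zero |>.1 (le_antisymm h5 this)
  exact sub_eq_zero.1 (norm_eq_zero.1 h6)

lemma continuous_prox (hn : 0 < n) (hμ : 0 < μ) (hμβ : μ ≤ β) (hθ : 0 ≤ θ)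
    (hs : ∀ i, IsSmooth β (f i)) (hc : ∀ i, IsStronglyConvexConcave μ (f i)) :
    Continuous (prox θ (globalObjective f)) := by
  refine (LipschitzWith.of_dist_le_mul (K := 1) fun w w' => ?_).continuous
  rw [dist_eq_norm, dist_eq_norm, NNReal.coe_one, one_mul]
  have h := norm_prox_sub_prox_le hn hμ hμβ hθ hs hc w w'
  have : 0 < μ + θ := by positivity
  nlinarith [norm_nonneg (prox θ (globalObjective f) w - prox θ (globalObjective f) w'),
    norm_nonneg (w - w'), mul_nonneg hμ.le (norm_nonneg (w - w'))]

end Prox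

/-! ### Averages over clients. -/

section Average

variable {n : ℕ} {E : Type*} [NormedAddCommGroup E] [InnerProductSpace ℝ E]

/-- The average of finitely many vectors. -/
noncomputable def average {E : Type*} [AddCommMonoid E] [Module ℝ E] (v : Fin n → E) : E :=
  (1 / (n : ℝ)) • ∑ i, v i

lemma average_sub (u v : Fin n → E) :
    average (fun i => u i - v i) = average u - average v := by
  simp [average, Finset.sum_sub_distrib, smul_sub]

lemma average_add (u v : Fin n → E) :
    average (fun i => u i + v i) = average u + average v := by
  simp [average, Finset.sum_add_distrib, smul_add]

lemma average_smul (c : ℝ) (v : Fin n → E) :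
    average (fun i => c • v i) = c • average v := by
  simp only [average, ← Finset.smul_sum]
  rw [smul_comm]

lemma average_mul (c : ℝ) (v : Fin n → ℝ) :
    average (fun i => c * v i) = c * average v := average_smul c v

lemma average_const (hn : 0 < n) (c : E) : average (fun _ : Fin n => c) = c := by
  have : (n : ℝ) ≠ 0 := by positivity
  simp only [average, Finset.sum_const, Finset.card_univ, Fintype.card_fin]
  rw [← Nat.cast_smul_eq_nsmul ℝ, smul_smul, one_div_mul_cancel this, one_smul]

lemma average_mono {u v : Fin n → ℝ} (h : ∀ i, u i ≤ v i) : average u ≤ average v :=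
  mul_le_mul_of_nonneg_left (Finset.sum_le_sum fun i _ => h i) (by positivity)

lemma average_nonneg {u : Fin n → ℝ} (h : ∀ i, 0 ≤ u i) : 0 ≤ average u :=
  mul_nonneg (by positivity) (Finset.sum_nonneg fun i _ => h i)

lemma inner_average_left (v : Fin n → E) (c : E) :
    inner ℝ (average v) c = average fun i => inner ℝ (v i) c := by
  simp [average, real_inner_smul_left, sum_inner]

/-- Bias-variance decomposition of an average of squares. -/
lemma average_norm_sub_sq (hn : 0 < n) (v : Fin n → E) (c : E) :
    average (fun i => ‖v i - c‖ ^ 2)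
      = average (fun i => ‖v i - average v‖ ^ 2) + ‖average v - c‖ ^ 2 := by
  have h : ∀ i, ‖v i - c‖ ^ 2 = ‖v i - average v‖ ^ 2 +
      (2 * inner ℝ (v i - average v) (average v - c) + ‖average v - c‖ ^ 2) := by
    intro i
    rw [← add_assoc, ← norm_add_sq_real]
    congr 2; abel
  have h0 : average (fun i => inner ℝ (v i - average v) (average v - c)) = 0 := by
    rw [← inner_average_left, average_sub, average_const hn, sub_self, inner_zero_left]
  simp only [h, average_add, average_mul, h0, average_const hn]
  ring

lemma norm_average_sq_le (hn : 0 < n) (v : Fin n → E) :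
    ‖average v‖ ^ 2 ≤ average fun i => ‖v i‖ ^ 2 := by
  have h := average_norm_sub_sq hn v 0
  simp only [sub_zero] at h
  rw [h]
  have := average_nonneg (n := n) (u := fun i => ‖v i - average v‖ ^ 2) fun i => by positivity
  linarith

lemma average_norm_sub_average_sq_le (hn : 0 < n) (v : Fin n → E) (c : E) :
    average (fun i => ‖v i - average v‖ ^ 2) ≤ average fun i => ‖v i - c‖ ^ 2 := by
  rw [average_norm_sub_sq hn v c]
  have := sq_nonneg ‖average v - c‖
  linarith

/-- Young's inequality with a free weight: `2 ‖a‖ ‖b‖ ≤ α ‖a‖² + ‖b‖² / α`. -/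
lemma norm_sub_sq_le_young (a b : E) {α : ℝ} (hα : 0 < α) :
    ‖a - b‖ ^ 2 ≤ (1 + α) * ‖a‖ ^ 2 + (1 + 1 / α) * ‖b‖ ^ 2 := by
  have h1 : ‖a - b‖ ^ 2 ≤ (‖a‖ + ‖b‖) ^ 2 :=
    pow_le_pow_left₀ (norm_nonneg _) (norm_sub_le a b) 2
  have h2 : 0 ≤ (α * ‖a‖ - ‖b‖) ^ 2 / α := by positivity
  have h3 : (α * ‖a‖ - ‖b‖) ^ 2 / α = α * ‖a‖ ^ 2 - 2 * ‖a‖ * ‖b‖ + 1 / α * ‖b‖ ^ 2 := by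
    field_simp
    ring
  nlinarith

end Average

/-! ### One inner iteration with exact directions. -/

section Deterministic

variable {n : ℕ} {E : Type*} [NormedAddCommGroup E] [InnerProductSpace ℝ E]
  {G : Fin n → E → E} {L a γ : ℝ} {zs : Fin n → E} {zt zstar : E}

/-- Contraction of the averaged iterate under the exact directions, up to the client drift. -/
lemma norm_average_step_sq_le (hn : 0 < n) (ha : 0 < a) (hL : 0 < L) (hγ : 0 ≤ γ)
    (hγL : γ * L ^ 2 ≤ a / 20) (haL : 2 * a ≤ L)
    (hG : ∀ i z z', ‖G i z - G i z'‖ ≤ L * ‖z - z'‖)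
    (hm : ∀ z, a * ‖z - zstar‖ ^ 2 ≤ inner ℝ (average fun i => G i z) (z - zstar))
    (hz : average (fun i => G i zstar) = 0) :
    ‖average zs - zstar - γ • average (fun i => G i (zs i))‖ ^ 2
      ≤ (1 - 9 / 10 * (γ * a)) * ‖average zs - zstar‖ ^ 2
        + 11 / 10 * (γ * L ^ 2 / a) * average fun i => ‖zs i - average zs‖ ^ 2 := by
  set z := average zs
  set X := average fun i => ‖zs i - z‖ ^ 2
  set r := ‖z - zstar‖
  have hX : 0 ≤ X := average_nonneg fun i => by positivity
  -- `δ` is the error of evaluating the gradients at the client iterates instead of at their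
  -- average; the correction terms of the directions cancel in the average.
  set δ := average fun i => G i (zs i) - G i z with hδ
  have hδX : ‖δ‖ ^ 2 ≤ L ^ 2 * X := by
    refine (norm_average_sq_le hn _).trans ?_
    rw [← average_mul]
    refine average_mono fun i => ?_
    rw [← mul_pow]
    exact pow_le_pow_left₀ (norm_nonneg _) (hG _ _ _) 2
  have hsum : average (fun i => G i (zs i)) = δ + average fun i => G i z := by
    rw [hδ, average_sub]; abel
  set g := average fun i => G i z
  have hg : ‖g‖ ^ 2 ≤ L ^ 2 * r ^ 2 := by
    have : g = average fun i => G i z - G i zstar := by rw [average_sub, hz, sub_zero]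
    rw [this]
    refine (norm_average_sq_le hn _).trans ?_
    rw [← average_const hn (L ^ 2 * r ^ 2)]
    refine average_mono fun i => ?_
    rw [← mul_pow]
    exact pow_le_pow_left₀ (norm_nonneg _) (hG _ _ _) 2
  rw [hsum, norm_sub_sq_real, real_inner_smul_right, inner_add_right, norm_smul, mul_pow,
    Real.norm_eq_abs, sq_abs, real_inner_comm g]
  have h1 := hm z
  have h2 : ‖δ + g‖ ^ 2 ≤ 2 * (L ^ 2 * X) + 2 * (L ^ 2 * r ^ 2) := by
    have h := norm_sub_sq_le_young δ (-g) one_pos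
    rw [sub_neg_eq_add, norm_neg] at h
    linarith
  -- Young with weight `a` spends half of the gain `2 a r²` of strong monotonicity. The quadratic
  -- term in `γ` spends another tenth of `a r²`, which leaves the factor `1 - 9/10 γ a`.
  have h3 : -(2 * inner ℝ (z - zstar) δ) ≤ a * r ^ 2 + L ^ 2 / a * X := by
    have h := neg_le_of_abs_le (abs_real_inner_le_norm (z - zstar) δ)
    have h4 : 0 ≤ (a * r - ‖δ‖) ^ 2 / a := by positivity
    have h5 : (a * r - ‖δ‖) ^ 2 / a = a * r ^ 2 - 2 * (r * ‖δ‖) + ‖δ‖ ^ 2 / a := by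
      field_simp
      ring
    have h6 : ‖δ‖ ^ 2 / a ≤ L ^ 2 / a * X := by
      rw [div_mul_eq_mul_div]; gcongr
    linarith
  have h7 := mul_le_mul_of_nonneg_left h2 (sq_nonneg γ)
  have h8 := mul_le_mul_of_nonneg_left h3 hγ
  have h9 := mul_le_mul_of_nonneg_left h1 hγ
  have e1 : γ ^ 2 * (2 * (L ^ 2 * r ^ 2)) ≤ γ * a / 10 * r ^ 2 := by
    have := mul_le_mul_of_nonneg_left hγL (mul_nonneg hγ (sq_nonneg r))
    linarith
  have hγa : γ * a ≤ 1 / 80 := by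
    have h4 : 4 * a ^ 2 ≤ L ^ 2 := by nlinarith
    have h5 : γ * (4 * a ^ 2) ≤ a / 20 := (mul_le_mul_of_nonneg_left h4 hγ).trans hγL
    have h6 : (γ * a) * a ≤ 1 / 80 * a := by linarith
    exact le_of_mul_le_mul_right h6 ha
  have e2 : γ ^ 2 * (2 * (L ^ 2 * X)) ≤ γ * L ^ 2 / a * X / 40 := by
    have h4 : γ ^ 2 * (2 * (L ^ 2 * X)) = 2 * (γ * a) * (γ * L ^ 2 / a * X) := by
      field_simp
    rw [h4]
    have h5 : 0 ≤ γ * L ^ 2 / a * X := by positivity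
    nlinarith
  have e3 : 0 ≤ γ * L ^ 2 / a * X := by positivity
  have e4 : γ * (L ^ 2 / a * X) = γ * L ^ 2 / a * X := by ring
  linarith

/-- Growth of the client drift under the exact directions, without communication. -/
lemma average_drift_step_sq_le (hn : 0 < n) {p : ℝ} (hp : 0 < p)
    (hG : ∀ i z z', ‖G i z - G i z'‖ ≤ L * ‖z - z'‖) {y : Fin n → E}
    (hy : ∀ i, y i = zs i - γ • (G i (zs i) - G i zt + average fun j => G j zt)) :
    average (fun i => ‖y i - average y‖ ^ 2)
      ≤ (1 + p / 2) * average (fun i => ‖zs i - average zs‖ ^ 2)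
        + (1 + 2 / p) * (γ ^ 2 * L ^ 2) * (average (fun i => ‖zs i - average zs‖ ^ 2)
          + 2 * ‖average zs - zstar‖ ^ 2 + 2 * ‖zt - zstar‖ ^ 2) := by
  set z := average zs
  set h : Fin n → E := fun i => G i (zs i) - G i zt + average fun j => G j zt
  have hyav : average y = z - γ • average h := by
    rw [← average_smul, ← average_sub]
    exact congrArg average (funext hy)
  have h1 : ∀ i, ‖y i - average y‖ ^ 2 ≤ (1 + p / 2) * ‖zs i - z‖ ^ 2
      + (1 + 2 / p) * γ ^ 2 * ‖h i - average h‖ ^ 2 := by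
    intro i
    have e : y i - average y = (zs i - z) - γ • (h i - average h) := by
      rw [hyav, hy, smul_sub]; abel
    -- Weight `p / 2`: the drift survives with probability `1 - p`, and `(1 - p) (1 + p / 2) ≤ 1 - p
    -- / 2` is still a contraction.
    have := norm_sub_sq_le_young (zs i - z) (γ • (h i - average h)) (half_pos hp)
    rw [e]
    rw [norm_smul, mul_pow, Real.norm_eq_abs, sq_abs, one_div_div] at this
    linarith
  have h2 : average (fun i => ‖h i - average h‖ ^ 2)
      ≤ L ^ 2 * (average (fun i => ‖zs i - z‖ ^ 2) + 2 * ‖z - zstar‖ ^ 2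
        + 2 * ‖zt - zstar‖ ^ 2) := by
    -- Recentring at the common correction leaves `G i (zs i) - G i zt`, which is bounded by a
    -- distance. This is why no bound on the dissimilarity of the clients is needed.
    refine (average_norm_sub_average_sq_le hn h (average fun j => G j zt)).trans ?_
    have h3 : average (fun i => ‖h i - average fun j => G j zt‖ ^ 2)
        ≤ average fun i => L ^ 2 * ‖zs i - zt‖ ^ 2 := by
      refine average_mono fun i => ?_
      rw [← mul_pow]
      refine pow_le_pow_left₀ (norm_nonneg _) ?_ 2
      simpa [h] using hG i (zs i) zt
    refine h3.trans ?_
    rw [average_mul, average_norm_sub_sq hn zs zt]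
    have h4 := norm_sub_sq_le_young (z - zstar) (zt - zstar) one_pos
    rw [sub_sub_sub_cancel_right] at h4
    have : 0 ≤ L ^ 2 := sq_nonneg L
    refine mul_le_mul_of_nonneg_left ?_ this
    linarith
  refine (average_mono h1).trans ?_
  rw [average_add, average_mul, average_mul]
  have h5 := mul_le_mul_of_nonneg_left h2 (by positivity : 0 ≤ (1 + 2 / p) * γ ^ 2)
  linarith

end Deterministic

/-! ### Second moments of independent centred noise. -/

section Noise

variable {n : ℕ} {E : Type*} [NormedAddCommGroup E] [InnerProductSpace ℝ E] [CompleteSpace E]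
  [MeasurableSpace E] [BorelSpace E] [SecondCountableTopology E]
  {A : Type*} [MeasurableSpace A]

lemma integral_norm_sub_sq_of_integral_eq_zero {ν : Measure A} [IsProbabilityMeasure ν]
    {u : A → E} (hu : MemLp u 2 ν) (h0 : ∫ ξ, u ξ ∂ν = 0) (b : E) (γ : ℝ) :
    Integrable (fun ξ => ‖b - γ • u ξ‖ ^ 2) ν ∧
      ∫ ξ, ‖b - γ • u ξ‖ ^ 2 ∂ν = ‖b‖ ^ 2 + γ ^ 2 * ∫ ξ, ‖u ξ‖ ^ 2 ∂ν := by
  have hui : Integrable u ν := hu.integrable (by norm_num)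
  have h1 : Integrable (fun ξ => inner ℝ b (u ξ)) ν := hui.const_inner b
  have h2 : Integrable (fun ξ => ‖u ξ‖ ^ 2) ν := hu.integrable_norm_pow (by norm_num)
  have e : ∀ ξ, ‖b - γ • u ξ‖ ^ 2
      = ‖b‖ ^ 2 - 2 * γ * inner ℝ b (u ξ) + γ ^ 2 * ‖u ξ‖ ^ 2 := by
    intro ξ
    rw [norm_sub_sq_real, real_inner_smul_right, norm_smul, mul_pow, Real.norm_eq_abs, sq_abs]
    ring
  have hi : ∫ ξ, inner ℝ b (u ξ) ∂ν = 0 := by rw [integral_inner hui, h0, inner_zero_right]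
  have h3 : Integrable (fun ξ => ‖b‖ ^ 2 - 2 * γ * inner ℝ b (u ξ)) ν :=
    (integrable_const _).sub (h1.const_mul _)
  simp only [e]
  refine ⟨h3.add (h2.const_mul _), ?_⟩
  rw [integral_add h3 (h2.const_mul _), integral_sub (integrable_const _) (h1.const_mul _),
    integral_const_mul, integral_const_mul, hi]
  simp

variable (π : Fin n → Measure A) [∀ i, IsProbabilityMeasure (π i)] {u : Fin n → A → E}

lemma integral_eval_pi {F : Type*} [NormedAddCommGroup F] [NormedSpace ℝ F] (i : Fin n)
    {g : A → F} (hg : AEStronglyMeasurable g (π i)) :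
    ∫ ξ, g (ξ i) ∂Measure.pi π = ∫ x, g x ∂π i :=
  integral_comp_eval (μ := π) (i := i) hg

lemma integral_inner_pi_eq_zero (hu : ∀ i, MemLp (u i) 2 (π i)) (h0 : ∀ i, ∫ ξ, u i ξ ∂π i = 0)
    {i j : Fin n} (hij : i ≠ j) :
    ∫ ξ, inner ℝ (u i (ξ i)) (u j (ξ j)) ∂Measure.pi π = 0 := by
  have hind := (iIndepFun_pi (μ := π) (X := u) fun i => (hu i).1.aemeasurable).indepFun hij
  have hint : ∀ i, Integrable (fun ξ : Fin n → A => u i (ξ i)) (Measure.pi π) := fun i =>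
    (measurePreserving_eval π i).integrable_comp_of_integrable ((hu i).integrable (by norm_num))
  have h : ∫ ξ, inner ℝ (u i (ξ i)) (u j (ξ j)) ∂Measure.pi π
      = inner ℝ (∫ ξ, u i (ξ i) ∂Measure.pi π) (∫ ξ, u j (ξ j) ∂Measure.pi π) :=
    hind.integral_bilin (hint i) (hint j) (innerSL ℝ)
  rw [h, integral_eval_pi π i (hu i).1, h0, inner_zero_left]

/-- Noise of different clients is independent and centred, so the cross terms vanish and averaging
divides the variance bound by `n`. -/
lemma integral_norm_average_sq_le (hn : 0 < n) (hu : ∀ i, MemLp (u i) 2 (π i))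
    (h0 : ∀ i, ∫ ξ, u i ξ ∂π i = 0) {V : ℝ} (hV : ∀ i, ∫ ξ, ‖u i ξ‖ ^ 2 ∂π i ≤ V) :
    MemLp (fun ξ : Fin n → A => average fun i => u i (ξ i)) 2 (Measure.pi π) ∧
    ∫ ξ, (average fun i => u i (ξ i)) ∂Measure.pi π = 0 ∧
    ∫ ξ, ‖average fun i => u i (ξ i)‖ ^ 2 ∂Measure.pi π ≤ V / n := by
  have hm : ∀ i, MemLp (fun ξ : Fin n → A => u i (ξ i)) 2 (Measure.pi π) := fun i =>
    (hu i).comp_measurePreserving (measurePreserving_eval π i)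
  have hi : ∀ i, Integrable (fun ξ : Fin n → A => u i (ξ i)) (Measure.pi π) := fun i =>
    (hm i).integrable (by norm_num)
  refine ⟨?_, ?_, ?_⟩
  · exact (memLp_finsetSum Finset.univ fun i _ => hm i).const_smul (1 / (n : ℝ))
  · simp only [average]
    rw [integral_smul, integral_finsetSum _ fun i _ => hi i]
    rw [Finset.sum_eq_zero fun i _ => by rw [integral_eval_pi π i (hu i).1, h0], smul_zero]
  · have e : ∀ ξ : Fin n → A, ‖average fun i => u i (ξ i)‖ ^ 2
        = (1 / (n : ℝ)) ^ 2 * ∑ i, ∑ j, inner ℝ (u i (ξ i)) (u j (ξ j)) := by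
      intro ξ
      rw [average, norm_smul, mul_pow, Real.norm_eq_abs, sq_abs, ← real_inner_self_eq_norm_sq,
        sum_inner]
      simp only [inner_sum]
    have hij : ∀ i j, Integrable (fun ξ : Fin n → A => inner ℝ (u i (ξ i)) (u j (ξ j)))
        (Measure.pi π) := fun i j =>
      ((hm i).norm.integrable_mul (hm j).norm).mono' ((hm i).1.inner (hm j).1)
        (Filter.Eventually.of_forall fun ξ => norm_inner_le_norm _ _)
    simp only [e]
    rw [integral_const_mul, integral_finsetSum _ fun i _ => integrable_finsetSum _ fun j _ => hij i j]
    have h1 : ∀ i, ∫ ξ, ∑ j, inner ℝ (u i (ξ i)) (u j (ξ j)) ∂Measure.pi π ≤ V := by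
      intro i
      rw [integral_finsetSum _ fun j _ => hij i j, Finset.sum_eq_single i
        (fun j _ hj => integral_inner_pi_eq_zero π hu h0 hj.symm) (by simp)]
      simp only [real_inner_self_eq_norm_sq]
      rw [integral_eval_pi π i (g := fun x => ‖u i x‖ ^ 2) ((hu i).1.norm.pow 2)]
      exact hV i
    have h2 := Finset.sum_le_sum fun i (_ : i ∈ Finset.univ) => h1 i
    simp only [Finset.sum_const, Finset.card_univ, Fintype.card_fin, nsmul_eq_mul] at h2
    have hn' : (0 : ℝ) < n := by positivity
    calc _ ≤ (1 / (n : ℝ)) ^ 2 * (n * V) := by gcongr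
      _ = V / n := by field_simp

end Noise

/-! ### One stochastic iteration decreases the Lyapunov function. -/

section Step

/-- Arithmetic of the one-step decrease of the Lyapunov function. -/
lemma lyapunov_arith {p e l r X q N n R Y A B : ℝ} (hp : 0 < p) (hp1 : p ≤ 1) (he : 0 ≤ e)
    (hep : e ≤ p / 80) (hl : 0 ≤ l) (hlp : l ≤ p / 20) (hr : 0 ≤ r) (hX : 0 ≤ X) (hq : 0 ≤ q)
    (hN : 0 ≤ N) (hn : 0 < n) (hA : A = 3 * l / p) (hB : B = e / (10 * p))
    (hR : R ≤ (1 - 9 / 10 * e) * r + 11 / 10 * l * X + N / n)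
    (hY : Y ≤ (1 + p / 2) * X + (1 + 2 / p) * (e * l) * (X + 2 * r + 2 * q) + N) :
    p * ((1 + B) * R) + (1 - p) * (R + A * Y + B * q)
      ≤ (1 - e / 4) * (r + A * X + B * q) + (5 / 4 * N / n + 3 * l / p * N) := by
  have hAp : A * p = 3 * l := by rw [hA]; field_simp
  have hBp : B * p = e / 10 := by rw [hB]; field_simp
  have hA0 : 0 ≤ A := by rw [hA]; positivity
  have hB0 : 0 ≤ B := by rw [hB]; positivity
  have hA1 : A ≤ 3 / 20 := by rw [hA, div_le_iff₀ hp]; linarith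
  have hNn : 0 ≤ N / n := by positivity
  -- The drift enters only when the coin shows no communication. The factor `2 / p` of Young's
  -- inequality is absorbed by `l ≤ p / 20`.
  have hY2 : (1 - p) * Y ≤ (1 - p / 2) * X + e / 10 * (X + 2 * r + 2 * q) + N := by
    have h1 := mul_le_mul_of_nonneg_left hY (sub_nonneg.2 hp1)
    have h2 : (1 - p) * ((1 + 2 / p) * (e * l)) ≤ e / 10 := by
      have h3 : (1 - p) * ((1 + 2 / p) * (e * l)) = (1 - p) * (p + 2) / 2 * (2 * e * (l / p)) := by
        field_simp
      have h4 : l / p ≤ 1 / 20 := by rw [div_le_iff₀ hp]; linarith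
      have h5 : (1 - p) * (p + 2) / 2 ≤ 1 := by nlinarith only [hp]
      have h6 : 2 * e * (l / p) ≤ e / 10 := by nlinarith only [mul_le_mul_of_nonneg_left h4 he]
      rw [h3]
      calc _ ≤ 1 * (2 * e * (l / p)) := by
            apply mul_le_mul_of_nonneg_right h5; positivity
        _ ≤ e / 10 := by linarith
    have h7 : (1 - p) * (1 + p / 2) ≤ 1 - p / 2 := by nlinarith only [hp]
    have h8 := mul_le_mul_of_nonneg_right h2 (by positivity : 0 ≤ X + 2 * r + 2 * q)
    have h9 := mul_le_mul_of_nonneg_right h7 hX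
    have h10 := mul_nonneg hp.le hN
    linarith
  have hAY := mul_le_mul_of_nonneg_left hY2 hA0
  have he1 : e ≤ 1 / 80 := by linarith only [hep, hp1]
  have hR2 := mul_le_mul_of_nonneg_left hR (by positivity : 0 ≤ 1 + e / 10)
  have hAe : A * e ≤ 3 / 20 * e := mul_le_mul_of_nonneg_right hA1 he
  -- The contraction `9/10 e` pays for the transfer `p B = e / 10` to the synchronized point and for
  -- the growth of the drift.
  have cr : ((1 + e / 10) * (1 - 9 / 10 * e) + A * e / 5) * r ≤ (1 - e / 4) * r := by
    refine mul_le_mul_of_nonneg_right ?_ hr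
    nlinarith only [hAe, he]
  -- The choice of `A` makes `A p / 2 = 3/2 l`, which exceeds the `11/10 l` that the drift costs the
  -- averaged iterate.
  have cX : ((1 + e / 10) * (11 / 10 * l) + A * (1 - p / 2 + e / 10)) * X
      ≤ (1 - e / 4) * A * X := by
    refine mul_le_mul_of_nonneg_right ?_ hX
    have h1 : A * e ≤ A * (p / 80) := mul_le_mul_of_nonneg_left hep hA0
    have h2 : e * l ≤ 1 / 80 * l := mul_le_mul_of_nonneg_right he1 hl
    linarith only [h1, h2, hAp, hl]
  -- The choice of `B` makes `p B = e / 10`, which exceeds `A e / 5 ≤ 3/100 e`.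
  have cq : (A * e / 5 + (1 - p) * B) * q ≤ (1 - e / 4) * B * q := by
    refine mul_le_mul_of_nonneg_right ?_ hq
    have h1 : B * e ≤ B * (p / 80) := mul_le_mul_of_nonneg_left hep hB0
    linarith only [h1, hAe, hBp, he]
  have cN : (1 + e / 10) * (N / n) ≤ 5 / 4 * (N / n) := by
    refine mul_le_mul_of_nonneg_right (by linarith only [he1]) hNn
  have cN2 : A * N = 3 * l / p * N := by rw [hA]
  have expand : p * ((1 + B) * R) + (1 - p) * (R + A * Y + B * q)
      = (1 + e / 10) * R + A * ((1 - p) * Y) + (1 - p) * B * q := by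
    linear_combination R * hBp
  rw [expand, mul_div_assoc, ← cN2]
  linarith only [hAY, hR2, cr, cX, cq, cN]

variable {n : ℕ} {E : Type*} [NormedAddCommGroup E] [InnerProductSpace ℝ E] [CompleteSpace E]
  [MeasurableSpace E] [BorelSpace E] [SecondCountableTopology E]
  {Ξ : Type*} [MeasurableSpace Ξ]

/-- Differences of two stochastic evaluations, with the two samples of client `i` drawn from
`π i`, are unbiased with variance at most `V`. -/
structure IsDifferenceOracle (G : Fin n → E → E) (Ghat : Fin n → E → Ξ → E)
    (π : Fin n → Measure (Ξ × Ξ)) (V : ℝ) : Prop where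
  memLp : ∀ i z z', MemLp (fun ξ => (Ghat i z ξ.1 - Ghat i z' ξ.2) - (G i z - G i z')) 2 (π i)
  integral_eq_zero : ∀ i z z',
    ∫ ξ, ((Ghat i z ξ.1 - Ghat i z' ξ.2) - (G i z - G i z')) ∂π i = 0
  integral_norm_sq_le : ∀ i z z',
    ∫ ξ, ‖(Ghat i z ξ.1 - Ghat i z' ξ.2) - (G i z - G i z')‖ ^ 2 ∂π i ≤ V

/-- One iteration of the solver with equal step sizes, as a map of the pair of the client iterates
and the last synchronized iterate. -/
noncomputable def syncStep (G : Fin n → E → E) (Ghat : Fin n → E → Ξ → E) (γ : ℝ)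
    (s : (Fin n → E) × E) (ω : StepSample n Ξ) : (Fin n → E) × E :=
  let v : Fin n → E := fun i => s.1 i - γ • (Ghat i (s.1 i) (ω.2 i).1 - Ghat i s.2 (ω.2 i).2
    + average fun j => G j s.2)
  if ω.1 = true then (fun _ => average v, average v) else (v, s.2)

/-- The Lyapunov function: squared error of the average, client drift and squared error of the last
synchronized iterate. -/
noncomputable def lyapunov (A B : ℝ) (zstar : E) (s : (Fin n → E) × E) : ℝ :=
  ‖average s.1 - zstar‖ ^ 2 + A * average (fun i => ‖s.1 i - average s.1‖ ^ 2)
    + B * ‖s.2 - zstar‖ ^ 2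

/-- The inequality half of Tonelli holds without measurability of `F`, so none has to be checked in
the one-step estimate. -/
lemma lintegral_stepLaw_le {p : ℝ} (π : Fin n → Measure (Ξ × Ξ)) [∀ i, IsProbabilityMeasure (π i)]
    (F : StepSample n Ξ → ENNReal) :
    ∫⁻ ω, F ω ∂stepLaw p π ≤ ENNReal.ofReal p * ∫⁻ ξ, F (true, ξ) ∂Measure.pi π
      + ENNReal.ofReal (1 - p) * ∫⁻ ξ, F (false, ξ) ∂Measure.pi π := by
  refine (lintegral_prod_le _).trans_eq ?_
  simp [coinLaw, lintegral_add_measure, lintegral_smul_measure, lintegral_dirac]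

/-- Combines the two exact-direction estimates with the noise and both outcomes of the coin;
`lyapunov_arith` closes the budget. The average sees variance `V / n`, the drift sees `V`. -/
theorem lintegral_lyapunov_syncStep_le (hn : 0 < n) {G : Fin n → E → E} {Ghat : Fin n → E → Ξ → E}
    {π : Fin n → Measure (Ξ × Ξ)} [∀ i, IsProbabilityMeasure (π i)] {V p a L γ : ℝ} {zstar : E}
    (hV : 0 ≤ V) (hp : 0 < p) (hp1 : p ≤ 1) (ha : 0 < a) (haL : 2 * a ≤ L) (hγ : 0 ≤ γ)
    (hγL : γ * L ^ 2 ≤ p * a / 20)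
    (hO : IsDifferenceOracle G Ghat π V)
    (hG : ∀ i z z', ‖G i z - G i z'‖ ≤ L * ‖z - z'‖)
    (hm : ∀ z, a * ‖z - zstar‖ ^ 2 ≤ inner ℝ (average fun i => G i z) (z - zstar))
    (hz : average (fun i => G i zstar) = 0) (s : (Fin n → E) × E) :
    ∫⁻ ω, ENNReal.ofReal (lyapunov (3 * (γ * L ^ 2 / a) / p) (γ * a / (10 * p)) zstar
        (syncStep G Ghat γ s ω)) ∂stepLaw p π
      ≤ ENNReal.ofReal ((1 - γ * a / 4)
          * lyapunov (3 * (γ * L ^ 2 / a) / p) (γ * a / (10 * p)) zstar s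
        + (5 / 4 * (γ ^ 2 * V) / n + 3 * (γ * L ^ 2 / a) / p * (γ ^ 2 * V))) := by
  have hL : 0 < L := by linarith
  set e := γ * a with he
  set l := γ * L ^ 2 / a with hl
  set A := 3 * l / p with hA
  set B := e / (10 * p) with hB
  have he0 : 0 ≤ e := by positivity
  have hl0 : 0 ≤ l := by positivity
  have hA0 : 0 ≤ A := by positivity
  have hB0 : 0 ≤ B := by positivity
  have hlp : l ≤ p / 20 := by rw [hl, div_le_iff₀ ha]; linarith
  have hep : e ≤ p / 80 := by
    have h4 : 4 * a ^ 2 ≤ L ^ 2 := by nlinarith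
    have h5 : γ * (4 * a ^ 2) ≤ p * a / 20 := (mul_le_mul_of_nonneg_left h4 hγ).trans hγL
    have h6 : e * a ≤ p / 80 * a := by rw [he]; linarith
    exact le_of_mul_le_mul_right h6 ha
  have hel : γ ^ 2 * L ^ 2 = e * l := by rw [he, hl]; field_simp
  obtain ⟨zs, zt⟩ := s
  set u : Fin n → Ξ × Ξ → E := fun i ξ =>
    (Ghat i (zs i) ξ.1 - Ghat i zt ξ.2) - (G i (zs i) - G i zt) with hu
  set y : Fin n → E := fun i => zs i - γ • (G i (zs i) - G i zt + average fun j => G j zt) with hy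
  set v : (Fin n → Ξ × Ξ) → Fin n → E := fun ξ i => y i - γ • u i (ξ i) with hv
  have hstep : ∀ c ξ, syncStep G Ghat γ (zs, zt) (c, ξ)
      = if c = true then (fun _ => average (v ξ), average (v ξ)) else (v ξ, zt) := by
    intro c ξ
    have : (fun i => zs i - γ • (Ghat i (zs i) (ξ i).1 - Ghat i zt (ξ i).2
        + average fun j => G j zt)) = v ξ := by
      funext i
      simp only [hv, hy, hu, smul_add, smul_sub]
      abel
    simp only [syncStep, this]
  have huL : ∀ i, MemLp (u i) 2 (π i) := fun i => hO.memLp i _ _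
  have hu0 : ∀ i, ∫ ξ, u i ξ ∂π i = 0 := fun i => hO.integral_eq_zero i _ _
  have huV : ∀ i, ∫ ξ, ‖u i ξ‖ ^ 2 ∂π i ≤ V := fun i => hO.integral_norm_sq_le i _ _
  obtain ⟨m1, m2, m3⟩ := integral_norm_average_sq_le π hn huL hu0 huV
  -- the averaged iterate
  have hyav : average y = average zs - γ • average fun i => G i (zs i) := by
    rw [hy, average_sub, average_smul, average_add, average_sub, average_const hn, sub_add_cancel]
  have hvav : ∀ ξ, average (v ξ) - zstar = (average zs - zstar - γ • average fun i => G i (zs i))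
      - γ • average fun i => u i (ξ i) := by
    intro ξ
    simp only [hv]
    rw [average_sub, average_smul, hyav]
    abel
  obtain ⟨iR, eR⟩ := integral_norm_sub_sq_of_integral_eq_zero m1 m2
    (average zs - zstar - γ • average fun i => G i (zs i)) γ
  simp only [← hvav] at iR eR
  set R := ∫ ξ, ‖average (v ξ) - zstar‖ ^ 2 ∂Measure.pi π with hRdef
  -- the client drift
  set D : (Fin n → Ξ × Ξ) → ℝ := fun ξ =>
    average fun i => ‖(y i - average y) - γ • u i (ξ i)‖ ^ 2 with hD
  have hDle : ∀ ξ, average (fun i => ‖v ξ i - average (v ξ)‖ ^ 2) ≤ D ξ := by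
    intro ξ
    refine (average_norm_sub_average_sq_le hn (v ξ) (average y)).trans_eq ?_
    simp only [hD, hv]
    congr 1
    funext i
    congr 2
    abel
  have hD0 : ∀ ξ, 0 ≤ D ξ := fun ξ => average_nonneg fun i => by positivity
  have hDi : ∀ i, Integrable (fun ξ : Fin n → Ξ × Ξ =>
      ‖(y i - average y) - γ • u i (ξ i)‖ ^ 2) (Measure.pi π) := fun i =>
    (measurePreserving_eval π i).integrable_comp_of_integrable
      (integral_norm_sub_sq_of_integral_eq_zero (huL i) (hu0 i) (y i - average y) γ).1
  have iD : Integrable D (Measure.pi π) := by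
    simp only [hD, average, smul_eq_mul]
    exact (integrable_finsetSum _ fun i _ => hDi i).const_mul _
  have eD : ∫ ξ, D ξ ∂Measure.pi π
      ≤ average (fun i => ‖y i - average y‖ ^ 2) + γ ^ 2 * V := by
    have h1 : ∫ ξ, D ξ ∂Measure.pi π = average fun i =>
        ∫ ξ, ‖(y i - average y) - γ • u i (ξ i)‖ ^ 2 ∂Measure.pi π := by
      simp only [hD]
      unfold average
      simp only [smul_eq_mul]
      rw [integral_const_mul]
      exact congrArg _ (integral_finsetSum _ fun i _ => hDi i)
    rw [h1, ← average_const hn (γ ^ 2 * V), ← average_add]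
    refine average_mono fun i => ?_
    have h2 := integral_norm_sub_sq_of_integral_eq_zero (huL i) (hu0 i) (y i - average y) γ
    rw [integral_eval_pi π i (g := fun x => ‖(y i - average y) - γ • u i x‖ ^ 2) h2.1.1, h2.2]
    have := mul_le_mul_of_nonneg_left (huV i) (sq_nonneg γ)
    linarith
  set Y := ∫ ξ, D ξ ∂Measure.pi π
  -- the two outcomes of the coin
  have htrue : ∫⁻ ξ, ENNReal.ofReal (lyapunov A B zstar (syncStep G Ghat γ (zs, zt) (true, ξ)))
      ∂Measure.pi π = ENNReal.ofReal ((1 + B) * R) := by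
    rw [hRdef, ← integral_const_mul, ofReal_integral_eq_lintegral_ofReal (iR.const_mul _)
      (Filter.Eventually.of_forall fun ξ => by positivity)]
    congr 1
    funext ξ
    rw [hstep]
    simp only [lyapunov, if_true, average_const hn, sub_self, norm_zero]
    congr 1
    ring
  have hfalse : ∫⁻ ξ, ENNReal.ofReal (lyapunov A B zstar (syncStep G Ghat γ (zs, zt) (false, ξ)))
      ∂Measure.pi π ≤ ENNReal.ofReal (R + A * Y + B * ‖zt - zstar‖ ^ 2) := by
    have iRD : Integrable (fun ξ => ‖average (v ξ) - zstar‖ ^ 2 + A * D ξ) (Measure.pi π) :=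
      iR.add (iD.const_mul A)
    have h1 : R + A * Y + B * ‖zt - zstar‖ ^ 2 = ∫ ξ, (‖average (v ξ) - zstar‖ ^ 2 + A * D ξ
        + B * ‖zt - zstar‖ ^ 2) ∂Measure.pi π := by
      rw [integral_add iRD (integrable_const _),
        integral_add iR (iD.const_mul A), integral_const_mul]
      simp [hRdef, Y]
    have iT : Integrable (fun ξ => ‖average (v ξ) - zstar‖ ^ 2 + A * D ξ
        + B * ‖zt - zstar‖ ^ 2) (Measure.pi π) := iRD.add (integrable_const _)
    rw [h1, ofReal_integral_eq_lintegral_ofReal iT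
      (Filter.Eventually.of_forall fun ξ => add_nonneg (add_nonneg (sq_nonneg _)
        (mul_nonneg hA0 (hD0 ξ))) (mul_nonneg hB0 (sq_nonneg _)))]
    refine lintegral_mono fun ξ => ENNReal.ofReal_le_ofReal ?_
    rw [hstep]
    simp only [lyapunov, Bool.false_eq_true, if_false]
    have := mul_le_mul_of_nonneg_left (hDle ξ) hA0
    linarith
  have hR0 : 0 ≤ R := integral_nonneg fun ξ => by positivity
  have hY0 : 0 ≤ Y := integral_nonneg hD0
  have h1p : 0 ≤ 1 - p := by linarith
  refine (lintegral_stepLaw_le π _).trans ?_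
  rw [htrue]
  refine (add_le_add_right (mul_le_mul_right hfalse _) _).trans ?_
  rw [← ENNReal.ofReal_mul hp.le, ← ENNReal.ofReal_mul h1p,
    ← ENNReal.ofReal_add (by positivity) (by positivity)]
  refine ENNReal.ofReal_le_ofReal ?_
  refine lyapunov_arith (N := γ ^ 2 * V) (X := average fun i => ‖zs i - average zs‖ ^ 2) hp hp1 he0
    hep hl0 hlp (sq_nonneg _) (average_nonneg fun i => by positivity) (sq_nonneg _) (by positivity)
    (by positivity : (0 : ℝ) < n) rfl rfl ?_ ?_
  · have h1 := norm_average_step_sq_le (zs := zs) hn ha hL hγ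
      (hγL.trans (by nlinarith)) haL hG hm hz
    have h2 := mul_le_mul_of_nonneg_left m3 (sq_nonneg γ)
    rw [eR, mul_div_assoc]
    linarith
  · have h1 := average_drift_step_sq_le (zs := zs) (zt := zt) (zstar := zstar) (y := y) (γ := γ) hn
      hp hG fun i => rfl
    rw [hel] at h1
    linarith

end Step

/-! ### Conditioning by freezing an independent variable. -/

section Independence

variable {Ω α β : Type*} [mΩ : MeasurableSpace Ω] [MeasurableSpace α] [MeasurableSpace β]
  {P : Measure Ω} [IsProbabilityMeasure P]

/-- Replaces conditional expectation: with the past `X` frozen, the fresh randomness `Y` is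
integrated separately. -/
lemma lintegral_comp_indepFun {X : Ω → α} {Y : Ω → β} (h : IndepFun X Y P) (hX : Measurable X)
    (hY : Measurable Y) {F : α × β → ENNReal} (hF : Measurable F) :
    ∫⁻ ω, F (X ω, Y ω) ∂P = ∫⁻ ω, ∫⁻ ω', F (X ω, Y ω') ∂P ∂P := by
  rw [← lintegral_map hF (hX.prodMk hY), h.map_prod_eq_prod_map_map hX.aemeasurable hY.aemeasurable,
    lintegral_prod _ hF.aemeasurable, lintegral_map hF.lintegral_prod_right' hX]
  refine lintegral_congr fun ω => ?_
  exact lintegral_map (f := fun y => F (X ω, y)) (hF.comp measurable_prodMk_left) hY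

/-- The sigma-algebra generated by the variables with index in `I`. -/
abbrev generatedBy {ι : Type*} (S : ι → Ω → β) (I : Set ι) : MeasurableSpace Ω :=
  ⨆ i ∈ I, MeasurableSpace.comap (S i) inferInstance

lemma measurable_generatedBy {ι : Type*} (S : ι → Ω → β) {I : Set ι} {i : ι} (hi : i ∈ I) :
    Measurable[generatedBy S I] (S i) :=
  Measurable.mono (comap_measurable (S i))
    (le_iSup₂ (f := fun i (_ : i ∈ I) => MeasurableSpace.comap (S i) inferInstance) i hi) le_rfl

lemma indepFun_of_generatedBy {ι : Type*} {S : ι → Ω → β} (hS : ∀ i, Measurable (S i))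
    (hind : iIndepFun S P) {I J : Set ι} (hIJ : Disjoint I J) {γ : Type*} [MeasurableSpace γ]
    {X : Ω → α} {Y : Ω → γ} (hX : Measurable[generatedBy S I] X)
    (hY : Measurable[generatedBy S J] Y) : IndepFun X Y P := by
  have h := indep_iSup_of_disjoint (fun i => (hS i).comap_le) hind.iIndep hIJ
  rw [IndepFun_iff_Indep]
  exact indep_of_indep_of_le_left (indep_of_indep_of_le_right h hY.comap_le) hX.comap_le

end Independence

/-! ### Iterating the Lyapunov estimate. -/

section Iteration

variable {n : ℕ} {E : Type*} [NormedAddCommGroup E] [InnerProductSpace ℝ E]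
  {Ξ : Type*} [MeasurableSpace Ξ]

/-- The iterates of `syncStep`. -/
noncomputable def syncState (G : Fin n → E → E) (Ghat : Fin n → E → Ξ → E) (γ : ℝ) (z0 : E)
    (ω : ℕ → StepSample n Ξ) : ℕ → (Fin n → E) × E
  | 0 => (fun _ => z0, z0)
  | k + 1 => syncStep G Ghat γ (syncState G Ghat γ z0 ω k) (ω k)

variable [MeasurableSpace E] [BorelSpace E] [SecondCountableTopology E]

lemma measurable_average {X : Type*} [MeasurableSpace X] {v : X → Fin n → E}
    (h : ∀ i, Measurable fun x => v x i) : Measurable fun x => average (v x) := by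
  unfold average
  exact (Finset.measurable_fun_sum _ fun i _ => h i).const_smul _

lemma measurable_syncStep {X : Type*} [MeasurableSpace X] {G : X → Fin n → E → E}
    {Ghat : X → Fin n → E → Ξ → E} {γ : X → ℝ} {s : X → (Fin n → E) × E} {ω : X → StepSample n Ξ}
    (hG : ∀ i, Measurable fun q : X × E => G q.1 i q.2)
    (hGhat : ∀ i, Measurable fun q : X × E × Ξ => Ghat q.1 i q.2.1 q.2.2)
    (hγ : Measurable γ) (hs : Measurable s) (hω : Measurable ω) :
    Measurable fun x => syncStep (G x) (Ghat x) (γ x) (s x) (ω x) := by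
  have hs1 : ∀ i, Measurable fun x => (s x).1 i := fun i => (measurable_pi_apply i).comp hs.fst
  have hω2 : ∀ i, Measurable fun x => (ω x).2 i := fun i => (measurable_pi_apply i).comp hω.snd
  have hv : ∀ i, Measurable fun x => (s x).1 i - γ x • (Ghat x i ((s x).1 i) ((ω x).2 i).1
      - Ghat x i (s x).2 ((ω x).2 i).2 + average fun j => G x j (s x).2) := by
    intro i
    refine (hs1 i).sub (hγ.smul (((?_ : Measurable _).sub ?_).add (measurable_average fun j => ?_)))
    · exact (hGhat i).comp (measurable_id.prodMk ((hs1 i).prodMk (hω2 i).fst))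
    · exact (hGhat i).comp (measurable_id.prodMk (hs.snd.prodMk (hω2 i).snd))
    · exact (hG j).comp (measurable_id.prodMk hs.snd)
  unfold syncStep
  refine Measurable.ite (hω.fst (measurableSet_singleton true)) ?_ ?_
  · have := measurable_average hv
    exact (measurable_pi_lambda _ fun _ => this).prodMk this
  · exact (measurable_pi_lambda _ hv).prodMk hs.snd

/-- Only the samples before `k` are required to be measurable, so the statement also applies with
the sigma-algebra generated by the past. -/
lemma measurable_syncState {X : Type*} [MeasurableSpace X] {G : X → Fin n → E → E}
    {Ghat : X → Fin n → E → Ξ → E} {γ : X → ℝ} {z0 : X → E} {ω : X → ℕ → StepSample n Ξ}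
    (hG : ∀ i, Measurable fun q : X × E => G q.1 i q.2)
    (hGhat : ∀ i, Measurable fun q : X × E × Ξ => Ghat q.1 i q.2.1 q.2.2)
    (hγ : Measurable γ) (hz0 : Measurable z0) (k : ℕ) (hω : ∀ j < k, Measurable fun x => ω x j) :
    Measurable fun x => syncState (G x) (Ghat x) (γ x) (z0 x) (ω x) k := by
  induction k with
  | zero => exact (measurable_pi_lambda _ fun _ => hz0).prodMk hz0
  | succ k ih =>
    exact measurable_syncStep hG hGhat hγ (ih fun j hj => hω j (by omega)) (hω k (by omega))

lemma measurable_lyapunov (A B : ℝ) (zstar : E) :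
    Measurable (lyapunov (n := n) A B zstar) := by
  have h0 : ∀ i, Measurable fun s : (Fin n → E) × E => s.1 i := fun i =>
    (measurable_pi_apply i).comp measurable_fst
  have h1 : Measurable fun s : (Fin n → E) × E => average s.1 := measurable_average h0
  unfold lyapunov
  refine (((h1.sub_const _).norm.pow_const 2).add ((measurable_average fun i => ?_).const_mul A)).add
    (((measurable_snd.sub_const _).norm.pow_const 2).const_mul B)
  exact ((h0 i).sub h1).norm.pow_const 2

variable [CompleteSpace E] {Ω : Type*} [MeasurableSpace Ω] {P : Measure Ω} [IsProbabilityMeasure P]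

/-- The noise term is the one-step noise divided by `γ a / 4`, the fixed point of the affine
recursion; this makes the induction step an identity. -/
theorem lintegral_lyapunov_syncState_le (hn : 0 < n) {G : Fin n → E → E} {Ghat : Fin n → E → Ξ → E}
    {π : Fin n → Measure (Ξ × Ξ)} [∀ i, IsProbabilityMeasure (π i)] {V p a L γ : ℝ} {z0 zstar : E}
    (hV : 0 ≤ V) (hp : 0 < p) (hp1 : p ≤ 1) (ha : 0 < a) (haL : 2 * a ≤ L) (hγ : 0 < γ)
    (hγL : γ * L ^ 2 ≤ p * a / 20) (hO : IsDifferenceOracle G Ghat π V)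
    (hGhat : ∀ i, Measurable (Function.uncurry (Ghat i)))
    (hG : ∀ i z z', ‖G i z - G i z'‖ ≤ L * ‖z - z'‖)
    (hm : ∀ z, a * ‖z - zstar‖ ^ 2 ≤ inner ℝ (average fun i => G i z) (z - zstar))
    (hz : average (fun i => G i zstar) = 0) {S : ℕ → Ω → StepSample n Ξ}
    (hS : ∀ k, Measurable (S k)) (hlaw : ∀ k, P.map (S k) = stepLaw p π) (hind : iIndepFun S P)
    (k : ℕ) :
    ∫⁻ ω, ENNReal.ofReal (lyapunov (3 * (γ * L ^ 2 / a) / p) (γ * a / (10 * p)) zstar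
        (syncState G Ghat γ z0 (fun k => S k ω) k)) ∂P
      ≤ ENNReal.ofReal ((1 - γ * a / 4) ^ k * ((1 + γ * a / (10 * p)) * ‖z0 - zstar‖ ^ 2)
        + (5 * γ * V / (n * a) + 12 * γ ^ 2 * L ^ 2 * V / (p * a ^ 2))) := by
  have hL : 0 < L := by linarith
  have hGm : ∀ i, Measurable (G i) := fun i =>
    (LipschitzWith.of_dist_le_mul (K := ⟨L, hL.le⟩) fun z z' => by
      rw [dist_eq_norm, dist_eq_norm]; exact hG i z z').continuous.measurable
  -- The sigma-algebra is a variable: it is used both for the ambient one and for the one generated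
  -- by the samples before `k`, which yields independence from sample `k`.
  have hmeas : ∀ (m : MeasurableSpace Ω) k (_ : ∀ j < k, Measurable[m] (S j)),
      Measurable[m] fun ω => syncState G Ghat γ z0 (fun k => S k ω) k := by
    intro m k hω
    exact measurable_syncState (X := Ω) (G := fun _ => G) (Ghat := fun _ => Ghat)
      (γ := fun _ => γ) (z0 := fun _ => z0) (ω := fun ω k => S k ω)
      (fun i => (hGm i).comp measurable_snd) (fun i => (hGhat i).comp measurable_snd)
      measurable_const measurable_const k hω
  have hstepm : Measurable fun q : ((Fin n → E) × E) × StepSample n Ξ => syncStep G Ghat γ q.1 q.2 :=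
    measurable_syncStep (G := fun _ => G) (Ghat := fun _ => Ghat) (γ := fun _ => γ)
      (fun i => (hGm i).comp measurable_snd) (fun i => (hGhat i).comp measurable_snd)
      measurable_const measurable_fst measurable_snd
  have hea : 0 < γ * a := by positivity
  have he1 : γ * a ≤ 1 / 80 := by
    have h4 : 4 * a ^ 2 ≤ L ^ 2 := by nlinarith
    have h5 : γ * (4 * a ^ 2) ≤ p * a / 20 := (mul_le_mul_of_nonneg_left h4 hγ.le).trans hγL
    have h6 : γ * a * a ≤ 1 / 80 * a := by nlinarith
    exact le_of_mul_le_mul_right h6 ha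
  have h1e : 0 ≤ 1 - γ * a / 4 := by linarith only [he1]
  induction k with
  | zero =>
    simp only [syncState, lyapunov, average_const hn, sub_self, norm_zero, lintegral_const,
      measure_univ, mul_one]
    refine ENNReal.ofReal_le_ofReal ?_
    have : 0 ≤ 5 * γ * V / (n * a) + 12 * γ ^ 2 * L ^ 2 * V / (p * a ^ 2) := by positivity
    simp only [ne_eq, OfNat.ofNat_ne_zero, not_false_eq_true, zero_pow, mul_zero, pow_zero,
      one_mul]
    linarith
  | succ k ih =>
    set A := 3 * (γ * L ^ 2 / a) / p
    set B := γ * a / (10 * p)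
    have hA0 : 0 ≤ A := by positivity
    have hB0 : 0 ≤ B := by positivity
    have hΦ0 : ∀ s : (Fin n → E) × E, 0 ≤ lyapunov A B zstar s := by
      intro s
      have : 0 ≤ average fun i => ‖s.1 i - average s.1‖ ^ 2 :=
        average_nonneg fun i => by positivity
      unfold lyapunov
      positivity
    have hindep : IndepFun (fun ω => syncState G Ghat γ z0 (fun k => S k ω) k) (S k) P :=
      indepFun_of_generatedBy hS hind (I := Set.Iio k) (J := {k}) (by simp)
        (hmeas _ k fun j hj => measurable_generatedBy S hj)
        (measurable_generatedBy S (Set.mem_singleton k))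
    have hF : Measurable fun q : ((Fin n → E) × E) × StepSample n Ξ =>
        ENNReal.ofReal (lyapunov A B zstar (syncStep G Ghat γ q.1 q.2)) :=
      ((measurable_lyapunov A B zstar).comp hstepm).ennreal_ofReal
    have h1 := lintegral_comp_indepFun hindep (hmeas _ k fun j _ => hS j) (hS k) hF
    simp only [syncState]
    rw [h1]
    set N0 := 5 / 4 * (γ ^ 2 * V) / n + 3 * (γ * L ^ 2 / a) / p * (γ ^ 2 * V)
    have hN0 : 0 ≤ N0 := by positivity
    have h2 : ∀ ω, ∫⁻ ω', ENNReal.ofReal (lyapunov A B zstar (syncStep G Ghat γ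
        (syncState G Ghat γ z0 (fun k => S k ω) k) (S k ω'))) ∂P
        ≤ ENNReal.ofReal (1 - γ * a / 4) * ENNReal.ofReal (lyapunov A B zstar
          (syncState G Ghat γ z0 (fun k => S k ω) k)) + ENNReal.ofReal N0 := by
      intro ω
      have h3 : ∀ s, ∫⁻ ω', ENNReal.ofReal (lyapunov A B zstar (syncStep G Ghat γ s (S k ω'))) ∂P
          = ∫⁻ x, ENNReal.ofReal (lyapunov A B zstar (syncStep G Ghat γ s x)) ∂stepLaw p π := by
        intro s
        rw [← hlaw k]
        have h4 : Measurable fun x => ENNReal.ofReal (lyapunov A B zstar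
            (syncStep G Ghat γ s x)) :=
          ((measurable_lyapunov A B zstar).comp
            (hstepm.comp (measurable_const.prodMk measurable_id))).ennreal_ofReal
        exact (lintegral_map h4 (hS k)).symm
      rw [h3]
      generalize syncState G Ghat γ z0 (fun k => S k ω) k = s
      have h4 : ENNReal.ofReal (1 - γ * a / 4) * ENNReal.ofReal (lyapunov A B zstar s)
          + ENNReal.ofReal N0 = ENNReal.ofReal ((1 - γ * a / 4) * lyapunov A B zstar s + N0) := by
        rw [ENNReal.ofReal_add (mul_nonneg h1e (hΦ0 s)) hN0, ENNReal.ofReal_mul h1e]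
      rw [h4]
      exact lintegral_lyapunov_syncStep_le hn hV hp hp1 ha haL hγ.le hγL hO hG hm hz _
    refine (lintegral_mono h2).trans ?_
    rw [lintegral_add_right _ measurable_const, lintegral_const, measure_univ, mul_one,
      lintegral_const_mul' _ _ ENNReal.ofReal_ne_top]
    refine (add_le_add_left (mul_le_mul_right ih _) _).trans ?_
    rw [← ENNReal.ofReal_mul h1e, ← ENNReal.ofReal_add (by positivity) hN0]
    refine ENNReal.ofReal_le_ofReal (le_of_eq ?_)
    have hn' : (0 : ℝ) < n := by positivity
    simp only [N0]
    field_simp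
    ring

end Iteration

/-! ### The weighted output. -/

section Output

variable {E : Type*} [NormedAddCommGroup E] [InnerProductSpace ℝ E]

/-- The weights of the output. -/
noncomputable def outputWeight (ρ : ℝ) (k : ℕ) : ℝ := ρ ^ (1 - (k : ℤ))

/-- Normalized weights of the output. -/
noncomputable def normWeight (ρ : ℝ) (K k : ℕ) : ℝ :=
  (1 / ∑ j ∈ Finset.range (K + 1), outputWeight ρ j) * outputWeight ρ k

lemma outputWeight_pos {ρ : ℝ} (hρ : 0 < ρ) (k : ℕ) : 0 < outputWeight ρ k := zpow_pos hρ _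

lemma normWeight_nonneg {ρ : ℝ} (hρ : 0 < ρ) (K k : ℕ) : 0 ≤ normWeight ρ K k :=
  mul_nonneg (one_div_nonneg.2 (Finset.sum_nonneg fun j _ => (outputWeight_pos hρ j).le))
    (outputWeight_pos hρ k).le

lemma sum_outputWeight_pos {ρ : ℝ} (hρ : 0 < ρ) (K : ℕ) :
    0 < ∑ j ∈ Finset.range (K + 1), outputWeight ρ j :=
  Finset.sum_pos (fun j _ => outputWeight_pos hρ j) (by simp)

lemma sum_normWeight {ρ : ℝ} (hρ : 0 < ρ) (K : ℕ) :
    ∑ k ∈ Finset.range (K + 1), normWeight ρ K k = 1 := by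
  simp only [normWeight, ← Finset.mul_sum]
  exact one_div_mul_cancel (sum_outputWeight_pos hρ K).ne'

/-- Since `ρ^(1 - k) ρ^(2 k) = ρ^(1 + k) = ρ^K ρ^(1 - (K - k))`, reversing the sum reproduces the
normalizer times `ρ^K`. Weights at half the decay rate thus keep exponential decay without a
prefactor `1 / (γ a)`. -/
lemma sum_normWeight_mul_pow {ρ : ℝ} (hρ : 0 < ρ) (K : ℕ) :
    ∑ k ∈ Finset.range (K + 1), normWeight ρ K k * (ρ ^ 2) ^ k = ρ ^ K := by
  have h1 : ∑ k ∈ Finset.range (K + 1), outputWeight ρ k * (ρ ^ 2) ^ k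
      = ρ ^ K * ∑ k ∈ Finset.range (K + 1), outputWeight ρ k := by
    rw [← Finset.sum_range_reflect (fun k => outputWeight ρ k) (K + 1), Finset.mul_sum]
    refine Finset.sum_congr rfl fun k hk => ?_
    have hk' : k ≤ K := by simpa [Nat.lt_succ_iff] using hk
    unfold outputWeight
    rw [← pow_mul, ← zpow_natCast, ← zpow_natCast, ← zpow_add₀ hρ.ne', ← zpow_add₀ hρ.ne']
    congr 1
    have : ((K + 1 - 1 - k : ℕ) : ℤ) = K - k := by omega
    rw [this]
    push_cast
    ring
  simp only [normWeight, mul_assoc, ← Finset.mul_sum]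
  rw [h1]
  have := (sum_outputWeight_pos hρ K).ne'
  field_simp

lemma norm_weighted_sub_sq_le {ρ : ℝ} (hρ : 0 < ρ) (K : ℕ) (z : ℕ → E) (zstar : E) :
    ‖(1 / ∑ k ∈ Finset.range (K + 1), outputWeight ρ k) •
        ∑ k ∈ Finset.range (K + 1), outputWeight ρ k • z k - zstar‖ ^ 2
      ≤ ∑ k ∈ Finset.range (K + 1), normWeight ρ K k * ‖z k - zstar‖ ^ 2 := by
  have hconv : ConvexOn ℝ Set.univ fun x : E => ‖x‖ ^ 2 :=
    (convexOn_norm convex_univ).pow (fun x _ => norm_nonneg x) 2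
  have h := hconv.map_sum_le (t := Finset.range (K + 1)) (w := normWeight ρ K)
    (p := fun k => z k - zstar) (fun k _ => normWeight_nonneg hρ K k) (sum_normWeight hρ K)
    (fun _ _ => Set.mem_univ _)
  have e : ∑ k ∈ Finset.range (K + 1), normWeight ρ K k • (z k - zstar)
      = (1 / ∑ k ∈ Finset.range (K + 1), outputWeight ρ k) •
        ∑ k ∈ Finset.range (K + 1), outputWeight ρ k • z k - zstar := by
    simp only [smul_sub, Finset.sum_sub_distrib, ← Finset.sum_smul, sum_normWeight hρ, one_smul]
    simp only [normWeight, mul_smul, ← Finset.smul_sum]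
  rw [e] at h
  simpa using h

end Output

/-! ### Error of SCAFFOLD-S for an arbitrary admissible step size. -/

section InnerSolver

variable {m d n : ℕ} {Ξ : Type*} [MeasurableSpace Ξ]

/-- With equal step sizes each client iterate is the synchronized iterate minus `γ` times its
accumulated directions. The global step from the synchronized iterate is therefore the average of
the local steps. -/
lemma scaffoldState_eq_syncState (hn : 0 < n) (G : Fin n → Pt m d → Pt m d)
    (Ghat : Fin n → Pt m d → Ξ → Pt m d) (γ : ℝ) (z0 : Pt m d) (ω : ℕ → StepSample n Ξ) (k : ℕ) :
    (scaffoldState G Ghat γ γ z0 ω k).client = (syncState G Ghat γ z0 ω k).1 ∧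
    (scaffoldState G Ghat γ γ z0 ω k).sync = (syncState G Ghat γ z0 ω k).2 ∧
    ∀ i, (scaffoldState G Ghat γ γ z0 ω k).client i = (scaffoldState G Ghat γ γ z0 ω k).sync
      - γ • (scaffoldState G Ghat γ γ z0 ω k).acc i := by
  induction k with
  | zero => simp [scaffoldState, syncState]
  | succ k ih =>
    obtain ⟨h1, h2, h3⟩ := ih
    set s := scaffoldState G Ghat γ γ z0 ω k with hs
    have e : (syncState G Ghat γ z0 ω k) = (s.client, s.sync) := by
      rw [h1, h2]
    simp only [scaffoldState, syncState, ← hs, e, scaffoldStep, syncStep]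
    have hav : ∀ g : Fin n → Pt m d, s.sync - γ • ((1 / (n : ℝ)) • ∑ i, (s.acc i + g i))
        = average fun i => s.client i - γ • g i := by
      intro g
      have : (fun i => s.client i - γ • g i) = fun i => s.sync - γ • (s.acc i + g i) := by
        funext i
        rw [h3, smul_add]
        abel
      rw [this, average_sub, average_const hn, average_smul]
      rfl
    by_cases hc : (ω k).1 = true
    · simp only [hc, if_true]
      refine ⟨?_, ?_, fun i => by simp⟩
      · funext _
        exact hav _
      · exact hav _
    · simp only [hc]
      refine ⟨rfl, rfl, fun i => ?_⟩
      simp only [Bool.false_eq_true, if_false]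
      rw [smul_add γ (s.acc i), ← sub_sub, ← h3 i]

lemma scaffoldOutput_eq (hn : 0 < n) (G : Fin n → Pt m d → Pt m d)
    (Ghat : Fin n → Pt m d → Ξ → Pt m d) (a γ : ℝ) (K : ℕ) (z0 : Pt m d)
    (ω : ℕ → StepSample n Ξ) :
    scaffoldOutput G Ghat a γ K z0 ω
      = (1 / ∑ k ∈ Finset.range (K + 1), outputWeight (1 - γ * a / 8) k) •
        ∑ k ∈ Finset.range (K + 1), outputWeight (1 - γ * a / 8) k •
          average (syncState G Ghat γ z0 ω k).1 := by
  simp only [scaffoldOutput, (scaffoldState_eq_syncState hn G Ghat γ z0 ω _).1]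
  rfl

variable {Ω : Type*} [MeasurableSpace Ω] {P : Measure Ω} [IsProbabilityMeasure P]

theorem lintegral_norm_scaffoldOutput_sub_sq_le (hn : 0 < n) {G : Fin n → Pt m d → Pt m d}
    {Ghat : Fin n → Pt m d → Ξ → Pt m d} {π : Fin n → Measure (Ξ × Ξ)}
    [∀ i, IsProbabilityMeasure (π i)] {V p a L γ : ℝ} {z0 zstar : Pt m d}
    (hV : 0 ≤ V) (hp : 0 < p) (hp1 : p ≤ 1) (ha : 0 < a) (haL : 2 * a ≤ L) (hγ : 0 < γ)
    (hγL : γ * L ^ 2 ≤ p * a / 20) (hO : IsDifferenceOracle G Ghat π V)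
    (hGhat : ∀ i, Measurable (Function.uncurry (Ghat i)))
    (hG : ∀ i z z', ‖G i z - G i z'‖ ≤ L * ‖z - z'‖)
    (hm : ∀ z, a * ‖z - zstar‖ ^ 2 ≤ inner ℝ (average fun i => G i z) (z - zstar))
    (hz : average (fun i => G i zstar) = 0) {S : ℕ → Ω → StepSample n Ξ}
    (hS : ∀ k, Measurable (S k)) (hlaw : ∀ k, P.map (S k) = stepLaw p π) (hind : iIndepFun S P)
    (K : ℕ) :
    ∫⁻ ω, ENNReal.ofReal (‖scaffoldOutput G Ghat a γ K z0 (fun k => S k ω) - zstar‖ ^ 2) ∂P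
      ≤ ENNReal.ofReal (2 * (1 - γ * a / 8) ^ K * ‖z0 - zstar‖ ^ 2
        + (5 * γ * V / (n * a) + 12 * γ ^ 2 * L ^ 2 * V / (p * a ^ 2))) := by
  have hL : 0 < L := by linarith
  have hGm : ∀ i, Measurable (G i) := fun i =>
    (LipschitzWith.of_dist_le_mul (K := ⟨L, hL.le⟩) fun z z' => by
      rw [dist_eq_norm, dist_eq_norm]; exact hG i z z').continuous.measurable
  have hea : 0 < γ * a := by positivity
  have hep : γ * a ≤ p / 80 := by
    have h4 : 4 * a ^ 2 ≤ L ^ 2 := by nlinarith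
    have h5 : γ * (4 * a ^ 2) ≤ p * a / 20 := (mul_le_mul_of_nonneg_left h4 hγ.le).trans hγL
    have h6 : γ * a * a ≤ p / 80 * a := by nlinarith
    exact le_of_mul_le_mul_right h6 ha
  set ρ := 1 - γ * a / 8 with hρdef
  have hρ : 0 < ρ := by linarith
  set A := 3 * (γ * L ^ 2 / a) / p
  set B := γ * a / (10 * p)
  have hA0 : 0 ≤ A := by positivity
  have hB0 : 0 ≤ B := by positivity
  have hB1 : B ≤ 1 := by
    rw [div_le_one (by positivity)]; linarith
  set N' := 5 * γ * V / (n * a) + 12 * γ ^ 2 * L ^ 2 * V / (p * a ^ 2)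
  have hN' : 0 ≤ N' := by positivity
  have hmeas : ∀ k, Measurable fun ω => syncState G Ghat γ z0 (fun k => S k ω) k := fun k =>
    measurable_syncState (X := Ω) (G := fun _ => G) (Ghat := fun _ => Ghat)
      (γ := fun _ => γ) (z0 := fun _ => z0) (ω := fun ω k => S k ω)
      (fun i => (hGm i).comp measurable_snd) (fun i => (hGhat i).comp measurable_snd)
      measurable_const measurable_const k fun j _ => hS j
  have h1 : ∀ ω, ENNReal.ofReal (‖scaffoldOutput G Ghat a γ K z0 (fun k => S k ω) - zstar‖ ^ 2)
      ≤ ∑ k ∈ Finset.range (K + 1), ENNReal.ofReal (normWeight ρ K k) * ENNReal.ofReal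
        (lyapunov A B zstar (syncState G Ghat γ z0 (fun k => S k ω) k)) := by
    intro ω
    have hle : ∀ s : (Fin n → Pt m d) × Pt m d,
        ‖average s.1 - zstar‖ ^ 2 ≤ lyapunov A B zstar s := by
      intro s
      have : 0 ≤ average fun i => ‖s.1 i - average s.1‖ ^ 2 :=
        average_nonneg fun i => by positivity
      unfold lyapunov
      have h2 : 0 ≤ A * average fun i => ‖s.1 i - average s.1‖ ^ 2 := by positivity
      have h3 : 0 ≤ B * ‖s.2 - zstar‖ ^ 2 := by positivity
      linarith
    rw [scaffoldOutput_eq hn]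
    refine (ENNReal.ofReal_le_ofReal (norm_weighted_sub_sq_le hρ K _ zstar)).trans ?_
    rw [ENNReal.ofReal_sum_of_nonneg fun k _ =>
      mul_nonneg (normWeight_nonneg hρ K k) (sq_nonneg _)]
    refine Finset.sum_le_sum fun k _ => ?_
    rw [ENNReal.ofReal_mul (normWeight_nonneg hρ K k)]
    exact mul_le_mul_right (ENNReal.ofReal_le_ofReal (hle _)) _
  refine (lintegral_mono h1).trans ?_
  have hm2 : ∀ k, Measurable fun ω => ENNReal.ofReal (normWeight ρ K k) * ENNReal.ofReal
      (lyapunov A B zstar (syncState G Ghat γ z0 (fun k => S k ω) k)) := fun k =>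
    (((measurable_lyapunov A B zstar).comp (hmeas k)).ennreal_ofReal).const_mul _
  rw [lintegral_finsetSum _ fun k _ => hm2 k]
  have h2 : ∀ k, ∫⁻ ω, ENNReal.ofReal (normWeight ρ K k) * ENNReal.ofReal
        (lyapunov A B zstar (syncState G Ghat γ z0 (fun k => S k ω) k)) ∂P
      ≤ ENNReal.ofReal (normWeight ρ K k *
        ((ρ ^ 2) ^ k * ((1 + B) * ‖z0 - zstar‖ ^ 2) + N')) := by
    intro k
    rw [lintegral_const_mul' _ _ ENNReal.ofReal_ne_top,
      ENNReal.ofReal_mul (normWeight_nonneg hρ K k)]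
    refine mul_le_mul_right ((lintegral_lyapunov_syncState_le hn hV hp hp1 ha haL hγ hγL hO hGhat hG
      hm hz hS hlaw hind k).trans (ENNReal.ofReal_le_ofReal ?_)) _
    -- The weights use half of the Lyapunov rate: `1 - γ a / 4 ≤ (1 - γ a / 8)²`.
    have h3 : (1 - γ * a / 4) ^ k ≤ (ρ ^ 2) ^ k := by
      refine pow_le_pow_left₀ (by linarith) ?_ k
      rw [hρdef]
      nlinarith
    have := mul_le_mul_of_nonneg_right h3
      (by positivity : 0 ≤ (1 + B) * ‖z0 - zstar‖ ^ 2)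
    linarith
  refine (Finset.sum_le_sum fun k _ => h2 k).trans ?_
  rw [← ENNReal.ofReal_sum_of_nonneg fun k _ =>
    mul_nonneg (normWeight_nonneg hρ K k) (by positivity)]
  refine ENNReal.ofReal_le_ofReal ?_
  simp only [mul_add, Finset.sum_add_distrib, ← Finset.sum_mul, sum_normWeight hρ, one_mul]
  simp only [← mul_assoc, ← Finset.sum_mul]
  rw [sum_normWeight_mul_pow hρ]
  have h4 : 0 ≤ ρ ^ K * ‖z0 - zstar‖ ^ 2 := by positivity
  nlinarith

end InnerSolver

/-! ### The implicit step size: existence, measurable choice, size of `a`. -/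

section StepSize

open Filter Topology

/-- The number `a` in the scaled step size, as a function of the step size. -/
noncomputable def stepsizeA (p β μ r0sq s0sq γ : ℝ) : ℝ :=
  r0sq / 2 + 2 * β ^ 2 / μ * (64 * (1 - p) * (2 + p) * (8 + p) / (12 * p ^ 3)) * γ ^ 3 * s0sq

/-- The argument of the logarithm in the scaled step size. -/
noncomputable def stepsizeArg (n : ℕ) (p β μ σ r0sq s0sq : ℝ) (K : ℕ) (γ : ℝ) : ℝ :=
  max 2 (min (stepsizeA p β μ r0sq s0sq γ * μ ^ 2 * K ^ 2 / (σ ^ 2 / (2 * n)))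
    (stepsizeA p β μ r0sq s0sq γ * μ ^ 3 * K ^ 3 / (8 * β ^ 2 * σ ^ 2 / (p * μ))))

/-- The map whose fixed points are the scaled step sizes. -/
noncomputable def stepsizeMap (n : ℕ) (p β μ σ r0sq s0sq : ℝ) (K : ℕ) (γ : ℝ) : ℝ :=
  if σ = 0 then p * μ / (80 * β ^ 2) else
    min (p * μ / (80 * β ^ 2))
      (Real.log (stepsizeArg n p β μ σ r0sq s0sq K γ) / (1 / 8 * μ * K))

variable {n K : ℕ} {p β μ σ r0sq s0sq γ : ℝ}

lemma isScaledStepsize_iff : IsScaledStepsize n p β μ σ r0sq s0sq K γ ↔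
    γ = stepsizeMap n p β μ σ r0sq s0sq K γ := Iff.rfl

lemma stepsizeMap_le : stepsizeMap n p β μ σ r0sq s0sq K γ ≤ p * μ / (80 * β ^ 2) := by
  unfold stepsizeMap
  split_ifs
  · exact le_rfl
  · exact min_le_left _ _

lemma log_stepsizeArg_pos : 1 / 2 ≤ Real.log (stepsizeArg n p β μ σ r0sq s0sq K γ) := by
  have h1 : (1 : ℝ) / 2 ≤ Real.log 2 := by linarith [Real.log_two_gt_d9]
  exact h1.trans (Real.log_le_log (by norm_num) (le_max_left _ _))

lemma stepsizeMap_pos (hp : 0 < p) (hμ : 0 < μ) (hβ : 0 < β) (hK : 1 ≤ K) :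
    0 < stepsizeMap n p β μ σ r0sq s0sq K γ := by
  have hK' : (0 : ℝ) < K := by exact_mod_cast hK
  have h1 : 0 < p * μ / (80 * β ^ 2) := by positivity
  unfold stepsizeMap
  split_ifs
  · exact h1
  · refine lt_min h1 (div_pos ?_ (by positivity))
    linarith [log_stepsizeArg_pos (n := n) (p := p) (β := β) (μ := μ) (σ := σ) (r0sq := r0sq)
      (s0sq := s0sq) (K := K) (γ := γ)]

lemma stepsizeMap_mono (hp : 0 < p) (hp1 : p ≤ 1) (hμ : 0 < μ) (hs0 : 0 ≤ s0sq) {γ' : ℝ}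
    (hγ : 0 ≤ γ) (h : γ ≤ γ') :
    stepsizeMap n p β μ σ r0sq s0sq K γ ≤ stepsizeMap n p β μ σ r0sq s0sq K γ' := by
  have hA : stepsizeA p β μ r0sq s0sq γ ≤ stepsizeA p β μ r0sq s0sq γ' := by
    have : 0 ≤ 1 - p := by linarith
    unfold stepsizeA
    gcongr
  have hL : stepsizeArg n p β μ σ r0sq s0sq K γ ≤ stepsizeArg n p β μ σ r0sq s0sq K γ' := by
    unfold stepsizeArg
    gcongr
  have h2 : 0 < stepsizeArg n p β μ σ r0sq s0sq K γ :=
    lt_of_lt_of_le two_pos (le_max_left _ _)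
  unfold stepsizeMap
  split_ifs
  · exact le_rfl
  · gcongr

lemma continuous_stepsizeMap : Continuous (stepsizeMap n p β μ σ r0sq s0sq K) := by
  have hA : Continuous (stepsizeA p β μ r0sq s0sq) := by unfold stepsizeA; fun_prop
  have hL : Continuous (stepsizeArg n p β μ σ r0sq s0sq K) := by
    unfold stepsizeArg
    fun_prop
  unfold stepsizeMap
  split_ifs
  · exact continuous_const
  · refine continuous_const.min (Continuous.div_const (hL.log fun γ => ?_) _)
    exact (lt_of_lt_of_le two_pos (le_max_left _ _)).ne'

/-- Fixed point iteration for the step size. -/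
noncomputable def stepsizeIter (n : ℕ) (p β μ σ r0sq s0sq : ℝ) (K : ℕ) : ℕ → ℝ
  | 0 => p * μ / (80 * β ^ 2)
  | j + 1 => stepsizeMap n p β μ σ r0sq s0sq K (stepsizeIter n p β μ σ r0sq s0sq K j)

/-- The map is monotone and bounded by `γ_max`, so iteration from `γ_max` decreases; by continuity
the limit is a fixed point. As a limit of explicit iterates it depends measurably on the data. -/
lemma tendsto_stepsizeIter (hp : 0 < p) (hp1 : p ≤ 1) (hμ : 0 < μ) (hβ : 0 < β) (hs0 : 0 ≤ s0sq)
    (hK : 1 ≤ K) : ∃ γ, Tendsto (stepsizeIter n p β μ σ r0sq s0sq K) atTop (𝓝 γ) ∧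
      IsScaledStepsize n p β μ σ r0sq s0sq K γ := by
  have h0 : ∀ j, 0 ≤ stepsizeIter n p β μ σ r0sq s0sq K j := by
    intro j
    cases j with
    | zero => exact (by positivity : 0 ≤ p * μ / (80 * β ^ 2))
    | succ j => exact (stepsizeMap_pos hp hμ hβ hK).le
  have hanti : Antitone (stepsizeIter n p β μ σ r0sq s0sq K) := by
    refine antitone_nat_of_succ_le fun j => ?_
    induction j with
    | zero => exact stepsizeMap_le
    | succ j ih => exact stepsizeMap_mono hp hp1 hμ hs0 (h0 _) ih
  have hlim := tendsto_atTop_ciInf hanti ⟨0, by rintro _ ⟨j, rfl⟩; exact h0 j⟩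
  refine ⟨_, hlim, ?_⟩
  rw [isScaledStepsize_iff]
  have h1 := ((continuous_stepsizeMap (n := n) (p := p) (β := β) (μ := μ) (σ := σ)
    (r0sq := r0sq) (s0sq := s0sq) (K := K)).tendsto _).comp hlim
  exact tendsto_nhds_unique ((tendsto_add_atTop_iff_nat 1).2 hlim) h1

/-- A measurable family of scaled step sizes. -/
lemma exists_measurable_stepsize {X : Type*} [MeasurableSpace X] {r s : X → ℝ} {K : X → ℕ}
    (hp : 0 < p) (hp1 : p ≤ 1) (hμ : 0 < μ) (hβ : 0 < β) (hr : Measurable r) (hs : Measurable s)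
    (hs0 : ∀ x, 0 ≤ s x) (hKm : Measurable K) (hK : ∀ x, 1 ≤ K x) :
    ∃ γ : X → ℝ, Measurable γ ∧ ∀ x, IsScaledStepsize n p β μ σ (r x) (s x) (K x) (γ x) := by
  choose γ h1 h2 using fun x => tendsto_stepsizeIter (n := n) (σ := σ) (r0sq := r x) hp hp1 hμ hβ
    (hs0 x) (hK x)
  refine ⟨γ, ?_, h2⟩
  have hKr : Measurable fun x => (K x : ℝ) := measurable_from_nat.comp hKm
  have hm : ∀ j, Measurable fun x => stepsizeIter n p β μ σ (r x) (s x) (K x) j := by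
    intro j
    induction j with
    | zero => exact measurable_const
    | succ j ih =>
      simp only [stepsizeIter]
      set g := fun x => stepsizeIter n p β μ σ (r x) (s x) (K x) j
      have hA : Measurable fun x => stepsizeA p β μ (r x) (s x) (g x) := by
        unfold stepsizeA
        fun_prop
      have hL : Measurable fun x => stepsizeArg n p β μ σ (r x) (s x) (K x) (g x) := by
        unfold stepsizeArg
        fun_prop
      unfold stepsizeMap
      split_ifs
      · exact measurable_const
      · exact measurable_const.min ((Real.measurable_log.comp hL).div (by fun_prop))
  exact measurable_of_tendsto_metrizable hm (tendsto_pi_nhds.2 h1)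

/-- The factor `1 / p³` in `H` is cancelled by `γ³ ≤ γ_max³`, and smoothness bounds `s0sq` by `4 β²
r0sq`. The implicit part of `a` is then at most `1152 / 512000` of `r0sq`, so `a` is comparable to
the squared initial distance for every solution `γ`. -/
lemma stepsizeA_mem (hp : 0 < p) (hp1 : p ≤ 1) (hμ : 0 < μ) (hμβ : μ ≤ β) (hs0 : 0 ≤ s0sq)
    (hsr : s0sq ≤ 4 * β ^ 2 * r0sq) (hγ : 0 ≤ γ) (hγm : γ ≤ p * μ / (80 * β ^ 2)) :
    r0sq / 2 ≤ stepsizeA p β μ r0sq s0sq γ ∧ stepsizeA p β μ r0sq s0sq γ ≤ r0sq := by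
  have hβ : 0 < β := hμ.trans_le hμβ
  have hr : 0 ≤ r0sq := by
    by_contra h
    push Not at h
    have : 4 * β ^ 2 * r0sq < 0 := mul_neg_of_pos_of_neg (by positivity) h
    linarith
  have h1p : 0 ≤ 1 - p := by linarith
  have hH : 64 * (1 - p) * (2 + p) * (8 + p) / (12 * p ^ 3) ≤ 144 / p ^ 3 := by
    rw [div_le_div_iff₀ (by positivity) (by positivity)]
    have h1 : (1 - p) * (2 + p) * (8 + p) ≤ 27 := by nlinarith [pow_pos hp 2, pow_pos hp 3]
    nlinarith [pow_pos hp 3]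
  set H := 64 * (1 - p) * (2 + p) * (8 + p) / (12 * p ^ 3)
  have hH0 : 0 ≤ H := by positivity
  unfold stepsizeA
  constructor
  · have : 0 ≤ 2 * β ^ 2 / μ * H * γ ^ 3 * s0sq := by positivity
    linarith
  · have h2 : 2 * β ^ 2 / μ * H * γ ^ 3 * s0sq
        ≤ 2 * β ^ 2 / μ * (144 / p ^ 3) * (p * μ / (80 * β ^ 2)) ^ 3 * (4 * β ^ 2 * r0sq) := by
      gcongr
    have h3 : 2 * β ^ 2 / μ * (144 / p ^ 3) * (p * μ / (80 * β ^ 2)) ^ 3 * (4 * β ^ 2 * r0sq)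
        = 1152 / 512000 * (μ ^ 2 / β ^ 2) * r0sq := by
      field_simp
      ring
    have h4 : μ ^ 2 / β ^ 2 ≤ 1 := by
      rw [div_le_one (by positivity)]
      exact pow_le_pow_left₀ hμ.le hμβ 2
    have h5 := mul_le_mul_of_nonneg_right h4 hr
    change r0sq / 2 + 2 * β ^ 2 / μ * H * γ ^ 3 * s0sq ≤ r0sq
    linarith

end StepSize

/-! ### The number of inner iterations. -/

section IterationCount

/-- The factor `M` in the number of inner iterations; `s` is `σ / (μ √ε)`. -/
noncomputable def countFactor (n : ℕ) (p s : ℝ) : ℝ :=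
  6000 * (1 / p + s ^ 2 / n + s / Real.sqrt p)

/-- The number of inner iterations as a function of `R = β² ‖w - P w‖² / (μ² ε)`. -/
noncomputable def iterCount (M R : ℝ) : ℕ :=
  ⌈2 * M * (Real.log (2 + R) + 2 + 3 * Real.log (6 * M))⌉₊

variable {n K : ℕ} {p s M R : ℝ}

lemma le_countFactor (hp : 0 < p) (hp1 : p ≤ 1) (hs : 0 ≤ s) :
    6000 ≤ countFactor n p s := by
  have h1 : 1 ≤ 1 / p := by rw [le_div_iff₀ hp]; linarith
  have h2 : 0 ≤ s ^ 2 / n := by positivity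
  have h3 : 0 ≤ s / Real.sqrt p := by positivity
  unfold countFactor
  linarith

lemma one_le_iterCount (hM : 1 ≤ M) (hR : 0 ≤ R) : 1 ≤ iterCount M R := by
  rw [iterCount, Nat.one_le_ceil_iff]
  have h1 : 0 ≤ Real.log (2 + R) := Real.log_nonneg (by linarith)
  have h2 : 0 ≤ Real.log (6 * M) := Real.log_nonneg (by linarith)
  positivity

/-- The requirement has `log K` on its left. From `log K ≤ K / (6 M) + log (6 M)`, the term `3 M log
K` costs at most `K / 2` plus a constant; the factor 2 in `iterCount` pays for that half. -/
lemma le_iterCount (hM : 1 ≤ M) (hR : 0 ≤ R) :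
    M * (Real.log (2 + R * (iterCount M R : ℝ) ^ 3) + 2) ≤ iterCount M R := by
  have hK1 := one_le_iterCount hM hR
  set K := iterCount M R with hK
  have hK1' : (1 : ℝ) ≤ K := by exact_mod_cast hK1
  have hK0 : (0 : ℝ) < K := by linarith
  have hM0 : 0 < M := by linarith
  have h1 : 2 * M * (Real.log (2 + R) + 2 + 3 * Real.log (6 * M)) ≤ K := Nat.le_ceil _
  have h2 : Real.log (2 + R * (K : ℝ) ^ 3) ≤ Real.log (2 + R) + 3 * Real.log K := by
    have h3 : Real.log (2 + R) + 3 * Real.log K = Real.log ((2 + R) * (K : ℝ) ^ 3) := by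
      rw [Real.log_mul (by positivity) (by positivity), Real.log_pow]
      norm_num
    rw [h3]
    refine Real.log_le_log (by positivity) ?_
    have : (1 : ℝ) ≤ (K : ℝ) ^ 3 := one_le_pow₀ hK1'
    nlinarith
  have h4 : Real.log K ≤ K / (6 * M) + Real.log (6 * M) := by
    have h5 : Real.log (K / (6 * M)) ≤ K / (6 * M) - 1 :=
      Real.log_le_sub_one_of_pos (by positivity)
    rw [Real.log_div hK0.ne' (by positivity)] at h5
    linarith
  have h6 : M * (3 * (K / (6 * M))) = K / 2 := by field_simp; norm_num
  have h7 : M * Real.log (2 + R * (K : ℝ) ^ 3)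
      ≤ M * (Real.log (2 + R) + 3 * (K / (6 * M) + Real.log (6 * M))) :=
    mul_le_mul_of_nonneg_left (by linarith) hM0.le
  linarith

lemma iterCount_le (hM : 1 ≤ M) (hR : 0 ≤ R) :
    (iterCount M R : ℝ) ≤ 1 + 2 * M * (Real.log (2 + R) + 2 + 3 * Real.log (6 * M)) := by
  have h1 : 0 ≤ Real.log (2 + R) := Real.log_nonneg (by linarith)
  have h2 : 0 ≤ Real.log (6 * M) := Real.log_nonneg (by linarith)
  have := Nat.ceil_lt_add_one (a := 2 * M * (Real.log (2 + R) + 2 + 3 * Real.log (6 * M)))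
    (by positivity)
  unfold iterCount
  linarith

end IterationCount

/-! ### The scaled step size reaches the inner accuracy. -/

section Accuracy

variable {n K : ℕ} {p β μ σ r0sq s0sq γ δ : ℝ}

/-- The exponential term is small after sufficiently many iterations. -/
lemma exp_term_le {k : ℝ} {R l : ℝ} (hp : 0 < p) (hk1 : 1 ≤ k) (hR : 0 ≤ R)
    (hl : l = Real.log (2 + R * k ^ 3)) (hK : 6000 / p * (l + 2) ≤ k) :
    24 * R * Real.exp (-(p * k / 2560)) ≤ 1 := by
  have h0 : 0 < 2 + R * k ^ 3 := by positivity
  have hl0 : 0 ≤ l := by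
    rw [hl]
    refine Real.log_nonneg ?_
    have : 0 ≤ R * k ^ 3 := by positivity
    linarith
  have h1 : 2 * (l + 2) ≤ p * k / 2560 := by
    rw [div_mul_eq_mul_div, div_le_iff₀ hp] at hK
    linarith
  have h2 : Real.exp (2 * (l + 2)) = Real.exp l ^ 2 * Real.exp 4 := by
    rw [← Real.exp_nat_mul, ← Real.exp_add]; congr 1; push_cast; ring
  rw [hl, Real.exp_log h0, ← hl] at h2
  have h3 : (5 : ℝ) ≤ Real.exp 4 := by
    have := Real.add_one_le_exp (4 : ℝ); linarith
  have h4 : 2 + R ≤ 2 + R * k ^ 3 := by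
    have : (1 : ℝ) ≤ k ^ 3 := one_le_pow₀ hk1
    nlinarith
  have h5 : 24 * R ≤ Real.exp (p * k / 2560) := by
    refine le_trans ?_ (Real.exp_le_exp.2 h1)
    rw [h2]
    have h6 : (2 + R) ^ 2 ≤ (2 + R * k ^ 3) ^ 2 := pow_le_pow_left₀ (by positivity) h4 2
    have h7 : (2 + R) ^ 2 * 5 ≤ (2 + R * k ^ 3) ^ 2 * Real.exp 4 := by gcongr
    nlinarith [sq_nonneg (R - 2 / 5)]
  rw [Real.exp_neg, ← div_eq_mul_inv, div_le_one (Real.exp_pos _)]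
  exact h5

/-- A condition number of at most 2 makes `γ_max` comparable to `p / μ`, so the decay exponent at
`γ_max` is of order `p K`. -/
lemma max_stepsize_bounds (hp : 0 < p) (hp1 : p ≤ 1) (hμ : 0 < μ) (hμβ : μ ≤ β)
    (hβμ : β ≤ 2 * μ) :
    p / (320 * μ) ≤ p * μ / (80 * β ^ 2) ∧ p * μ / (80 * β ^ 2) * μ ≤ 1 := by
  have hβ : 0 < β := hμ.trans_le hμβ
  have h1 : β ^ 2 ≤ (2 * μ) ^ 2 := pow_le_pow_left₀ hβ.le hβμ 2
  have h2 : μ ^ 2 ≤ β ^ 2 := pow_le_pow_left₀ hμ.le hμβ 2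
  constructor
  · rw [div_le_div_iff₀ (by positivity) (by positivity)]
    linarith only [mul_le_mul_of_nonneg_left h1 hp.le]
  · rw [div_mul_eq_mul_div, div_le_one (by positivity)]
    have h3 := mul_le_mul_of_nonneg_right hp1 (sq_nonneg μ)
    linarith only [h2, h3, sq_nonneg μ]

lemma one_sub_pow_le_exp {x : ℝ} (hx : x ≤ 1) (K : ℕ) :
    (1 - x / 8) ^ K ≤ Real.exp (-(x * K / 8)) := by
  have h2 : 1 - x / 8 ≤ Real.exp (-(x / 8)) := by
    have := Real.add_one_le_exp (-(x / 8)); linarith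
  refine (pow_le_pow_left₀ (by linarith) h2 K).trans_eq ?_
  rw [← Real.exp_nat_mul]
  congr 1
  ring

/-- Error of the inner solver with a scaled step size, when the noise level is positive. -/
lemma scaled_error_le (hn : 0 < n) (hp : 0 < p) (hp1 : p ≤ 1) (hμ : 0 < μ) (hμβ : μ ≤ β)
    (hβμ : β ≤ 2 * μ) (hσ : 0 < σ) (hs0 : 0 ≤ s0sq) (hsr : s0sq ≤ 4 * β ^ 2 * r0sq) (hK : 1 ≤ K)
    (hγ : IsScaledStepsize n p β μ σ r0sq s0sq K γ) :
    ∃ l, 1 / 2 ≤ l ∧ Real.exp l ≤ 2 + r0sq * μ ^ 2 * K ^ 3 / σ ^ 2 ∧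
      2 * (1 - γ * μ / 8) ^ K * r0sq + (5 * γ * (4 * σ ^ 2) / (n * μ)
        + 12 * γ ^ 2 * (2 * β) ^ 2 * (4 * σ ^ 2) / (p * μ ^ 2))
      ≤ 2 * r0sq * Real.exp (-(p * K / 2560)) + 164 * (l * σ ^ 2 / (n * μ ^ 2 * K))
        + 49664 * (l ^ 2 * σ ^ 2 / (p * μ ^ 2 * K ^ 2)) := by
  have hβ : 0 < β := hμ.trans_le hμβ
  have hK1 : (1 : ℝ) ≤ K := by exact_mod_cast hK
  have hK0 : (0 : ℝ) < K := by linarith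
  have hn0 : (0 : ℝ) < n := by exact_mod_cast hn
  have hr : 0 ≤ r0sq := by
    by_contra h
    push Not at h
    have : 4 * β ^ 2 * r0sq < 0 := mul_neg_of_pos_of_neg (by positivity) h
    linarith
  rw [isScaledStepsize_iff] at hγ
  have hγpos : 0 < γ := by rw [hγ]; exact stepsizeMap_pos hp hμ hβ hK
  have hγm : γ ≤ p * μ / (80 * β ^ 2) := by
    have := stepsizeMap_le (n := n) (p := p) (β := β) (μ := μ) (σ := σ) (r0sq := r0sq)
      (s0sq := s0sq) (K := K) (γ := γ)
    rwa [← hγ] at this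
  obtain ⟨ha1, ha2⟩ := stepsizeA_mem hp hp1 hμ hμβ hs0 hsr hγpos.le hγm
  set A := stepsizeA p β μ r0sq s0sq γ with hA
  have hA0 : 0 ≤ A := by linarith
  set m := stepsizeArg n p β μ σ r0sq s0sq K γ with hm
  set l := Real.log m with hl
  have hl2 : 1 / 2 ≤ l := log_stepsizeArg_pos
  have hm2 : 2 ≤ m := le_max_left _ _
  have hm0 : 0 < m := by linarith
  set Q1 := A * μ ^ 2 * K ^ 2 / (σ ^ 2 / (2 * n)) with hQ1
  set Q2 := A * μ ^ 3 * K ^ 3 / (8 * β ^ 2 * σ ^ 2 / (p * μ)) with hQ2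
  have hmQ : m = max 2 (min Q1 Q2) := rfl
  have hγX : γ = min (p * μ / (80 * β ^ 2)) (l / (1 / 8 * μ * K)) := by
    rw [stepsizeMap, if_neg hσ.ne'] at hγ
    exact hγ
  refine ⟨l, hl2, ?_, ?_⟩
  · rw [hl, Real.exp_log hm0, hmQ]
    -- Only the second quotient is needed to bound the logarithm, so `n` does not enter it.
    have h1 : Q2 ≤ r0sq * μ ^ 2 * K ^ 3 / σ ^ 2 := by
      have e : Q2 = A * μ ^ 2 * K ^ 3 / σ ^ 2 * (p * μ ^ 2 / (8 * β ^ 2)) := by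
        rw [hQ2]; field_simp
      rw [e]
      have h2 : p * μ ^ 2 / (8 * β ^ 2) ≤ 1 := by
        rw [div_le_one (by positivity)]
        have h3 : μ ^ 2 ≤ β ^ 2 := pow_le_pow_left₀ hμ.le hμβ 2
        have h4 := mul_le_mul_of_nonneg_right hp1 (sq_nonneg μ)
        linarith only [h3, h4, sq_nonneg μ]
      calc _ ≤ A * μ ^ 2 * K ^ 3 / σ ^ 2 * 1 := by gcongr
        _ ≤ r0sq * μ ^ 2 * K ^ 3 / σ ^ 2 := by rw [mul_one]; gcongr
    have h3 : 0 ≤ r0sq * μ ^ 2 * K ^ 3 / σ ^ 2 := by positivity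
    refine max_le (by linarith) ((min_le_right _ _).trans (by linarith))
  · set U := l * σ ^ 2 / (n * μ ^ 2 * K) with hU
    set W := l ^ 2 * σ ^ 2 / (p * μ ^ 2 * K ^ 2) with hW
    have hl0 : 0 < l := by linarith
    have hXl : γ ≤ l / (1 / 8 * μ * K) := by rw [hγX]; exact min_le_right _ _
    have hX : γ ≤ 8 * l / (μ * K) := by
      refine hXl.trans_eq ?_
      field_simp
    have n1 : 5 * γ * (4 * σ ^ 2) / (n * μ) ≤ 160 * U := by
      calc 5 * γ * (4 * σ ^ 2) / (n * μ) ≤ 5 * (8 * l / (μ * K)) * (4 * σ ^ 2) / (n * μ) := by gcongr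
        _ = 160 * U := by rw [hU]; field_simp; norm_num
    have n2 : 12 * γ ^ 2 * (2 * β) ^ 2 * (4 * σ ^ 2) / (p * μ ^ 2) ≤ 49152 * W := by
      calc 12 * γ ^ 2 * (2 * β) ^ 2 * (4 * σ ^ 2) / (p * μ ^ 2)
          ≤ 12 * (8 * l / (μ * K)) ^ 2 * (2 * (2 * μ)) ^ 2 * (4 * σ ^ 2) / (p * μ ^ 2) := by gcongr
        _ = 49152 * W := by rw [hW]; field_simp; norm_num
    -- One term for each branch of the minimum: at `γ_max` the decay is exponential in `p K`;
    -- otherwise `γ μ K / 8` equals `log m` and the decay is `1 / m`.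
    have hpow : (1 - γ * μ / 8) ^ K ≤ Real.exp (-(p * K / 2560)) + 1 / m := by
      obtain ⟨hmax1, hmax2⟩ := max_stepsize_bounds hp hp1 hμ hμβ hβμ
      have h1 := one_sub_pow_le_exp ((mul_le_mul_of_nonneg_right hγm hμ.le).trans hmax2) K
      refine h1.trans ?_
      rcases min_choice (p * μ / (80 * β ^ 2)) (l / (1 / 8 * μ * K)) with h | h
      · have h2 : Real.exp (-(γ * μ * K / 8)) ≤ Real.exp (-(p * K / 2560)) := by
          refine Real.exp_le_exp.2 (neg_le_neg ?_)
          rw [hγX, h]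
          calc p * K / 2560 = p / (320 * μ) * μ * K / 8 := by field_simp; norm_num
            _ ≤ _ := by gcongr
        have : 0 ≤ 1 / m := by positivity
        linarith
      · have h2 : γ * μ * K / 8 = l := by
          rw [hγX, h]
          field_simp
        rw [h2, Real.exp_neg, hl, Real.exp_log hm0, one_div]
        have := Real.exp_pos (-(p * K / 2560))
        linarith
    -- The logarithm's argument is tuned so that this residue is no larger than the noise: `m`
    -- dominates one of the two quotients, and `A ≥ r0sq / 2`.
    have hrm : r0sq * (1 / m) ≤ σ ^ 2 / (n * μ ^ 2 * K ^ 2) + 64 * (σ ^ 2 / (p * μ ^ 2 * K ^ 3)) := by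
      rw [mul_one_div, div_le_iff₀ hm0]
      have hmin : min Q1 Q2 ≤ m := le_max_right _ _
      have p1 : 0 ≤ σ ^ 2 / (n * μ ^ 2 * K ^ 2) := by positivity
      have p2 : 0 ≤ 64 * (σ ^ 2 / (p * μ ^ 2 * K ^ 3)) := by positivity
      rcases min_choice Q1 Q2 with h | h
      · rw [h] at hmin
        have e : σ ^ 2 / (n * μ ^ 2 * K ^ 2) * Q1 = 2 * A := by rw [hQ1]; field_simp
        have := mul_le_mul_of_nonneg_left hmin p1
        have := mul_nonneg p2 hm0.le
        linarith
      · rw [h] at hmin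
        have e : 64 * (σ ^ 2 / (p * μ ^ 2 * K ^ 3)) * Q2 = 8 * A * (μ ^ 2 / β ^ 2) := by
          rw [hQ2]; field_simp; ring
        have e2 : 1 / 4 ≤ μ ^ 2 / β ^ 2 := by
          rw [div_le_div_iff₀ (by norm_num) (by positivity)]
          have : β ^ 2 ≤ (2 * μ) ^ 2 := pow_le_pow_left₀ hβ.le hβμ 2
          linarith only [this]
        have e3 := mul_le_mul_of_nonneg_left e2 (by positivity : 0 ≤ 8 * A)
        have := mul_le_mul_of_nonneg_left hmin p2
        have := mul_nonneg p1 hm0.le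
        linarith
    have u1 : σ ^ 2 / (n * μ ^ 2 * K ^ 2) ≤ 2 * U := by
      have e : σ ^ 2 / (n * μ ^ 2 * K ^ 2) = σ ^ 2 / (n * μ ^ 2 * K) * (1 / K) := by field_simp
      have e2 : U = σ ^ 2 / (n * μ ^ 2 * K) * l := by rw [hU]; ring
      rw [e, e2]
      have h1 : (1 : ℝ) / K ≤ 1 := by rw [div_le_one hK0]; exact hK1
      have h2 : 0 ≤ σ ^ 2 / (n * μ ^ 2 * K) := by positivity
      have h3 := mul_le_mul_of_nonneg_left h1 h2
      have h4 := mul_le_mul_of_nonneg_left hl2 h2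
      linarith only [h3, h4]
    have u2 : σ ^ 2 / (p * μ ^ 2 * K ^ 3) ≤ 4 * W := by
      have e : σ ^ 2 / (p * μ ^ 2 * K ^ 3) = σ ^ 2 / (p * μ ^ 2 * K ^ 2) * (1 / K) := by field_simp
      have e2 : W = σ ^ 2 / (p * μ ^ 2 * K ^ 2) * l ^ 2 := by rw [hW]; ring
      rw [e, e2]
      have h1 : (1 : ℝ) / K ≤ 1 := by rw [div_le_one hK0]; exact hK1
      have h2 : 0 ≤ σ ^ 2 / (p * μ ^ 2 * K ^ 2) := by positivity
      have h3 : (1 / 2 : ℝ) ^ 2 ≤ l ^ 2 := pow_le_pow_left₀ (by norm_num) hl2 2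
      have h4 := mul_le_mul_of_nonneg_left h1 h2
      have h5 := mul_le_mul_of_nonneg_left h3 h2
      linarith only [h4, h5]
    have hfin := mul_le_mul_of_nonneg_left hpow hr
    linarith only [hfin, hrm, u1, u2, n1, n2]

/-- The number of iterations suffices for the accuracy `δ = (μ / (2 b))² ε`, where `b` is the
strong monotonicity constant of the subproblem. -/
lemma scaled_error_le_accuracy {b ε : ℝ} (hn : 0 < n) (hp : 0 < p) (hp1 : p ≤ 1) (hb : 0 < b)
    (hbβ : b ≤ β) (hβb : β ≤ 2 * b) (hμ : 0 < μ) (hε : 0 < ε) (hσ : 0 ≤ σ) (hs0 : 0 ≤ s0sq)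
    (hsr : s0sq ≤ 4 * β ^ 2 * r0sq) (hK : 1 ≤ K)
    (hγ : IsScaledStepsize n p β b σ r0sq s0sq K γ)
    (hKM : countFactor n p (σ / (μ * Real.sqrt ε)) *
      (Real.log (2 + b ^ 2 * r0sq / (μ ^ 2 * ε) * (K : ℝ) ^ 3) + 2) ≤ K) :
    2 * (1 - γ * b / 8) ^ K * r0sq + (5 * γ * (4 * σ ^ 2) / (n * b)
        + 12 * γ ^ 2 * (2 * β) ^ 2 * (4 * σ ^ 2) / (p * b ^ 2)) ≤ (μ / (2 * b)) ^ 2 * ε := by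
  have hβ : 0 < β := hb.trans_le hbβ
  have hK1 : (1 : ℝ) ≤ K := by exact_mod_cast hK
  have hK0 : (0 : ℝ) < K := by linarith
  have hn0 : (0 : ℝ) < n := by exact_mod_cast hn
  have hr : 0 ≤ r0sq := by
    by_contra h
    push Not at h
    have : 4 * β ^ 2 * r0sq < 0 := mul_neg_of_pos_of_neg (by positivity) h
    linarith
  set s := σ / (μ * Real.sqrt ε) with hs
  set R := b ^ 2 * r0sq / (μ ^ 2 * ε) with hR
  set Λ := Real.log (2 + R * (K : ℝ) ^ 3) with hΛ
  set δ := (μ / (2 * b)) ^ 2 * ε with hδ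
  have hδ0 : 0 < δ := by positivity
  have hs' : 0 ≤ s := by positivity
  have hR0 : 0 ≤ R := by positivity
  have hΛ0 : 0 ≤ Λ := by
    refine Real.log_nonneg ?_
    have : 0 ≤ R * (K : ℝ) ^ 3 := by positivity
    linarith
  have hrR : r0sq = 4 * R * δ := by rw [hR, hδ]; field_simp; norm_num
  have hsq : 0 < Real.sqrt p := Real.sqrt_pos.2 hp
  -- Three budgets inside `K`: `1 / p` for the exponential term, `s² / n` for the averaged noise, `s
  -- / √p` for the drift noise.
  have hsplit : 6000 / p * (Λ + 2) + 6000 * (s ^ 2 / n * (Λ + 2))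
      + 6000 * (s / Real.sqrt p * (Λ + 2)) ≤ K := by
    rw [countFactor] at hKM
    refine le_trans (le_of_eq ?_) hKM
    ring
  have t1 : 0 ≤ s ^ 2 / n * (Λ + 2) := by positivity
  have t2 : 0 ≤ s / Real.sqrt p * (Λ + 2) := by positivity
  have t3 : 0 ≤ 1 / p * (Λ + 2) := by positivity
  have t3' : 6000 / p * (Λ + 2) = 6000 * (1 / p * (Λ + 2)) := by ring
  have hexp : 2 * r0sq * Real.exp (-(p * K / 2560)) ≤ δ / 3 := by
    have h1 := exp_term_le hp hK1 hR0 hΛ (by linarith)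
    rw [hrR]
    linarith only [mul_le_mul_of_nonneg_left h1 hδ0.le]
  rcases hσ.eq_or_lt with h0 | h0
  · rw [isScaledStepsize_iff, stepsizeMap, if_pos h0.symm] at hγ
    rw [← h0]
    obtain ⟨hmax1, hmax2⟩ := max_stepsize_bounds hp hp1 hb hbβ hβb
    have h1 := one_sub_pow_le_exp ((mul_le_mul_of_nonneg_right hγ.le hb.le).trans hmax2) K
    have h2 : Real.exp (-(γ * b * K / 8)) ≤ Real.exp (-(p * K / 2560)) := by
      refine Real.exp_le_exp.2 (neg_le_neg ?_)
      rw [hγ]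
      calc p * K / 2560 = p / (320 * b) * b * K / 8 := by field_simp; norm_num
        _ ≤ _ := by gcongr
    have h3 := mul_le_mul_of_nonneg_left (h1.trans h2) hr
    norm_num
    linarith
  · obtain ⟨l, hl, hlexp, hle⟩ := scaled_error_le hn hp hp1 hb hbβ hβb h0 hs0 hsr hK hγ
    refine hle.trans ?_
    have hs0' : 0 < s := by positivity
    -- In units of `δ` the noise is `s²`: the strong monotonicity constant `b` of the subproblem
    -- cancels.
    have hσs : σ ^ 2 = 4 * s ^ 2 * b ^ 2 * δ := by
      rw [hs, hδ, div_pow, mul_pow, Real.sq_sqrt hε.le]; field_simp; norm_num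
    -- For small noise the step-size logarithm contains `log (1 / s)`, which the final bound cannot
    -- afford. It is bounded by `2 / s`, which is harmless because `l` occurs below only in the
    -- product `l s`.
    have hls : l ≤ Λ + 2 / s := by
      have e : r0sq * b ^ 2 * (K : ℝ) ^ 3 / σ ^ 2 = R * (K : ℝ) ^ 3 / s ^ 2 := by
        rw [hσs, hrR]; field_simp
      rw [e] at hlexp
      have h1 : 2 + R * (K : ℝ) ^ 3 / s ^ 2 ≤ (2 + R * (K : ℝ) ^ 3) * (1 + 1 / s) ^ 2 := by
        have h2 : 0 ≤ R * (K : ℝ) ^ 3 := by positivity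
        have h3 : R * (K : ℝ) ^ 3 / s ^ 2 = R * (K : ℝ) ^ 3 * (1 / s) ^ 2 := by
          field_simp
        have h4 : 0 ≤ 1 / s := by positivity
        rw [h3]
        linarith only [mul_nonneg h2 h4, h2, h4, sq_nonneg (1 / s)]
      have h2 : (1 + 1 / s) ^ 2 ≤ Real.exp (2 / s) := by
        have h3 := Real.add_one_le_exp (1 / s)
        have h4 : Real.exp (2 / s) = Real.exp (1 / s) ^ 2 := by
          rw [← Real.exp_nat_mul]; congr 1; push_cast; ring
        rw [h4]
        exact pow_le_pow_left₀ (by positivity) (by linarith) 2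
      rw [← Real.exp_le_exp, Real.exp_add, hΛ, Real.exp_log (by positivity)]
      exact hlexp.trans (h1.trans (mul_le_mul_of_nonneg_left h2 (by positivity)))
    have hls2 : l * s ≤ (s + 1) * (Λ + 2) := by
      have h1 := mul_le_mul_of_nonneg_right hls hs'
      have h2 : (Λ + 2 / s) * s = Λ * s + 2 := by field_simp
      linarith only [h1, h2, hΛ0, hs']
    have hl0 : 0 < l := by linarith
    have hsp : 1 / Real.sqrt p ≤ 1 / p := by
      refine one_div_le_one_div_of_le hp ?_
      exact Real.le_sqrt_of_sq_le (by nlinarith)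
    have q1 : l * σ ^ 2 / (n * b ^ 2 * K) ≤ δ / 600 := by
      have e : l * σ ^ 2 / (n * b ^ 2 * K) = 4 * δ * (l * s * s / n) / K := by
        rw [hσs]; field_simp
      rw [e, div_le_iff₀ hK0]
      have h1 : l * s * s / n ≤ 2 * (s ^ 2 / n * (Λ + 2)) + 1 / p * (Λ + 2) := by
        have h2 : l * s * s ≤ (2 * s ^ 2 + 1) * (Λ + 2) := by
          have h3 := mul_le_mul_of_nonneg_right hls2 hs'
          have h4 : (0 : ℝ) ≤ ((s - 1 / 2) ^ 2 + 3 / 4) * (Λ + 2) := by positivity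
          linarith only [h3, h4]
        have h3 : 1 / (n : ℝ) ≤ 1 / p := by
          refine one_div_le_one_div_of_le hp (hp1.trans ?_)
          exact_mod_cast hn
        calc l * s * s / n ≤ (2 * s ^ 2 + 1) * (Λ + 2) / n := by gcongr
          _ = 2 * (s ^ 2 / n * (Λ + 2)) + 1 / n * (Λ + 2) := by ring
          _ ≤ _ := by gcongr
      have h4 : l * s * s / n ≤ K / 2400 := by linarith only [h1, hsplit, t1, t2, t3, t3']
      linarith only [mul_le_mul_of_nonneg_left h4 hδ0.le]
    have q2 : l ^ 2 * σ ^ 2 / (p * b ^ 2 * K ^ 2) ≤ δ / 1000000 := by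
      have hsq2 : Real.sqrt p ^ 2 = p := Real.sq_sqrt hp.le
      have e : l ^ 2 * σ ^ 2 / (p * b ^ 2 * K ^ 2) = 4 * δ * (l * s / Real.sqrt p) ^ 2 / K ^ 2 := by
        have h1 : (l * s / Real.sqrt p) ^ 2 = (l * s) ^ 2 / p := by rw [div_pow, hsq2]
        rw [hσs, h1]; field_simp
      rw [e, div_le_iff₀ (by positivity)]
      have h1 : l * s / Real.sqrt p ≤ K / 6000 := by
        calc l * s / Real.sqrt p ≤ (s + 1) * (Λ + 2) / Real.sqrt p := by gcongr
          _ = s / Real.sqrt p * (Λ + 2) + 1 / Real.sqrt p * (Λ + 2) := by ring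
          _ ≤ s / Real.sqrt p * (Λ + 2) + 1 / p * (Λ + 2) := by gcongr
          _ ≤ K / 6000 := by linarith only [hsplit, t1, t2, t3, t3']
      have h2 : (l * s / Real.sqrt p) ^ 2 ≤ (K / 6000 : ℝ) ^ 2 :=
        pow_le_pow_left₀ (by positivity) h1 2
      have h3 := mul_le_mul_of_nonneg_left h2 hδ0.le
      linarith only [h3, mul_nonneg hδ0.le (sq_nonneg (K : ℝ))]
    -- The shares of `δ` are `1/3`, `164/600` and `49664/1000000`, with sum below 1.
    linarith only [hexp, q1, q2, hδ0]

end Accuracy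

/-! ### The inner solver on a subproblem of the outer method. -/

section Subproblem

variable {m d n : ℕ} {Ξ : Type*} [MeasurableSpace Ξ] {f : Fin n → Objective m d}
  {Ghat : Fin n → Pt m d → Ξ → Pt m d} {D : Fin n → Measure Ξ} [∀ i, IsProbabilityMeasure (D i)]
  {π : Fin n → Measure (Ξ × Ξ)} [∀ i, IsProbabilityMeasure (π i)] {β μ θ σ p ε : ℝ}

lemma subGrad_eq (hs : ∀ i, IsSmooth β (f i)) (θ : ℝ) (w : Pt m d) (i : Fin n) (z : Pt m d) :
    subGrad f θ w i z = gradMap (f i) z + θ • (z - w) :=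
  gradMap_regularized (hs i).isDifferentiable θ w z

/-- The regularization is deterministic and cancels. Under an arbitrary joint law only `‖u - v‖² ≤ 2
‖u‖² + 2 ‖v‖²` is available, whence `4 σ²`. -/
lemma isDifferenceOracle_subGradHat (hs : ∀ i, IsSmooth β (f i))
    (hest : ∀ i, IsUnbiasedEstimate (gradMap (f i)) (Ghat i) (D i) σ)
    (hπ : ∀ i, (π i).fst = D i ∧ (π i).snd = D i) (w : Pt m d) :
    IsDifferenceOracle (subGrad f θ w) (subGradHat Ghat θ w) π (4 * σ ^ 2) := by
  have e : ∀ i z z' (ξ : Ξ × Ξ), subGradHat Ghat θ w i z ξ.1 - subGradHat Ghat θ w i z' ξ.2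
      - (subGrad f θ w i z - subGrad f θ w i z')
      = (Ghat i z ξ.1 - gradMap (f i) z) - (Ghat i z' ξ.2 - gradMap (f i) z') := by
    intro i z z' ξ
    rw [subGrad_eq hs, subGrad_eq hs]
    unfold subGradHat
    abel
  have mp1 : ∀ i, MeasurePreserving Prod.fst (π i) (D i) := fun i => ⟨measurable_fst, (hπ i).1⟩
  have mp2 : ∀ i, MeasurePreserving Prod.snd (π i) (D i) := fun i => ⟨measurable_snd, (hπ i).2⟩
  have hL : ∀ i z, MemLp (fun ξ => Ghat i z ξ - gradMap (f i) z) 2 (D i) := fun i z =>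
    ((hest i).memLp z).sub (memLp_const _)
  have hI : ∀ i z, ∫ ξ, (Ghat i z ξ - gradMap (f i) z) ∂D i = 0 := fun i z => by
    rw [integral_sub (((hest i).memLp z).integrable (by norm_num)) (integrable_const _),
      (hest i).unbiased z]
    simp
  have hL1 : ∀ i z, MemLp (fun ξ : Ξ × Ξ => Ghat i z ξ.1 - gradMap (f i) z) 2 (π i) := fun i z =>
    (hL i z).comp_measurePreserving (mp1 i)
  have hL2 : ∀ i z, MemLp (fun ξ : Ξ × Ξ => Ghat i z ξ.2 - gradMap (f i) z) 2 (π i) := fun i z =>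
    (hL i z).comp_measurePreserving (mp2 i)
  have t1 : ∀ i {F : Type} [NormedAddCommGroup F] [NormedSpace ℝ F] (g : Ξ → F),
      AEStronglyMeasurable g (D i) → ∫ ξ, g ξ.1 ∂π i = ∫ ξ, g ξ ∂D i := by
    intro i F _ _ g hg
    rw [← (mp1 i).map_eq] at hg ⊢
    exact (integral_map (mp1 i).aemeasurable hg).symm
  have t2 : ∀ i {F : Type} [NormedAddCommGroup F] [NormedSpace ℝ F] (g : Ξ → F),
      AEStronglyMeasurable g (D i) → ∫ ξ, g ξ.2 ∂π i = ∫ ξ, g ξ ∂D i := by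
    intro i F _ _ g hg
    rw [← (mp2 i).map_eq] at hg ⊢
    exact (integral_map (mp2 i).aemeasurable hg).symm
  refine ⟨fun i z z' => ?_, fun i z z' => ?_, fun i z z' => ?_⟩
  · simp only [e]
    exact (hL1 i z).sub (hL2 i z')
  · simp only [e]
    rw [integral_sub ((hL1 i z).integrable (by norm_num)) ((hL2 i z').integrable (by norm_num)),
      t1 i _ (hL i z).1, t2 i _ (hL i z').1, hI, hI, sub_zero]
  · simp only [e]
    have i1 := (hL1 i z).integrable_norm_pow (p := 2) (by norm_num)
    have i2 := (hL2 i z').integrable_norm_pow (p := 2) (by norm_num)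
    have hle : ∫ ξ, ‖(Ghat i z ξ.1 - gradMap (f i) z) - (Ghat i z' ξ.2 - gradMap (f i) z')‖ ^ 2 ∂π i
        ≤ ∫ ξ, (2 * ‖Ghat i z ξ.1 - gradMap (f i) z‖ ^ 2
          + 2 * ‖Ghat i z' ξ.2 - gradMap (f i) z'‖ ^ 2) ∂π i := by
      refine integral_mono (((hL1 i z).sub (hL2 i z')).integrable_norm_pow (by norm_num))
        ((i1.const_mul 2).add (i2.const_mul 2)) fun ξ => ?_
      have := norm_sub_sq_le_young (Ghat i z ξ.1 - gradMap (f i) z)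
        (Ghat i z' ξ.2 - gradMap (f i) z') one_pos
      norm_num at this ⊢
      exact this
    refine hle.trans ?_
    rw [integral_add (i1.const_mul 2) (i2.const_mul 2), integral_const_mul, integral_const_mul,
      t1 i (fun ξ => ‖Ghat i z ξ - gradMap (f i) z‖ ^ 2) ((hL i z).1.norm.pow 2),
      t2 i (fun ξ => ‖Ghat i z' ξ - gradMap (f i) z'‖ ^ 2) ((hL i z').1.norm.pow 2)]
    linarith [(hest i).variance_le z, (hest i).variance_le z']

lemma average_subGrad (hn : 0 < n) (hs : ∀ i, IsSmooth β (f i)) (w z : Pt m d) :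
    average (fun i => subGrad f θ w i z) = meanMap f z + θ • (z - w) := by
  simp only [subGrad_eq hs]
  rw [average_add, average_const hn]
  rfl

lemma norm_subGrad_sub_le (hβ : 0 ≤ β) (hθ : 0 ≤ θ) (hs : ∀ i, IsSmooth β (f i)) (w : Pt m d)
    (i : Fin n) (z z' : Pt m d) :
    ‖subGrad f θ w i z - subGrad f θ w i z'‖ ≤ 2 * (β + θ) * ‖z - z'‖ := by
  have e : subGrad f θ w i z - subGrad f θ w i z'
      = (gradMap (f i) z - gradMap (f i) z') + θ • (z - z') := by
    rw [subGrad_eq hs, subGrad_eq hs]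
    simp only [smul_sub]
    abel
  rw [e]
  have h1 := norm_add_le (gradMap (f i) z - gradMap (f i) z') (θ • (z - z'))
  rw [norm_smul, Real.norm_of_nonneg hθ] at h1
  have h2 := (hs i).norm_gradMap_sub_le hβ z z'
  have h3 := mul_nonneg hθ (norm_nonneg (z - z'))
  linarith

variable {Ω : Type*} [MeasurableSpace Ω] {P : Measure Ω} [IsProbabilityMeasure P]

/-- Accuracy of the inner solver on the subproblem with centre `w`. -/
theorem lintegral_norm_subSolve_sub_sq_le (hn : 0 < n) (hμ : 0 < μ) (hμβ : μ ≤ β) (hσ : 0 ≤ σ)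
    (hp : 0 < p) (hp1 : p ≤ 1) (hε : 0 < ε) (hs : ∀ i, IsSmooth β (f i))
    (hc : ∀ i, IsStronglyConvexConcave μ (f i))
    (hest : ∀ i, IsUnbiasedEstimate (gradMap (f i)) (Ghat i) (D i) σ)
    (hπ : ∀ i, (π i).fst = D i ∧ (π i).snd = D i) {S : ℕ → Ω → StepSample n Ξ}
    (hS : ∀ k, Measurable (S k)) (hlaw : ∀ k, P.map (S k) = stepLaw p π) (hind : iIndepFun S P)
    {K : ℕ} {γ : ℝ} {w : Pt m d} (hK : 1 ≤ K) (hγ : IsSubStepsize f p β μ σ (β - μ) w K γ)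
    (hKM : countFactor n p (σ / (μ * Real.sqrt ε)) *
      (Real.log (2 + β ^ 2 * ‖w - prox (β - μ) (globalObjective f) w‖ ^ 2 / (μ ^ 2 * ε)
        * (K : ℝ) ^ 3) + 2) ≤ K) :
    ∫⁻ ω, ENNReal.ofReal (‖subSolve f Ghat μ (β - μ) γ K w (fun k => S k ω)
        - prox (β - μ) (globalObjective f) w‖ ^ 2) ∂P
      ≤ ENNReal.ofReal ((μ / (2 * β)) ^ 2 * ε) := by
  have hβ : 0 < β := hμ.trans_le hμβ
  have hθ : 0 ≤ β - μ := by linarith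
  unfold IsSubStepsize at hγ
  set u := prox (β - μ) (globalObjective f) w with hu
  have hμθ : μ + (β - μ) = β := by ring
  rw [hμθ] at hγ
  have hβ' : 0 < β + (β - μ) := by linarith
  have hs0 : 0 ≤ (1 / (n : ℝ)) *
      ∑ i, ‖subGrad f (β - μ) w i w - subGrad f (β - μ) w i u‖ ^ 2 :=
    mul_nonneg (by positivity) (Finset.sum_nonneg fun i _ => by positivity)
  have hsr : (1 / (n : ℝ)) * ∑ i, ‖subGrad f (β - μ) w i w - subGrad f (β - μ) w i u‖ ^ 2
      ≤ 4 * (β + (β - μ)) ^ 2 * ‖w - u‖ ^ 2 := by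
    change average (fun i => ‖subGrad f (β - μ) w i w - subGrad f (β - μ) w i u‖ ^ 2) ≤ _
    rw [← average_const hn (4 * (β + (β - μ)) ^ 2 * ‖w - u‖ ^ 2)]
    refine average_mono fun i => ?_
    have := pow_le_pow_left₀ (norm_nonneg _) (norm_subGrad_sub_le hβ.le hθ hs w i w u) 2
    refine this.trans_eq (by ring)
  have hγpos : 0 < γ := by
    rw [isScaledStepsize_iff] at hγ
    rw [hγ]
    exact stepsizeMap_pos hp hβ hβ' hK
  have hγm : γ ≤ p * β / (80 * (β + (β - μ)) ^ 2) := by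
    rw [isScaledStepsize_iff] at hγ
    rw [hγ]
    exact stepsizeMap_le
  have hz : average (fun i => subGrad f (β - μ) w i u) = 0 := by
    rw [average_subGrad hn hs]
    exact meanMap_prox hn hμ hμβ hθ hs hc w
  -- The regularization pays off here: the smoothness `2 β - μ` lies between the strong monotonicity
  -- constant `β` and `2 β`.
  have hacc := scaled_error_le_accuracy hn hp hp1 hβ (by linarith) (by linarith) hμ hε hσ hs0 hsr
    hK hγ hKM
  have hmain := lintegral_norm_scaffoldOutput_sub_sq_le (G := subGrad f (β - μ) w)
    (Ghat := subGradHat Ghat (β - μ) w) (π := π) (V := 4 * σ ^ 2) (p := p) (a := β)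
    (L := 2 * (β + (β - μ))) (γ := γ) (z0 := w) (zstar := u) hn (by positivity) hp hp1 hβ
    (by linarith) hγpos ?_ (isDifferenceOracle_subGradHat hs hest hπ w) ?_
    (norm_subGrad_sub_le hβ.le hθ hs w) ?_ hz hS hlaw hind K
  · unfold subSolve
    rw [hμθ]
    exact hmain.trans (ENNReal.ofReal_le_ofReal hacc)
  -- With `L` twice the smoothness constant, the 80 in `γ_max` becomes the 20 of the Lyapunov
  -- estimate.
  · rw [le_div_iff₀ (by positivity)] at hγm
    linarith
  · intro i
    have h1 := (hest i).measurable
    have h2 : Measurable fun q : Pt m d × Ξ => (β - μ) • (q.1 - w) :=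
      (measurable_fst.sub_const w).const_smul (β - μ)
    exact h1.add h2
  · intro z
    have h1 := meanMap_le_inner hn hs hc z u
    have h2 : average (fun i => subGrad f (β - μ) w i z)
        = (meanMap f z - meanMap f u) + (β - μ) • (z - u) := by
      have h3 := eq_neg_of_add_eq_zero_left (meanMap_prox hn hμ hμβ hθ hs hc w)
      rw [← hu] at h3
      rw [average_subGrad hn hs, h3]
      simp only [smul_sub]
      abel
    rw [h2, inner_add_left, real_inner_smul_left, real_inner_self_eq_norm_sq]
    linarith

lemma measurable_gradMap {g : Objective m d} (hβ : 0 ≤ β) (h : IsSmooth β g) :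
    Measurable (gradMap g) :=
  (LipschitzWith.of_dist_le_mul (K := ⟨2 * β, by positivity⟩) fun z z' => by
    rw [dist_eq_norm, dist_eq_norm]; exact h.norm_gradMap_sub_le hβ z z').continuous.measurable

lemma measurable_weighted_output {E : Type*} [NormedAddCommGroup E] [NormedSpace ℝ E]
    [MeasurableSpace E] [BorelSpace E] [SecondCountableTopology E] {X : Type*} [MeasurableSpace X]
    {ρ : X → ℝ} {z : X → ℕ → E} (hρ : Measurable ρ) (hz : ∀ j, Measurable fun x => z x j) (k : ℕ) :
    Measurable fun x => (1 / ∑ j ∈ Finset.range k, outputWeight (ρ x) j) •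
      ∑ j ∈ Finset.range k, outputWeight (ρ x) j • z x j := by
  have hwt : ∀ j, Measurable fun x => outputWeight (ρ x) j := fun j => by
    unfold outputWeight
    exact hρ.pow_const _
  have h1 : Measurable fun x => ∑ j ∈ Finset.range k, outputWeight (ρ x) j • z x j :=
    Finset.measurable_fun_sum _ fun j _ => (hwt j).smul (hz j)
  have h2 : Measurable fun x => 1 / ∑ j ∈ Finset.range k, outputWeight (ρ x) j :=
    measurable_const.div (Finset.measurable_fun_sum _ fun j _ => hwt j)
  exact h2.smul h1

lemma measurable_scaffoldOutput (hn : 0 < n) {X : Type*} [MeasurableSpace X]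
    {G : X → Fin n → Pt m d → Pt m d} {Gh : X → Fin n → Pt m d → Ξ → Pt m d} {a : ℝ}
    {γ : X → ℝ} {z0 : X → Pt m d} {ω : X → ℕ → StepSample n Ξ}
    (hG : ∀ i, Measurable fun q : X × Pt m d => G q.1 i q.2)
    (hGh : ∀ i, Measurable fun q : X × Pt m d × Ξ => Gh q.1 i q.2.1 q.2.2)
    (hγ : Measurable γ) (hz0 : Measurable z0) (k : ℕ) (hω : ∀ j, Measurable fun x => ω x j) :
    Measurable fun x => scaffoldOutput (G x) (Gh x) a (γ x) k (z0 x) (ω x) := by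
  simp only [scaffoldOutput_eq hn]
  refine measurable_weighted_output (by fun_prop) (fun j => ?_) (k + 1)
  have hst := measurable_syncState hG hGh hγ hz0 j fun j _ => hω j
  exact measurable_average fun i => (measurable_pi_apply i).comp hst.fst

lemma measurable_subGrad (hβ : 0 ≤ β) (hs : ∀ i, IsSmooth β (f i)) {X : Type*} [MeasurableSpace X]
    {w z : X → Pt m d} (hw : Measurable w) (hz : Measurable z) (i : Fin n) :
    Measurable fun x => subGrad f θ (w x) i (z x) := by
  simp only [subGrad_eq hs]
  have h1 : Measurable fun x => gradMap (f i) (z x) := (measurable_gradMap hβ (hs i)).comp hz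
  exact h1.add ((hz.sub hw).const_smul θ)

lemma measurable_subGradHat (hGhat : ∀ i, Measurable (Function.uncurry (Ghat i))) {X : Type*}
    [MeasurableSpace X] {w : X → Pt m d} (hw : Measurable w) (i : Fin n) :
    Measurable fun q : X × Pt m d × Ξ => subGradHat Ghat θ (w q.1) i q.2.1 q.2.2 := by
  unfold subGradHat
  have h1 : Measurable fun q : X × Pt m d × Ξ => Ghat i q.2.1 q.2.2 :=
    (hGhat i).comp measurable_snd
  have h2 : Measurable fun q : X × Pt m d × Ξ => θ • (q.2.1 - w q.1) :=
    (measurable_snd.fst.sub (hw.comp measurable_fst)).const_smul θ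
  exact h1.add h2

lemma measurable_subSolve_const (hn : 0 < n) (hβ : 0 ≤ β) (hs : ∀ i, IsSmooth β (f i))
    (hGhat : ∀ i, Measurable (Function.uncurry (Ghat i))) {X : Type*} [MeasurableSpace X]
    {w : X → Pt m d} {γ : X → ℝ} {ω : X → ℕ → StepSample n Ξ} (hw : Measurable w)
    (hγ : Measurable γ) (k : ℕ) (hω : ∀ k, Measurable fun x => ω x k) :
    Measurable fun x => subSolve f Ghat μ θ (γ x) k (w x) (ω x) :=
  measurable_scaffoldOutput hn (G := fun x => subGrad f θ (w x))
    (Gh := fun x => subGradHat Ghat θ (w x)) (a := μ + θ)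
    (measurable_subGrad hβ hs (hw.comp measurable_fst) measurable_snd)
    (measurable_subGradHat hGhat hw) hγ hw k hω

/-- The number of inner iterations depends on the meta-iterate; since it takes countably many
values, measurability for each fixed number suffices. -/
lemma measurable_nat_index {X Y : Type*} [MeasurableSpace X] [MeasurableSpace Y] {F : ℕ → X → Y}
    (hF : ∀ k, Measurable (F k)) {K : X → ℕ} (hK : Measurable K) :
    Measurable fun x => F (K x) x := by
  have h1 : Measurable fun q : ℕ × X => F q.1 q.2 := measurable_from_prod_countable_right hF
  have h2 : Measurable fun x => (K x, x) := hK.prodMk measurable_id'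
  exact h1.comp h2

lemma measurable_subSolve (hn : 0 < n) (hβ : 0 ≤ β) (hs : ∀ i, IsSmooth β (f i))
    (hGhat : ∀ i, Measurable (Function.uncurry (Ghat i))) {X : Type*} [MeasurableSpace X]
    {w : X → Pt m d} {γ : X → ℝ} {K : X → ℕ} {ω : X → ℕ → StepSample n Ξ} (hw : Measurable w)
    (hγ : Measurable γ) (hK : Measurable K) (hω : ∀ k, Measurable fun x => ω x k) :
    Measurable fun x => subSolve f Ghat μ θ (γ x) (K x) (w x) (ω x) :=
  measurable_nat_index (F := fun k x => subSolve f Ghat μ θ (γ x) k (w x) (ω x))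
    (fun k => measurable_subSolve_const hn hβ hs hGhat hw hγ k hω) hK

end Subproblem

/-! ### The outer loop: independence, linear convergence, synchronizations. -/

section OuterIteration

variable {m d n : ℕ} {Ξ : Type*} [MeasurableSpace Ξ] {f : Fin n → Objective m d}
  {Ghat : Fin n → Pt m d → Ξ → Pt m d} {β μ θ p ε : ℝ} {K : Pt m d → ℕ} {γ : Pt m d → ℝ}
  {z0 zstar : Pt m d}

lemma measurable_catalystIter (hn : 0 < n) (hβ : 0 ≤ β) (hs : ∀ i, IsSmooth β (f i))
    (hGhat : ∀ i, Measurable (Function.uncurry (Ghat i))) (hK : Measurable K) (hγ : Measurable γ)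
    {X : Type*} [MeasurableSpace X] {S : ℕ → ℕ → X → StepSample n Ξ} (t : ℕ)
    (hS : ∀ s < t, ∀ k, Measurable (S s k)) :
    Measurable fun x => catalystIter f Ghat μ θ K γ z0 (fun s k => S s k x) t := by
  induction t with
  | zero => exact measurable_const
  | succ t ih =>
    have hw := ih fun s hst => hS s (by omega)
    exact measurable_subSolve hn hβ hs hGhat hw (hγ.comp hw) (hK.comp hw) (hS t (by omega))

lemma lintegral_coin {π : Fin n → Measure (Ξ × Ξ)} [∀ i, IsProbabilityMeasure (π i)] {Ω : Type*}
    [MeasurableSpace Ω] {P : Measure Ω} {X : Ω → StepSample n Ξ} (hX : Measurable X)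
    (hlaw : P.map X = stepLaw p π) :
    ∫⁻ ω, (if (X ω).1 = true then 1 else 0) ∂P = ENNReal.ofReal p := by
  have hm : Measurable fun b : Bool => if b = true then (1 : ENNReal) else 0 := measurable_of_finite _
  have hm' : Measurable fun a : StepSample n Ξ => if a.1 = true then (1 : ENNReal) else 0 :=
    hm.comp measurable_fst
  rw [← lintegral_map hm' hX, hlaw, stepLaw, lintegral_prod _ hm'.aemeasurable]
  simp [coinLaw]

variable {Ω : Type*} [MeasurableSpace Ω] {P : Measure Ω} [IsProbabilityMeasure P]
  {S : ℕ → ℕ → Ω → StepSample n Ξ}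

/-- The meta-iterate is independent of the randomness of the following meta-iteration. -/
lemma indepFun_catalystIter (hn : 0 < n) (hβ : 0 ≤ β) (hs : ∀ i, IsSmooth β (f i))
    (hGhat : ∀ i, Measurable (Function.uncurry (Ghat i))) (hK : Measurable K) (hγ : Measurable γ)
    (hS : ∀ t k, Measurable (S t k)) (hind : iIndepFun (fun tk : ℕ × ℕ => S tk.1 tk.2) P) (t : ℕ) :
    IndepFun (fun ω => catalystIter f Ghat μ θ K γ z0 (fun s k => S s k ω) t)
      (fun ω k => S t k ω) P := by
  refine indepFun_of_generatedBy (I := {tk : ℕ × ℕ | tk.1 < t}) (J := {tk : ℕ × ℕ | tk.1 = t})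
    (fun tk => hS tk.1 tk.2) hind ?_ ?_ ?_
  · rw [Set.disjoint_left]
    intro tk h1 h2
    simp only [Set.mem_ofPred_eq] at h1 h2
    omega
  · refine @measurable_catalystIter m d n Ξ _ f Ghat β μ θ K γ z0 hn hβ hs hGhat hK hγ Ω
      (generatedBy (fun tk : ℕ × ℕ => S tk.1 tk.2) {tk : ℕ × ℕ | tk.1 < t}) S t ?_
    intro s hst k
    exact measurable_generatedBy (fun tk : ℕ × ℕ => S tk.1 tk.2) (i := (s, k)) hst
  · refine @measurable_pi_lambda _ _ _
      (generatedBy (fun tk : ℕ × ℕ => S tk.1 tk.2) {tk : ℕ × ℕ | tk.1 = t}) _ _ fun k => ?_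
    exact measurable_generatedBy (fun tk : ℕ × ℕ => S tk.1 tk.2) (i := (t, k)) rfl

/-- Convexity of the square with weights `1 - η` and `η`, applied to `‖w - z‖` and `‖o - u‖ / η`. -/
lemma norm_sub_sq_le_of_contraction {E : Type*} [NormedAddCommGroup E] {η : ℝ} (hη : 0 < η)
    (hη1 : η ≤ 1) {o u w z : E} (h : ‖u - z‖ ≤ (1 - η) * ‖w - z‖) :
    ‖o - z‖ ^ 2 ≤ (1 - η) * ‖w - z‖ ^ 2 + 1 / η * ‖o - u‖ ^ 2 := by
  have h1 : ‖o - z‖ ≤ (1 - η) * ‖w - z‖ + ‖o - u‖ := by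
    have := norm_add_le (o - u) (u - z)
    rw [sub_add_sub_cancel] at this
    linarith
  have h2 := pow_le_pow_left₀ (norm_nonneg _) h1 2
  have h3 : 0 ≤ (1 - η) / η * (η * ‖w - z‖ - ‖o - u‖) ^ 2 :=
    mul_nonneg (div_nonneg (by linarith) hη.le) (sq_nonneg _)
  have h4 : (1 - η) / η * (η * ‖w - z‖ - ‖o - u‖) ^ 2
      = (1 - η) * ‖w - z‖ ^ 2 + 1 / η * ‖o - u‖ ^ 2 - ((1 - η) * ‖w - z‖ + ‖o - u‖) ^ 2 := by
    field_simp
    ring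
  linarith

/-- The meta-iterates approach the solution linearly, up to the accuracy of the inner solver. -/
theorem lintegral_norm_catalystIter_sub_sq_le (hn : 0 < n) (hμ : 0 < μ) (hμβ : μ ≤ β) (hε : 0 < ε)
    (hs : ∀ i, IsSmooth β (f i)) (hc : ∀ i, IsStronglyConvexConcave μ (f i))
    (hGhat : ∀ i, Measurable (Function.uncurry (Ghat i))) (hK : Measurable K) (hγ : Measurable γ)
    (hz : IsMinimaxOptimal (globalObjective f) zstar)
    (hS : ∀ t k, Measurable (S t k)) (hind : iIndepFun (fun tk : ℕ × ℕ => S tk.1 tk.2) P)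
    (hacc : ∀ t w, ∫⁻ ω, ENNReal.ofReal (‖subSolve f Ghat μ (β - μ) (γ w) (K w) w
      (fun k => S t k ω) - prox (β - μ) (globalObjective f) w‖ ^ 2) ∂P
        ≤ ENNReal.ofReal ((μ / (2 * β)) ^ 2 * ε)) (t : ℕ) :
    ∫⁻ ω, ENNReal.ofReal (‖catalystIter f Ghat μ (β - μ) K γ z0 (fun s k => S s k ω) t
      - zstar‖ ^ 2) ∂P ≤ ENNReal.ofReal ((1 - μ / β) ^ t * ‖z0 - zstar‖ ^ 2 + ε / 4) := by
  have hβ : 0 < β := hμ.trans_le hμβ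
  have hθ : 0 ≤ β - μ := by linarith
  have hη0 : 0 < μ / β := div_pos hμ hβ
  have hη1 : μ / β ≤ 1 := (div_le_one hβ).2 hμβ
  induction t with
  | zero =>
    simp only [catalystIter, lintegral_const, measure_univ, mul_one]
    refine ENNReal.ofReal_le_ofReal ?_
    rw [pow_zero]
    linarith
  | succ t ih =>
    have hwm := measurable_catalystIter (f := f) (μ := μ) (θ := β - μ) (z0 := z0) hn hβ.le hs hGhat
      hK hγ t fun s _ => hS s
    have hYm : Measurable fun ω k => S t k ω := measurable_pi_lambda _ fun k => hS t k
    have hF : Measurable fun q : Pt m d × (ℕ → StepSample n Ξ) => ENNReal.ofReal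
        (‖subSolve f Ghat μ (β - μ) (γ q.1) (K q.1) q.1 q.2 - zstar‖ ^ 2) := by
      have h1 := measurable_subSolve (f := f) (μ := μ) (θ := β - μ) hn hβ.le hs hGhat
        (measurable_fst (α := Pt m d) (β := ℕ → StepSample n Ξ)) (hγ.comp measurable_fst)
        (hK.comp measurable_fst) (ω := Prod.snd) fun k =>
          (measurable_pi_apply k).comp measurable_snd
      exact ((h1.sub_const zstar).norm.pow_const 2).ennreal_ofReal
    have h1 := lintegral_comp_indepFun (indepFun_catalystIter (f := f) (μ := μ) (θ := β - μ)
      (z0 := z0) hn hβ.le hs hGhat hK hγ hS hind t) hwm hYm hF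
    simp only [catalystIter]
    rw [h1]
    have h2 : ∀ w : Pt m d, ∫⁻ ω', ENNReal.ofReal (‖subSolve f Ghat μ (β - μ) (γ w) (K w) w
        (fun k => S t k ω') - zstar‖ ^ 2) ∂P
        ≤ ENNReal.ofReal (1 - μ / β) * ENNReal.ofReal (‖w - zstar‖ ^ 2)
          + ENNReal.ofReal (μ / β * (ε / 4)) := by
      intro w
      have hcon : ‖prox (β - μ) (globalObjective f) w - zstar‖ ≤ (1 - μ / β) * ‖w - zstar‖ := by
        have h := norm_prox_sub_prox_le hn hμ hμβ hθ hs hc w zstar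
        rw [prox_of_isMinimaxOptimal hn hμ hμβ hθ hs hc hz, show μ + (β - μ) = β by ring] at h
        have e : (1 - μ / β) * ‖w - zstar‖ = (β - μ) * ‖w - zstar‖ / β := by field_simp
        rw [e, le_div_iff₀ hβ]
        linarith
      -- The inner accuracy is calibrated so that `ε / 4` is the fixed point of the outer recursion.
      have hwβ : 1 / (μ / β) * ((μ / (2 * β)) ^ 2 * ε) = μ / β * (ε / 4) := by
        field_simp
        norm_num
      calc _ ≤ ∫⁻ ω', (ENNReal.ofReal (1 - μ / β) * ENNReal.ofReal (‖w - zstar‖ ^ 2)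
            + ENNReal.ofReal (1 / (μ / β)) * ENNReal.ofReal (‖subSolve f Ghat μ (β - μ) (γ w) (K w)
              w (fun k => S t k ω') - prox (β - μ) (globalObjective f) w‖ ^ 2)) ∂P := by
            refine lintegral_mono fun ω' => ?_
            rw [← ENNReal.ofReal_mul (by linarith), ← ENNReal.ofReal_mul (by positivity),
              ← ENNReal.ofReal_add (mul_nonneg (by linarith) (by positivity)) (by positivity)]
            exact ENNReal.ofReal_le_ofReal (norm_sub_sq_le_of_contraction hη0 hη1 hcon)
        _ = ENNReal.ofReal (1 - μ / β) * ENNReal.ofReal (‖w - zstar‖ ^ 2)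
            + ENNReal.ofReal (1 / (μ / β)) * ∫⁻ ω', ENNReal.ofReal (‖subSolve f Ghat μ (β - μ)
              (γ w) (K w) w (fun k => S t k ω') - prox (β - μ) (globalObjective f) w‖ ^ 2) ∂P := by
            rw [lintegral_add_left measurable_const, lintegral_const, measure_univ, mul_one,
              lintegral_const_mul' _ _ ENNReal.ofReal_ne_top]
        _ ≤ _ := by
            rw [← hwβ, ENNReal.ofReal_mul (by positivity : 0 ≤ 1 / (μ / β))]
            gcongr
            exact hacc t w
    refine (lintegral_mono fun ω => h2 _).trans ?_
    rw [lintegral_add_right _ measurable_const, lintegral_const, measure_univ, mul_one,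
      lintegral_const_mul' _ _ ENNReal.ofReal_ne_top]
    calc _ ≤ ENNReal.ofReal (1 - μ / β)
          * ENNReal.ofReal ((1 - μ / β) ^ t * ‖z0 - zstar‖ ^ 2 + ε / 4)
          + ENNReal.ofReal (μ / β * (ε / 4)) := by gcongr
      _ = ENNReal.ofReal ((1 - μ / β) ^ (t + 1) * ‖z0 - zstar‖ ^ 2 + ε / 4) := by
          have : 0 ≤ (1 - μ / β) ^ t := pow_nonneg (by linarith) t
          rw [← ENNReal.ofReal_mul (by linarith), ← ENNReal.ofReal_add
            (mul_nonneg (by linarith) (by positivity)) (by positivity)]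
          congr 1
          ring

/-- Expected number of synchronizations in one meta-iteration, given a bound on the number of
iterations. -/
lemma lintegral_card_sync_le (hn : 0 < n) (hβ : 0 ≤ β) (hs : ∀ i, IsSmooth β (f i))
    (hGhat : ∀ i, Measurable (Function.uncurry (Ghat i))) (hK : Measurable K) (hγ : Measurable γ)
    (hp : 0 < p) {π : Fin n → Measure (Ξ × Ξ)} [∀ i, IsProbabilityMeasure (π i)]
    (hS : ∀ t k, Measurable (S t k)) (hlaw : ∀ t k, P.map (S t k) = stepLaw p π)
    (hind : iIndepFun (fun tk : ℕ × ℕ => S tk.1 tk.2) P) {a b D : ℝ} (ha : 0 ≤ a) (hb : 0 ≤ b)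
    (hD : 0 ≤ D) (hKle : ∀ w, (K w : ℝ) ≤ a + b * ‖w - zstar‖ ^ 2) (t : ℕ)
    (hdist : ∫⁻ ω, ENNReal.ofReal (‖catalystIter f Ghat μ θ K γ z0 (fun s k => S s k ω) t
      - zstar‖ ^ 2) ∂P ≤ ENNReal.ofReal D) :
    ∫⁻ ω, (((Finset.range (K (catalystIter f Ghat μ θ K γ z0 (fun s k => S s k ω) t))).filter
      (fun k => (S t k ω).1 = true)).card : ENNReal) ∂P ≤ ENNReal.ofReal (p * (a + b * D)) := by
  have hwm := measurable_catalystIter (f := f) (μ := μ) (θ := θ) (z0 := z0) hn hβ hs hGhat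
    hK hγ t fun s _ => hS s
  have hYm : Measurable fun ω k => S t k ω := measurable_pi_lambda _ fun k => hS t k
  have hm : Measurable fun b : Bool => if b = true then (1 : ENNReal) else 0 := measurable_of_finite _
  have hF : Measurable fun q : Pt m d × (ℕ → StepSample n Ξ) =>
      ∑ k ∈ Finset.range (K q.1), if (q.2 k).1 = true then (1 : ENNReal) else 0 :=
    measurable_nat_index (F := fun j (q : Pt m d × (ℕ → StepSample n Ξ)) =>
      ∑ k ∈ Finset.range j, if (q.2 k).1 = true then (1 : ENNReal) else 0)
      (fun j => Finset.measurable_fun_sum _ fun k _ => hm.comp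
        ((measurable_pi_apply k).comp measurable_snd).fst) (hK.comp measurable_fst)
  have h1 := lintegral_comp_indepFun (indepFun_catalystIter (f := f) (μ := μ) (θ := θ)
      (z0 := z0) hn hβ hs hGhat hK hγ hS hind t) hwm hYm hF
  simp only [Finset.card_filter, Nat.cast_sum, Nat.cast_ite, Nat.cast_one, Nat.cast_zero]
  rw [h1]
  -- With the meta-iterate frozen, `K w` is a constant and every coin contributes `p`. The affine
  -- majorant then needs only the second moment of the distance.
  have h2 : ∀ w : Pt m d, ∫⁻ ω', (∑ k ∈ Finset.range (K w),
      if (S t k ω').1 = true then (1 : ENNReal) else 0) ∂P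
      ≤ ENNReal.ofReal p * (ENNReal.ofReal a + ENNReal.ofReal b * ENNReal.ofReal (‖w - zstar‖ ^ 2))
      := by
    intro w
    rw [lintegral_finsetSum (f := fun k ω' => if (S t k ω').1 = true then (1 : ENNReal) else 0) _
      fun k _ => hm.comp (hS t k).fst]
    simp only [fun k => lintegral_coin (hS t k) (hlaw t k), Finset.sum_const,
      Finset.card_range, nsmul_eq_mul]
    rw [mul_comm, ← ENNReal.ofReal_mul hb, ← ENNReal.ofReal_add ha (by positivity)]
    gcongr
    rw [← ENNReal.ofReal_natCast]
    exact ENNReal.ofReal_le_ofReal (hKle w)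
  refine (lintegral_mono fun ω => h2 _).trans ?_
  rw [lintegral_const_mul' _ _ ENNReal.ofReal_ne_top, lintegral_add_left measurable_const,
    lintegral_const, measure_univ, mul_one, lintegral_const_mul' _ _ ENNReal.ofReal_ne_top,
    ENNReal.ofReal_mul hp.le, ENNReal.ofReal_add ha (by positivity), ENNReal.ofReal_mul hb]
  gcongr

end OuterIteration

/-! ### Arithmetic of the round count. -/

section Rounds

/-- A tangent line of the concave logarithm at `2 + Rb`, for use at a bound `Rb` on the mean of the
random `R`. It takes the place of Jensen's inequality. -/
lemma iterCount_le_affine {M R Rb : ℝ} (hM : 1 ≤ M) (hR : 0 ≤ R) (hRb : 0 ≤ Rb) :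
    (iterCount M R : ℝ) ≤ 1 + 2 * M * (Real.log (2 + Rb) + 2 + 3 * Real.log (6 * M))
      + 2 * M / (2 + Rb) * R := by
  have h1 := iterCount_le hM hR
  have h2 : Real.log (2 + R) ≤ Real.log (2 + Rb) + R / (2 + Rb) := by
    have h3 : 0 < (2 + R) / (2 + Rb) := by positivity
    have h4 := Real.log_le_sub_one_of_pos h3
    rw [Real.log_div (by positivity) (by positivity)] at h4
    have h5 : (2 + R) / (2 + Rb) - 1 ≤ R / (2 + Rb) := by
      rw [div_sub_one (by positivity)]
      gcongr
      linarith
    linarith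
  have h3 := mul_le_mul_of_nonneg_left h2 (by linarith : 0 ≤ 2 * M)
  have h4 : 2 * M * (R / (2 + Rb)) = 2 * M / (2 + Rb) * R := by ring
  linarith

/-- The number of meta-iterations, where `r = β / μ` and `e = ‖z⁰ - z*‖² / ε`. -/
noncomputable def metaCount (r e : ℝ) : ℕ := ⌈r * Real.log (2 + 2 * e)⌉₊

/-- `(1 - 1 / r)^T ≤ exp (-T / r) ≤ 1 / (2 + 2 e)`. The summand 2 keeps the logarithm positive even
at `e = 0`. -/
lemma contraction_pow_metaCount_le {r e : ℝ} (hr : 1 ≤ r) (he : 0 ≤ e) :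
    (1 - 1 / r) ^ metaCount r e * e ≤ 1 / 2 := by
  have hr0 : 0 < r := by linarith
  have hr1 : 1 / r ≤ 1 := (div_le_one hr0).2 hr
  have h1 : r * Real.log (2 + 2 * e) ≤ metaCount r e := Nat.le_ceil _
  have h2 : (1 - 1 / r) ^ metaCount r e ≤ Real.exp (-(metaCount r e / r)) := by
    have h3 := Real.add_one_le_exp (-(1 / r))
    refine (pow_le_pow_left₀ (by linarith) (by linarith : 1 - 1 / r ≤ Real.exp (-(1 / r)))
      _).trans_eq ?_
    rw [← Real.exp_nat_mul]
    congr 1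
    ring
  have h3 : Real.log (2 + 2 * e) ≤ metaCount r e / r := by
    rw [le_div_iff₀ hr0]
    linarith
  have h4 : Real.exp (-(metaCount r e / r)) ≤ 1 / (2 + 2 * e) := by
    rw [Real.exp_neg, ← one_div]
    refine one_div_le_one_div_of_le (by positivity) ?_
    rw [← Real.log_le_iff_le_exp (by positivity)]
    exact h3
  calc _ ≤ 1 / (2 + 2 * e) * e := mul_le_mul_of_nonneg_right (h2.trans h4) he
    _ ≤ 1 / 2 := by
      rw [div_mul_eq_mul_div, div_le_div_iff₀ (by positivity) (by norm_num)]
      linarith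

lemma p_mul_countFactor {n : ℕ} {p s : ℝ} (hp : 0 < p) :
    p * countFactor n p s = 6000 * (p * s ^ 2 / n + Real.sqrt p * s + 1) := by
  unfold countFactor
  have h1 : Real.sqrt p * Real.sqrt p = p := Real.mul_self_sqrt hp.le
  have h2 : 0 < Real.sqrt p := Real.sqrt_pos.2 hp
  have h3 : p * (s / Real.sqrt p) = Real.sqrt p * s := by
    rw [mul_div_assoc', div_eq_iff h2.ne']
    linear_combination (-s) * h1
  have h4 : p * (1 / p) = 1 := by field_simp
  calc _ = 6000 * (p * (1 / p) + p * s ^ 2 / n + p * (s / Real.sqrt p)) := by ring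
    _ = _ := by rw [h3, h4]; ring

lemma log_le_mul_log {x y : ℝ} (k : ℕ) (hx : 0 < x) (h : x ≤ y ^ k) :
    Real.log x ≤ k * Real.log y := by
  rw [← Real.log_pow]
  exact Real.log_le_log hx h

/-- The total number of rounds. Here `r = β / μ`, `e = ‖z⁰ - z*‖² / ε` and `s = σ / (μ √ε)`. -/
lemma rounds_le {n : ℕ} (hn : 0 < n) {p r e s : ℝ} (hp : 0 < p) (hp1 : p ≤ 1) (hr : 1 ≤ r)
    (he : 0 ≤ e) (hs : 0 ≤ s) :
    metaCount r e * (1 + p * (1 + 2 * countFactor n p s * (Real.log (2 + 4 * r ^ 2 * (e + 1 / 4))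
        + 2 + 3 * Real.log (6 * countFactor n p s)) + 2 * countFactor n p s))
      ≤ 1500000 * Real.log (2 + r + 1 / p + e + s ^ 2) ^ 2
        * (r * (p * s ^ 2 / n + Real.sqrt p * s + 1)) := by
  have hn1 : (1 : ℝ) ≤ n := by exact_mod_cast hn
  have hr0 : 0 < r := by linarith
  have hip : 1 ≤ 1 / p := by rw [le_div_iff₀ hp]; linarith
  obtain ⟨y, hy⟩ : ∃ y, y = 2 + r + 1 / p + e + s ^ 2 := ⟨_, rfl⟩
  obtain ⟨Λ, hΛ⟩ : ∃ Λ, Λ = Real.log y := ⟨_, rfl⟩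
  rw [← hy, ← hΛ]
  have hs2 : 0 ≤ s ^ 2 := sq_nonneg s
  have hy4 : 4 ≤ y := by linarith
  have hΛ1 : 1 ≤ Λ := by
    rw [hΛ, Real.le_log_iff_exp_le (by linarith)]
    have := Real.exp_one_lt_d9
    linarith
  have hM := le_countFactor (n := n) hp hp1 hs
  obtain ⟨M, hMdef⟩ : ∃ M, M = countFactor n p s := ⟨_, rfl⟩
  rw [← hMdef] at hM ⊢
  have hpM : p * M = 6000 * (p * s ^ 2 / n + Real.sqrt p * s + 1) := by
    rw [hMdef, p_mul_countFactor hp]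
  obtain ⟨B, hB⟩ : ∃ B, B = p * s ^ 2 / n + Real.sqrt p * s + 1 := ⟨_, rfl⟩
  rw [← hB] at hpM ⊢
  have hB1 : 1 ≤ B := by
    have h1 : 0 ≤ p * s ^ 2 / n := by positivity
    have h2 : 0 ≤ Real.sqrt p * s := by positivity
    linarith
  have hT : (metaCount r e : ℝ) ≤ 3 * r * Λ := by
    have h0 : 0 ≤ Real.log (2 + 2 * e) := Real.log_nonneg (by linarith)
    have h1 := Nat.ceil_lt_add_one (a := r * Real.log (2 + 2 * e)) (by positivity)
    have h2 : Real.log (2 + 2 * e) ≤ (2 : ℕ) * Λ := hΛ ▸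
      log_le_mul_log 2 (by positivity) (by nlinarith only [hy4, hy, hs2, hr, hip, he])
    push_cast at h2
    have h3 := mul_le_mul_of_nonneg_left h2 hr0.le
    have h4 : 1 ≤ r * Λ := one_le_mul_of_one_le_of_one_le hr hΛ1
    unfold metaCount
    linarith
  have hL1 : Real.log (2 + 4 * r ^ 2 * (e + 1 / 4)) ≤ 4 * Λ := by
    have h := log_le_mul_log (x := 2 + 4 * r ^ 2 * (e + 1 / 4)) (y := y) 4 (by positivity) (by
      have hre : r ^ 2 ≤ y ^ 2 := pow_le_pow_left₀ hr0.le (by linarith) 2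
      have h1 : r ^ 2 * (e + 1 / 4) ≤ y ^ 2 * (y - 3) :=
        mul_le_mul hre (by linarith) (by positivity) (by positivity)
      have h3 : 0 ≤ y ^ 3 * (y - 4) := mul_nonneg (by positivity) (by linarith)
      have h5 : (4 : ℝ) ^ 2 ≤ y ^ 2 := pow_le_pow_left₀ (by norm_num) hy4 2
      linarith)
    rw [hΛ]
    exact_mod_cast h
  -- `6 M ≤ 54000 y` and `4^8 = 65536`, so `y ≥ 4` gives `6 M ≤ y^9`.
  have hL2 : Real.log (6 * M) ≤ 9 * Λ := by
    have h := log_le_mul_log (x := 6 * M) (y := y) 9 (by linarith) (by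
      have hsp : s / Real.sqrt p ≤ (s ^ 2 + 1 / p) / 2 := by
        have h1 : s / Real.sqrt p = s * (1 / Real.sqrt p) := by ring
        have h2 : (1 / Real.sqrt p) ^ 2 = 1 / p := by
          rw [div_pow, Real.sq_sqrt hp.le, one_pow]
        rw [h1, ← h2]
        linarith only [sq_nonneg (s - 1 / Real.sqrt p)]
      have hsn : s ^ 2 / n ≤ s ^ 2 := div_le_self hs2 hn1
      have h1 : M ≤ 6000 * (3 / 2 * y) := by
        rw [hMdef, countFactor]
        linarith
      have h2 : (4 : ℝ) ^ 8 ≤ y ^ 8 := pow_le_pow_left₀ (by norm_num) hy4 8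
      have h3 := mul_le_mul_of_nonneg_right h2 (by linarith : 0 ≤ y)
      have h4 : y ^ 9 = y ^ 8 * y := by ring
      rw [h4]
      linarith)
    rw [hΛ]
    exact_mod_cast h
  -- The logarithms add up to `4 + 27` multiples of `Λ`, and the constants `2 + 1` are absorbed by
  -- `Λ ≥ 1`: 34 in all. The broadcast and the rounding of the count are covered by `1 ≤ B Λ`.
  have hK : 1 + p * (1 + 2 * M * (Real.log (2 + 4 * r ^ 2 * (e + 1 / 4)) + 2
      + 3 * Real.log (6 * M)) + 2 * M) ≤ 410000 * (B * Λ) := by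
    have h1 : 2 * (p * M) * (Real.log (2 + 4 * r ^ 2 * (e + 1 / 4)) + 2 + 3 * Real.log (6 * M) + 1)
        ≤ 2 * (p * M) * (34 * Λ) :=
      mul_le_mul_of_nonneg_left (by linarith) (by rw [hpM]; linarith)
    have h2 : 2 * (p * M) * (34 * Λ) = 408000 * (B * Λ) := by rw [hpM]; ring
    have h3 : 1 ≤ B * Λ := one_le_mul_of_one_le_of_one_le hB1 hΛ1
    linarith only [h1, h2, h3, hp1]
  have hBΛ : 0 ≤ B * Λ := by positivity
  calc _ ≤ 3 * r * Λ * (410000 * (B * Λ)) := by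
        refine mul_le_mul hT hK ?_ (by positivity)
        have h1 : 0 ≤ Real.log (2 + 4 * r ^ 2 * (e + 1 / 4)) := by
          refine Real.log_nonneg ?_
          have : 0 ≤ 4 * r ^ 2 * (e + 1 / 4) := by positivity
          linarith
        have h2 : 0 ≤ Real.log (6 * M) := Real.log_nonneg (by linarith)
        have h3 : 0 ≤ M := by linarith
        positivity
    _ = 1230000 * (Λ ^ 2 * (r * B)) := by ring
    _ ≤ 1500000 * (Λ ^ 2 * (r * B)) := by
        have : 0 ≤ Λ ^ 2 * (r * B) := by positivity
        linarith
    _ = _ := by ring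

end Rounds

/-! ### Expected rounds, and the passage back to Bochner integrals. -/

section TotalRounds

variable {m d n : ℕ} {Ξ : Type*} [MeasurableSpace Ξ] {f : Fin n → Objective m d}
  {Ghat : Fin n → Pt m d → Ξ → Pt m d} {β μ θ p ε : ℝ} {K : Pt m d → ℕ} {γ : Pt m d → ℝ}
  {z0 zstar : Pt m d}

lemma measurable_card_sync (hn : 0 < n) (hβ : 0 ≤ β) (hs : ∀ i, IsSmooth β (f i))
    (hGhat : ∀ i, Measurable (Function.uncurry (Ghat i))) (hK : Measurable K) (hγ : Measurable γ)
    {X : Type*} [MeasurableSpace X] {S : ℕ → ℕ → X → StepSample n Ξ}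
    (hS : ∀ t k, Measurable (S t k)) (t : ℕ) :
    Measurable fun x => ((Finset.range
      (K (catalystIter f Ghat μ θ K γ z0 (fun s k => S s k x) t))).filter
        (fun k => (S t k x).1 = true)).card := by
  have hw := measurable_catalystIter (f := f) (μ := μ) (θ := θ) (z0 := z0) hn hβ hs hGhat
    hK hγ t fun s _ => hS s
  have hm : Measurable fun b : Bool => if b = true then 1 else 0 := measurable_of_finite _
  simp only [Finset.card_filter]
  exact measurable_nat_index (F := fun j x => ∑ k ∈ Finset.range j,
    if (S t k x).1 = true then 1 else 0)
    (fun j => Finset.measurable_fun_sum _ fun k _ => hm.comp (hS t k).fst) (hK.comp hw)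

lemma measurable_catalystRounds (hn : 0 < n) (hβ : 0 ≤ β) (hs : ∀ i, IsSmooth β (f i))
    (hGhat : ∀ i, Measurable (Function.uncurry (Ghat i))) (hK : Measurable K) (hγ : Measurable γ)
    {X : Type*} [MeasurableSpace X] {S : ℕ → ℕ → X → StepSample n Ξ}
    (hS : ∀ t k, Measurable (S t k)) (T : ℕ) :
    Measurable fun x => catalystRounds f Ghat μ θ K γ z0 (fun s k => S s k x) T :=
  Finset.measurable_fun_sum _ fun t _ =>
    (measurable_card_sync hn hβ hs hGhat hK hγ hS t).const_add 1

/-- Expected number of communication rounds, given bounds on the numbers of inner iterations and on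
the distances of the meta-iterates to the solution. -/
theorem lintegral_catalystRounds_le (hn : 0 < n) (hβ : 0 ≤ β) (hs : ∀ i, IsSmooth β (f i))
    (hGhat : ∀ i, Measurable (Function.uncurry (Ghat i))) (hK : Measurable K) (hγ : Measurable γ)
    (hp : 0 < p) {π : Fin n → Measure (Ξ × Ξ)} [∀ i, IsProbabilityMeasure (π i)]
    {Ω : Type*} [MeasurableSpace Ω] {P : Measure Ω} [IsProbabilityMeasure P]
    {S : ℕ → ℕ → Ω → StepSample n Ξ}
    (hS : ∀ t k, Measurable (S t k)) (hlaw : ∀ t k, P.map (S t k) = stepLaw p π)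
    (hind : iIndepFun (fun tk : ℕ × ℕ => S tk.1 tk.2) P) {a b D : ℝ} (ha : 0 ≤ a) (hb : 0 ≤ b)
    (hD : 0 ≤ D) (hKle : ∀ w, (K w : ℝ) ≤ a + b * ‖w - zstar‖ ^ 2)
    (hdist : ∀ t, ∫⁻ ω, ENNReal.ofReal (‖catalystIter f Ghat μ θ K γ z0 (fun s k => S s k ω) t
      - zstar‖ ^ 2) ∂P ≤ ENNReal.ofReal D) (T : ℕ) :
    ∫⁻ ω, ENNReal.ofReal (catalystRounds f Ghat μ θ K γ z0 (fun s k => S s k ω) T : ℝ) ∂P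
      ≤ ENNReal.ofReal (T * (1 + p * (a + b * D))) := by
  simp only [ENNReal.ofReal_natCast]
  simp only [catalystRounds, Nat.cast_sum, Nat.cast_add, Nat.cast_one]
  have hcast : Measurable fun j : ℕ => (j : ENNReal) := measurable_from_nat
  have hm := fun t => hcast.comp
    (measurable_card_sync (f := f) (μ := μ) (θ := θ) (z0 := z0) hn hβ hs hGhat hK hγ hS t)
  simp only [Function.comp_def] at hm
  rw [lintegral_finsetSum _ fun t _ => (hm t).const_add 1, ENNReal.ofReal_mul (by positivity),
    ENNReal.ofReal_natCast, ← nsmul_eq_mul]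
  refine (Finset.sum_le_card_nsmul _ _ (ENNReal.ofReal (1 + p * (a + b * D))) fun t _ => ?_).trans_eq
    (by rw [Finset.card_range])
  rw [lintegral_add_left measurable_const, lintegral_const, measure_univ, mul_one,
    ENNReal.ofReal_add zero_le_one (by positivity), ENNReal.ofReal_one]
  gcongr
  exact lintegral_card_sync_le hn hβ hs hGhat hK hγ hp hS hlaw hind ha hb hD hKle t (hdist t)

/-- A finite bound on the lower integral yields integrability as well. `Y'` is a measurable version
of the data, so the given samples may be merely almost everywhere measurable. -/
lemma integrable_and_integral_le {Ω A : Type*} [MeasurableSpace Ω] {P : Measure Ω} {Y Y' : Ω → A}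
    (hY : Y =ᵐ[P] Y') {Φ : A → ℝ} (h0 : ∀ y, 0 ≤ Φ y) {c : ℝ} (hc : 0 ≤ c)
    (hm : Measurable fun ω => Φ (Y' ω))
    (h : ∫⁻ ω, ENNReal.ofReal (Φ (Y' ω)) ∂P ≤ ENNReal.ofReal c) :
    Integrable (fun ω => Φ (Y ω)) P ∧ ∫ ω, Φ (Y ω) ∂P ≤ c := by
  have hΦ : (fun ω => Φ (Y ω)) =ᵐ[P] fun ω => Φ (Y' ω) := hY.fun_comp Φ
  have hi : Integrable (fun ω => Φ (Y' ω)) P :=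
    (lintegral_ofReal_ne_top_iff_integrable hm.aestronglyMeasurable
      (Filter.Eventually.of_forall fun ω => h0 _)).1 (h.trans_lt ENNReal.ofReal_lt_top).ne
  refine ⟨hi.congr hΦ.symm, ?_⟩
  rw [integral_congr_ae hΦ, ← ENNReal.ofReal_le_ofReal_iff hc, ofReal_integral_eq_lintegral_ofReal hi
    (Filter.Eventually.of_forall fun ω => h0 _)]
  exact h

end TotalRounds

/-! ### The rule for the iteration count and the existence of step sizes. -/

section Rule

variable {m d n : ℕ} {f : Fin n → Objective m d} {β μ σ p ε : ℝ} {zstar : Pt m d}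

/-- The rule for the number of inner iterations. -/
noncomputable def innerCount (f : Fin n → Objective m d) (p β μ σ ε : ℝ) (w : Pt m d) : ℕ :=
  iterCount (countFactor n p (σ / (μ * Real.sqrt ε)))
    (β ^ 2 * ‖w - prox (β - μ) (globalObjective f) w‖ ^ 2 / (μ ^ 2 * ε))

lemma measurable_innerCount (hn : 0 < n) (hμ : 0 < μ) (hμβ : μ ≤ β)
    (hs : ∀ i, IsSmooth β (f i)) (hc : ∀ i, IsStronglyConvexConcave μ (f i)) :
    Measurable (innerCount f p β μ σ ε) := by
  have h1 : Measurable (prox (β - μ) (globalObjective f)) :=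
    (continuous_prox hn hμ hμβ (by linarith) hs hc).measurable
  have h2 : Measurable fun w : Pt m d => ‖w - prox (β - μ) (globalObjective f) w‖ ^ 2 :=
    (measurable_id.sub h1).norm.pow_const 2
  unfold innerCount iterCount
  refine Nat.measurable_ceil.comp ?_
  fun_prop

/-- The proximal map fixes `zstar` and does not increase distances, so `w` is within `2 ‖w - zstar‖`
of its proximal point. This makes the count affine in a quantity that the outer recursion controls.
-/
lemma innerCount_le (hn : 0 < n) (hμ : 0 < μ) (hμβ : μ ≤ β) (hσ : 0 ≤ σ) (hp : 0 < p)
    (hp1 : p ≤ 1) (hε : 0 < ε) (hs : ∀ i, IsSmooth β (f i))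
    (hc : ∀ i, IsStronglyConvexConcave μ (f i)) (hz : IsMinimaxOptimal (globalObjective f) zstar)
    {Rb : ℝ} (hRb : 0 ≤ Rb) (w : Pt m d) :
    (innerCount f p β μ σ ε w : ℝ) ≤ 1 + 2 * countFactor n p (σ / (μ * Real.sqrt ε)) *
        (Real.log (2 + Rb) + 2 + 3 * Real.log (6 * countFactor n p (σ / (μ * Real.sqrt ε))))
      + 2 * countFactor n p (σ / (μ * Real.sqrt ε)) / (2 + Rb) * (4 * (β / μ) ^ 2 / ε)
        * ‖w - zstar‖ ^ 2 := by
  have hβ : 0 < β := hμ.trans_le hμβ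
  have hM := le_countFactor (n := n) (s := σ / (μ * Real.sqrt ε)) hp hp1 (by positivity)
  refine (iterCount_le_affine (by linarith) (by positivity) hRb).trans ?_
  have h1 : ‖w - prox (β - μ) (globalObjective f) w‖ ≤ 2 * ‖w - zstar‖ := by
    have h := norm_prox_sub_prox_le hn hμ hμβ (by linarith : 0 ≤ β - μ) hs hc w zstar
    rw [prox_of_isMinimaxOptimal hn hμ hμβ (by linarith) hs hc hz,
      show μ + (β - μ) = β by ring] at h
    have h2 : ‖prox (β - μ) (globalObjective f) w - zstar‖ ≤ ‖w - zstar‖ := by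
      refine le_of_mul_le_mul_left (h.trans ?_) hβ
      exact mul_le_mul_of_nonneg_right (by linarith) (norm_nonneg _)
    have h3 := norm_sub_le (w - zstar) (prox (β - μ) (globalObjective f) w - zstar)
    rw [sub_sub_sub_cancel_right] at h3
    linarith
  have h2 : β ^ 2 * ‖w - prox (β - μ) (globalObjective f) w‖ ^ 2 / (μ ^ 2 * ε)
      ≤ 4 * (β / μ) ^ 2 / ε * ‖w - zstar‖ ^ 2 := by
    calc _ ≤ β ^ 2 * (2 * ‖w - zstar‖) ^ 2 / (μ ^ 2 * ε) := by gcongr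
      _ = _ := by field_simp; ring
  have h3 := mul_le_mul_of_nonneg_left h2 (by positivity :
    0 ≤ 2 * countFactor n p (σ / (μ * Real.sqrt ε)) / (2 + Rb))
  linarith

lemma exists_measurable_subStepsize (hn : 0 < n) (hμ : 0 < μ) (hμβ : μ ≤ β) (hp : 0 < p)
    (hp1 : p ≤ 1) (hs : ∀ i, IsSmooth β (f i)) (hc : ∀ i, IsStronglyConvexConcave μ (f i))
    {K : Pt m d → ℕ} (hK : Measurable K) (hK1 : ∀ w, 1 ≤ K w) :
    ∃ γ : Pt m d → ℝ, Measurable γ ∧ ∀ w, IsSubStepsize f p β μ σ (β - μ) w (K w) (γ w) := by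
  have hβ : 0 < β := hμ.trans_le hμβ
  have hpm : Measurable (prox (β - μ) (globalObjective f)) :=
    (continuous_prox hn hμ hμβ (by linarith) hs hc).measurable
  have hr : Measurable fun w : Pt m d => ‖w - prox (β - μ) (globalObjective f) w‖ ^ 2 :=
    (measurable_id.sub hpm).norm.pow_const 2
  have hg : Measurable fun w : Pt m d => (1 / (n : ℝ)) * ∑ i, ‖subGrad f (β - μ) w i w
      - subGrad f (β - μ) w i (prox (β - μ) (globalObjective f) w)‖ ^ 2 := by
    refine (Finset.measurable_fun_sum _ fun i _ => ?_).const_mul _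
    have h1 := measurable_subGrad (f := f) (θ := β - μ) hβ.le hs measurable_id measurable_id i
    have h2 := measurable_subGrad (f := f) (θ := β - μ) hβ.le hs measurable_id hpm i
    exact (h1.sub h2).norm.pow_const 2
  exact exists_measurable_stepsize hp hp1 (by linarith) (by linarith) hr hg
    (fun w => mul_nonneg (by positivity) (Finset.sum_nonneg fun i _ => by positivity)) hK hK1

end Rule

end FedMinimax

/-! ### Assembly. One logarithm from the meta-iterations and one from the inner counts give `q = 2`.
-/

theorem mainTheorem4 :
    ∃ (C : ℝ) (q : ℕ), 0 < C ∧
    ∀ (m d n : ℕ) (_ : 0 < n)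
      -- client objectives, stochastic gradient mappings, client distributions, and the joint laws
      -- of the two samples that a client draws in one iteration
      (f : Fin n → Objective m d)
      (Ξ : Type*) [MeasurableSpace Ξ] (Ghat : Fin n → Pt m d → Ξ → Pt m d)
      (D : Fin n → Measure Ξ) [∀ i, IsProbabilityMeasure (D i)]
      (π : Fin n → Measure (Ξ × Ξ)) [∀ i, IsProbabilityMeasure (π i)]
      (β μ σ p ε : ℝ) (z0 zstar : Pt m d)
      (_ : 0 < μ) (_ : μ ≤ β) (_ : 0 ≤ σ) (_ : 0 < p) (_ : p ≤ 1) (_ : 0 < ε)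
      (_ : ∀ i, IsSmooth β (f i)) (_ : ∀ i, IsStronglyConvexConcave μ (f i))
      (_ : ∀ i, IsUnbiasedEstimate (gradMap (f i)) (Ghat i) (D i) σ)
      (_ : ∀ i, (π i).fst = D i ∧ (π i).snd = D i)
      (_ : IsMinimaxOptimal (globalObjective f) zstar),
    ∃ (T : ℕ) (K : Pt m d → ℕ), Measurable K ∧ (∀ w, 1 ≤ K w) ∧
      -- the step size rule is realizable, and the guarantee holds for every realization of it
      (∃ γ : Pt m d → ℝ, Measurable γ ∧
        ∀ w, IsSubStepsize f p β μ σ (β - μ) w (K w) (γ w)) ∧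
      ∀ γ : Pt m d → ℝ, Measurable γ →
        (∀ w, IsSubStepsize f p β μ σ (β - μ) w (K w) (γ w)) →
      ∀ (Ω : Type*) [MeasurableSpace Ω] (P : Measure Ω) [IsProbabilityMeasure P]
        (S : ℕ → ℕ → Ω → StepSample n Ξ)
        (_ : ∀ t k, HasLaw (S t k) (stepLaw p π) P)
        (_ : iIndepFun (fun tk : ℕ × ℕ => S tk.1 tk.2) P),
      -- stopping criterion of the inner solver, at every meta-iteration `t` and every possible
      -- value `w` of the current meta-iterate
      (∀ (t : ℕ) (w : Pt m d),
        Integrable (fun ω => ‖subSolve f Ghat μ (β - μ) (γ w) (K w) w (fun k => S t k ω)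
          - prox (β - μ) (globalObjective f) w‖ ^ 2) P ∧
        ∫ ω, ‖subSolve f Ghat μ (β - μ) (γ w) (K w) w (fun k => S t k ω)
          - prox (β - μ) (globalObjective f) w‖ ^ 2 ∂P ≤ (μ / (2 * ((β - μ) + μ))) ^ 2 * ε) ∧
      -- accuracy of the output
      (Integrable (fun ω => ‖catalystIter f Ghat μ (β - μ) K γ z0 (fun t k => S t k ω) T
          - zstar‖ ^ 2) P ∧
        ∫ ω, ‖catalystIter f Ghat μ (β - μ) K γ z0 (fun t k => S t k ω) T
          - zstar‖ ^ 2 ∂P ≤ ε) ∧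
      -- expected number of communication rounds
      (Integrable (fun ω =>
          (catalystRounds f Ghat μ (β - μ) K γ z0 (fun t k => S t k ω) T : ℝ)) P ∧
        ∫ ω, (catalystRounds f Ghat μ (β - μ) K γ z0 (fun t k => S t k ω) T : ℝ) ∂P ≤
          C * Real.log (2 + β / μ + 1 / p + ‖z0 - zstar‖ ^ 2 / ε + σ ^ 2 / (μ ^ 2 * ε)) ^ q *
            (p * β * σ ^ 2 / (n * μ ^ 3 * ε) + Real.sqrt p * β * σ / (μ ^ 2 * Real.sqrt ε)
              + β / μ)) := by
  refine ⟨1500000, 2, by norm_num, ?_⟩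
  intro m d n hn f Ξ _ Ghat D _ π _ β μ σ p ε z0 zstar hμ hμβ hσ hp hp1 hε hs hc hest hπ hz
  have hβ : 0 < β := hμ.trans_le hμβ
  have hθ : 0 ≤ β - μ := by linarith
  have hGhat : ∀ i, Measurable (Function.uncurry (Ghat i)) := fun i => (hest i).measurable
  have hs0 : 0 ≤ σ / (μ * Real.sqrt ε) := by positivity
  have hM : 1 ≤ countFactor n p (σ / (μ * Real.sqrt ε)) :=
    le_trans (by norm_num) (le_countFactor hp hp1 hs0)
  have hKm : Measurable (innerCount f p β μ σ ε) := measurable_innerCount hn hμ hμβ hs hc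
  have hK1 : ∀ w, 1 ≤ innerCount f p β μ σ ε w := fun w => one_le_iterCount hM (by positivity)
  refine ⟨metaCount (β / μ) (‖z0 - zstar‖ ^ 2 / ε), innerCount f p β μ σ ε, hKm, hK1, ?_, ?_⟩
  · exact exists_measurable_subStepsize hn hμ hμβ hp hp1 hs hc hKm hK1
  intro γ hγm hγ Ω _ P _ S hlaw hind
  -- A law only makes the samples almost everywhere measurable. Measurable versions keep the laws
  -- and the independence, and the countably many exceptional sets form a null set.
  set S' : ℕ → ℕ → Ω → StepSample n Ξ := fun t k => (hlaw t k).aemeasurable.mk (S t k) with hS'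
  have hSm : ∀ t k, Measurable (S' t k) := fun t k => (hlaw t k).aemeasurable.measurable_mk
  have hae : ∀ t k, S t k =ᵐ[P] S' t k := fun t k => (hlaw t k).aemeasurable.ae_eq_mk
  have hlaw' : ∀ t k, P.map (S' t k) = stepLaw p π := fun t k => by
    rw [← (hlaw t k).map_eq, Measure.map_congr (hae t k)]
  have hind' : iIndepFun (fun tk : ℕ × ℕ => S' tk.1 tk.2) P :=
    hind.congr fun tk => hae tk.1 tk.2
  have hseq : ∀ t, (fun ω k => S t k ω) =ᵐ[P] fun ω k => S' t k ω := fun t => by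
    filter_upwards [ae_all_iff.2 (hae t)] with ω h
    exact funext h
  have hseq2 : (fun ω t k => S t k ω) =ᵐ[P] fun ω t k => S' t k ω := by
    filter_upwards [ae_all_iff.2 hseq] with ω h
    exact funext h
  have hacc : ∀ t w, ∫⁻ ω, ENNReal.ofReal (‖subSolve f Ghat μ (β - μ) (γ w)
      (innerCount f p β μ σ ε w) w (fun k => S' t k ω) - prox (β - μ) (globalObjective f) w‖ ^ 2) ∂P
        ≤ ENNReal.ofReal ((μ / (2 * β)) ^ 2 * ε) := fun t w =>
    lintegral_norm_subSolve_sub_sq_le hn hμ hμβ hσ hp hp1 hε hs hc hest hπ (hSm t) (hlaw' t)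
      (hind'.precomp (g := fun k => (t, k)) fun a b h => (Prod.mk.inj h).2) (hK1 w) (hγ w)
      (le_iterCount hM (by positivity))
  have hdist := lintegral_norm_catalystIter_sub_sq_le (z0 := z0) hn hμ hμβ hε hs hc hGhat hKm hγm
    hz hSm hind' hacc
  refine ⟨fun t w => ?_, ?_, ?_⟩
  · rw [sub_add_cancel]
    refine integrable_and_integral_le (hseq t)
      (Φ := fun s => ‖subSolve f Ghat μ (β - μ) (γ w) (innerCount f p β μ σ ε w) w s
        - prox (β - μ) (globalObjective f) w‖ ^ 2) (fun _ => by positivity) (by positivity) ?_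
      (hacc t w)
    exact ((measurable_subSolve_const hn hβ.le hs hGhat measurable_const measurable_const _
      (hSm t)).sub_const _).norm.pow_const 2
  · refine integrable_and_integral_le hseq2
      (Φ := fun s => ‖catalystIter f Ghat μ (β - μ) (innerCount f p β μ σ ε) γ z0 s
        (metaCount (β / μ) (‖z0 - zstar‖ ^ 2 / ε)) - zstar‖ ^ 2) (fun _ => by positivity) hε.le ?_
      ((hdist _).trans (ENNReal.ofReal_le_ofReal ?_))
    · exact ((measurable_catalystIter hn hβ.le hs hGhat hKm hγm _ fun s _ => hSm s).sub_const
        _).norm.pow_const 2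
    -- The initial error contributes at most `ε / 2` and the inner errors at most `ε / 4`.
    · have h := contraction_pow_metaCount_le (r := β / μ) (e := ‖z0 - zstar‖ ^ 2 / ε)
        ((one_le_div hμ).2 hμβ) (by positivity)
      rw [one_div_div, ← mul_div_assoc, div_le_iff₀ hε] at h
      linarith
  · obtain ⟨e, he⟩ : ∃ e, e = ‖z0 - zstar‖ ^ 2 / ε := ⟨_, rfl⟩
    obtain ⟨s, hsdef⟩ : ∃ s, s = σ / (μ * Real.sqrt ε) := ⟨_, rfl⟩
    obtain ⟨M, hMdef⟩ : ∃ M, M = countFactor n p s := ⟨_, rfl⟩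
    -- A bound, uniform in `t`, on the mean of the ratio in the count: every meta-iterate has mean
    -- squared distance at most `ε (e + 1 / 4)`. The linear term of the tangent line then costs at
    -- most `2 M`.
    obtain ⟨Rb, hRb⟩ : ∃ Rb, Rb = 4 * (β / μ) ^ 2 * (e + 1 / 4) := ⟨_, rfl⟩
    have he0 : 0 ≤ e := by rw [he]; positivity
    have hRb0 : 0 ≤ Rb := by rw [hRb]; positivity
    have hr1 : 1 ≤ β / μ := (one_le_div hμ).2 hμβ
    rw [← hsdef] at hs0 hM
    rw [← hMdef] at hM
    have hKle := innerCount_le hn hμ hμβ hσ hp hp1 hε hs hc hz hRb0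
    rw [← hsdef, ← hMdef] at hKle
    have hlogR : 0 ≤ Real.log (2 + Rb) := Real.log_nonneg (by linarith)
    have hlogM : 0 ≤ Real.log (6 * M) := Real.log_nonneg (by linarith)
    have hM0 : 0 ≤ M := by linarith
    have hdist' : ∀ t, ∫⁻ ω, ENNReal.ofReal (‖catalystIter f Ghat μ (β - μ)
        (innerCount f p β μ σ ε) γ z0 (fun s k => S' s k ω) t - zstar‖ ^ 2) ∂P
        ≤ ENNReal.ofReal (ε * (e + 1 / 4)) := fun t => by
      refine (hdist t).trans (ENNReal.ofReal_le_ofReal ?_)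
      have h1 : μ / β ≤ 1 := (div_le_one hβ).2 hμβ
      have h2 : 0 ≤ μ / β := by positivity
      have h3 : (1 - μ / β) ^ t ≤ 1 := pow_le_one₀ (by linarith) (by linarith)
      have h4 := mul_le_mul_of_nonneg_right h3 (sq_nonneg ‖z0 - zstar‖)
      have h5 : ε * e = ‖z0 - zstar‖ ^ 2 := by rw [he]; field_simp
      linarith
    have hrounds := lintegral_catalystRounds_le (π := π) hn hβ.le hs hGhat hKm hγm hp hSm hlaw'
      hind' (by positivity) (by positivity) (by positivity) hKle hdist'
      (metaCount (β / μ) (‖z0 - zstar‖ ^ 2 / ε))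
    have hfin := rounds_le hn hp hp1 hr1 he0 hs0
    have hs2 : s ^ 2 = σ ^ 2 / (μ ^ 2 * ε) := by
      rw [hsdef, div_pow, mul_pow, Real.sq_sqrt hε.le]
    have hb : 2 * M / (2 + Rb) * (4 * (β / μ) ^ 2 / ε) * (ε * (e + 1 / 4)) ≤ 2 * M := by
      have e1 : 2 * M / (2 + Rb) * (4 * (β / μ) ^ 2 / ε) * (ε * (e + 1 / 4))
          = 2 * M * (Rb / (2 + Rb)) := by
        rw [hRb]; field_simp
      have e2 : Rb / (2 + Rb) ≤ 1 := (div_le_one (by linarith)).2 (by linarith)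
      rw [e1]
      exact mul_le_of_le_one_right (by linarith) e2
    rw [← hMdef, ← hRb] at hfin
    have hcount : (metaCount (β / μ) e : ℝ) * (1 + p * ((1 + 2 * M * (Real.log (2 + Rb) + 2
        + 3 * Real.log (6 * M))) + 2 * M / (2 + Rb) * (4 * (β / μ) ^ 2 / ε) * (ε * (e + 1 / 4))))
        ≤ 1500000 * Real.log (2 + β / μ + 1 / p + ‖z0 - zstar‖ ^ 2 / ε + σ ^ 2 / (μ ^ 2 * ε)) ^ 2 *
            (p * β * σ ^ 2 / (n * μ ^ 3 * ε) + Real.sqrt p * β * σ / (μ ^ 2 * Real.sqrt ε)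
              + β / μ) := by
      have e1 : p * β * σ ^ 2 / (n * μ ^ 3 * ε) + Real.sqrt p * β * σ / (μ ^ 2 * Real.sqrt ε)
          + β / μ = β / μ * (p * s ^ 2 / n + Real.sqrt p * s + 1) := by
        rw [hs2, hsdef]
        field_simp
      rw [e1, ← he, ← hs2]
      refine le_trans ?_ hfin
      gcongr
    rw [← he] at hrounds ⊢
    rw [← he] at hcount
    refine integrable_and_integral_le hseq2
      (Φ := fun s => (catalystRounds f Ghat μ (β - μ) (innerCount f p β μ σ ε) γ z0 s
        (metaCount (β / μ) e) : ℝ)) (fun _ => by positivity) ?_ ?_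
      (hrounds.trans (ENNReal.ofReal_le_ofReal hcount))
    · refine le_trans ?_ hcount
      positivity
    · exact measurable_from_nat.comp (measurable_catalystRounds hn hβ.le hs hGhat hKm hγm hSm _)
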